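/- **Notation.** For a language $L\subseteq\{0,1\}^*$ and a class $\mathcal X$ write $L\in_{i.o.}\mathcal X$ if there is $L'\in\mathcal X$ with $L\cap\{0,1\}^k=L'\cap\{0,1\}^k$ for infinitely many $k$. $\mathrm{NE}$ is the class of languages decidable in nondeterministic time $2^{O(k)}$ on inputs of length $k$, and $L\in\mathrm{coNE}$ iff the complement of $L$ is in $\mathrm{NE}$. A language $L$ is in $(\mathrm{NP}\cap\mathrm{coNP})/\mathrm{poly}$ if there are polynomial-time predicates $F_0(x,y,z),F_1(x,y,z)$, a constant $c\ge 1$ and advice strings $w_k$ with $|w_k|\le k^c$ such that for all $x$ and all $z$ with $|z|\le|x|^c$ exactly one of $\exists y\,(|y|\le|x|^c\wedge F_0(x,y,z))$ and $\exists y\,(|y|\le|x|^c\wedge F_1(x,y,z))$ holds, and $x\in L$ iff $\exists y\,(|y|\le|x|^c\wedge F_1(x,y,w_{|x|}))$. $\mathrm{NP}/\mathrm{poly}$ is nondeterministic polynomial time with polynomial-length advice depending only on the input length. $\mathrm{TAUT}$ is the set of propositional tautologies in the DeMorgan language, encoded as binary strings. **Functions with unique witnesses.** $f:\{0,1\}^*\to\{0,1\}$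 is an $\mathrm{NP}\cap\mathrm{coNP}$ function with unique witnesses if there are polynomial-time relations $F_0,F_1$ and a constant $c$ such that for $a=0,1$: $f(u)=a$ iff $\exists y\,(|y|\le|u|^c\wedge F_a(u,y))$, and for each $u$ there is exactly one such $y$ for $a=f(u)$. The hardness $H_f(\ell)$ is the maximal $S\ge1$ such that every Boolean circuit $C$ with $\ell$ inputs and size at most $S$ satisfies $\Pr_{u\in\{0,1\}^\ell}[C(u)=f(u)]<\frac12+\frac1{2S}$ (and $0$ if there is none). **The Nisan–Wigderson generator.** For $0<\delta\le 1/3$ and $n\ge 1$ let $\ell=\lfloor n^{1/3}\rfloor$, $m(n)=2^{\lfloor n^\delta\rfloor}$ and $d=\log_2 m(n)$. For each such $\delta$ fix set systems $A_n=\{J_i\subseteq[n]\}_{i\in[m(n)]}$ with $|J_i|=\ell$ for all $i$ and $|J_i\cap J_j|\le d$ for $i\ne j$, such that $J_i$ is computable from $i$ and $1^{(n)}$ in polynomial time. $NW_{A_n,f}:\{0,1\}^n\to\{0,1\}^{m(n)}$ is the function whose $i$-th output bit at $x$ is $f(x_{j_1}\dots x_{j_\ell})$, where $J_i=\{j_1<\dots<j_\ell\}$,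 and $Rng(NW_{A,f})$ is the union of the ranges of $NW_{A_n,f}$ over $n\ge1$. **Conjecture 2.1 (for these set systems).** For every $\mathrm{NP}\cap\mathrm{coNP}$ function $f$ with unique witnesses and $H_f(\ell)=2^{\ell^{\Omega(1)}}$ there is $0<\delta\le1/3$ such that, for $m(n)=2^{\lfloor n^\delta\rfloor}$, every infinite $\mathrm{NP}$ set $R$ that has infinitely many elements whose length equals $m(n)$ for some $n\ge 1$ satisfies $Rng(NW_{A,f})\cap R\ne\emptyset$. **Exponentially hard one-way permutation.** A polynomial-time computable, length-preserving permutation $h$ of $\{0,1\}^*$ such that for some $a,b>0$ and all sufficiently large $\ell$, every circuit $D$ with $\ell$ inputs and size at most $2^{\ell^b}$ satisfies $\Pr_{v\in\{0,1\}^\ell}[D(h(v))=v]\le2^{-\ell^a}$. **Lemma 2.3.** For every choice of set systems as above: if Conjecture 2.1 holds for them and an exponentially hard one-way permutation exists, then for every $L\in\mathrm{NE}\cap\mathrm{coNE}$ we have $L\in_{i.o.}(\mathrm{NP}\cap\mathrm{coNP})/\mathrm{poly}$. In particular, $\mathrm{TAUT}\in_{i.o.}\mathrm{NP}/\mathrm{poly}$.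 -/

import Mathlib

open Filter

/-! ### Polynomial time

Binary words are `List Bool`, a language is a `Set (List Bool)`.  Polynomial time is Mathlib's:
a multi-stack Turing machine that, for some polynomial `p`, halts with the correct output within
`p N` steps on every input whose code has length `N`. -/

/-- `f` is computable by a deterministic polynomial-time Turing machine, with respect to given
encodings of its inputs and outputs. -/
def PolyTime {α β Γ₁ Γ₂ : Type} (ea : Computability.Encoding α Γ₁)
    (eb : Computability.Encoding β Γ₂) (f : α → β) : Prop :=
  Nonempty (Turing.TM2ComputableInPolyTime ea.encode eb.encode f)

/-- Binary words, written letter by letter. -/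
def wordEnc : Computability.Encoding (List Bool) Bool :=
  Computability.encodingList Bool

/-- Pairs of binary words (the two words are written over disjoint alphabets). -/
def wordEnc2 : Computability.Encoding (List Bool × List Bool) (Bool ⊕ Bool) :=
  Computability.encodingProd wordEnc wordEnc

/-- Triples of binary words. -/
def wordEnc3 :
    Computability.Encoding (List Bool × List Bool × List Bool) (Bool ⊕ (Bool ⊕ Bool)) :=
  Computability.encodingProd wordEnc wordEnc2

/-- A polynomial-time function on binary words. -/
def PolyTimeFun (f : List Bool → List Bool) : Prop :=
  PolyTime wordEnc wordEnc f

/-- A polynomial-time binary relation on binary words. -/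
def PolyTimeRel2 (F : List Bool → List Bool → Bool) : Prop :=
  PolyTime wordEnc2 Computability.encodingBoolBool
    (fun p : List Bool × List Bool => F p.1 p.2)

/-- A polynomial-time ternary relation on binary words. -/
def PolyTimeRel3 (F : List Bool → List Bool → List Bool → Bool) : Prop :=
  PolyTime wordEnc3 Computability.encodingBoolBool
    (fun p : List Bool × List Bool × List Bool => F p.1 p.2.1 p.2.2)

/-! ### Complexity classes -/

/-- The class `NP`: witnesses of polynomial length, verified in polynomial time. -/
def ClassNP : Set (Set (List Bool)) :=
  {L | ∃ (F : List Bool → List Bool → Bool) (c : ℕ), PolyTimeRel2 F ∧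
    ∀ x, x ∈ L ↔ ∃ y : List Bool, y.length ≤ x.length ^ c ∧ F x y = true}

/-- The class `NE`, i.e. non-deterministic time `2 ^ O(k)` on inputs of length `k`: witnesses of
length at most `2 ^ (c * k)`, verified in time polynomial in the joint length of the input and the
witness (so in time `2 ^ O(k)`; a witness may be padded up to the length bound, so all of the time
`2 ^ O(k)` is available to the verifier). -/
def ClassNE : Set (Set (List Bool)) :=
  {L | ∃ (F : List Bool → List Bool → Bool) (c : ℕ), PolyTimeRel2 F ∧
    ∀ x, x ∈ L ↔ ∃ y : List Bool, y.length ≤ 2 ^ (c * x.length) ∧ F x y = true}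

/-- The class `coNE`. -/
def ClassCoNE : Set (Set (List Bool)) :=
  {L | Lᶜ ∈ ClassNE}

/-- The class `NP/poly`: non-deterministic polynomial time with an advice word `w k`, of length
polynomial in `k`, for each input length `k`. -/
def ClassNPPoly : Set (Set (List Bool)) :=
  {L | ∃ (F : List Bool → List Bool → List Bool → Bool) (c : ℕ) (w : ℕ → List Bool),
    1 ≤ c ∧ PolyTimeRel3 F ∧ (∀ k, (w k).length ≤ k ^ c) ∧
    ∀ x, x ∈ L ↔ ∃ y : List Bool, y.length ≤ x.length ^ c ∧ F x y (w x.length) = true}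

/-- The class `(NP ∩ coNP)/poly`: two polynomial-time predicates `F₀(x, y, z)`, `F₁(x, y, z)` such
that for all `x` and *all* potential advice words `z` (with `|z| ≤ |x| ^ c`) exactly one of
`∃ y, F₀(x, y, z)` and `∃ y, F₁(x, y, z)` holds (with `|y| ≤ |x| ^ c`), together with a sequence of
advice words. -/
def ClassNPcoNPPoly : Set (Set (List Bool)) :=
  {L | ∃ (F₀ F₁ : List Bool → List Bool → List Bool → Bool) (c : ℕ) (w : ℕ → List Bool),
    1 ≤ c ∧ PolyTimeRel3 F₀ ∧ PolyTimeRel3 F₁ ∧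
    (∀ x z : List Bool, z.length ≤ x.length ^ c →
      Xor (∃ y : List Bool, y.length ≤ x.length ^ c ∧ F₀ x y z = true)
        (∃ y : List Bool, y.length ≤ x.length ^ c ∧ F₁ x y z = true)) ∧
    (∀ k, (w k).length ≤ k ^ c) ∧
    ∀ x, x ∈ L ↔ ∃ y : List Bool, y.length ≤ x.length ^ c ∧ F₁ x y (w x.length) = true}

/-- `L` is infinitely often in the class `X`: some member of `X` agrees with `L` on all words of
length `k`, for infinitely many `k`. -/
def InfinitelyOftenIn (L : Set (List Bool)) (X : Set (Set (List Bool))) : Prop :=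
  ∃ L' ∈ X, {k : ℕ | ∀ x : List Bool, x.length = k → (x ∈ L ↔ x ∈ L')}.Infinite

/-! ### Propositional tautologies -/

/-- Propositional formulas in the DeMorgan language, with variables named by binary words. -/
inductive PropForm : Type
  | const (b : Bool) : PropForm
  | var (w : List Bool) : PropForm
  | neg (φ : PropForm) : PropForm
  | and (φ ψ : PropForm) : PropForm
  | or (φ ψ : PropForm) : PropForm

/-- Truth value of a formula under an assignment. -/
def PropForm.eval (v : List Bool → Bool) : PropForm → Bool
  | .const b => b
  | .var w => v w
  | .neg φ => !(φ.eval v)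
  | .and φ ψ => φ.eval v && ψ.eval v
  | .or φ ψ => φ.eval v || ψ.eval v

/-- Binary code of a formula: prefix notation, with the prefix-free tags `00b` for the constant
`b`, `01` for a variable, `10` for a conjunction, `110` for a disjunction and `111` for a negation.
The name `b₁ … b_r` of a variable is written as `1 b₁ 1 b₂ … 1 b_r 0`.  As `φ ∧ 1` is longer than
`φ` by `5` bits and `¬ ¬ φ` by `6` bits, formulas can be padded to every sufficiently large
length; no length class is empty for a trivial reason. -/
def PropForm.code : PropForm → List Bool
  | .const b => [false, false, b]
  | .var w => [false, true] ++ w.flatMap (fun b => [true, b]) ++ [false]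
  | .and φ ψ => [true, false] ++ φ.code ++ ψ.code
  | .or φ ψ => [true, true, false] ++ φ.code ++ ψ.code
  | .neg φ => [true, true, true] ++ φ.code

/-- The language of (codes of) propositional tautologies. -/
def TAUT : Set (List Bool) :=
  {s | ∃ φ : PropForm, φ.code = s ∧ ∀ v, φ.eval v = true}

/-! ### Boolean circuits -/

/-- A gate: a binary Boolean operation applied to two earlier wires. -/
structure CircuitGate where
  op : Bool → Bool → Bool
  left : ℕ
  right : ℕ

/-- A Boolean circuit of fan-in two, as a straight-line program.  On an input of length `ℓ` the
wires `0, …, ℓ - 1` carry the input bits and the wire `ℓ + i` carries the value of the `i`-th gate.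
A wire that has not been computed yet reads as the constant `0`. -/
structure BoolCircuit where
  gates : List CircuitGate
  outputs : List ℕ

/-- The number of gates. -/
def BoolCircuit.size (C : BoolCircuit) : ℕ :=
  C.gates.length

/-- The values of all wires on input `x`. -/
def BoolCircuit.wires (C : BoolCircuit) (x : List Bool) : List Bool :=
  C.gates.foldl (fun w g => w ++ [g.op (w.getD g.left false) (w.getD g.right false)]) x

/-- The output of a circuit on input `x`. -/
def BoolCircuit.eval (C : BoolCircuit) (x : List Bool) : List Bool :=
  C.outputs.map (fun i => (C.wires x).getD i false)

/-! ### Hardness of functions and one-way permutations -/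

open Classical in
/-- The probability of an event over a uniformly random word of length `ℓ`. -/
noncomputable def wordProb (ℓ : ℕ) (E : List Bool → Prop) : ℝ :=
  ((Finset.univ.filter (fun v : Fin ℓ → Bool => E (List.ofFn v))).card : ℝ) / 2 ^ ℓ

/-- At input length `ℓ`, no circuit of size at most `S` agrees with `f` with probability at least
`1/2 + ε/2`. -/
def HardAt (f : List Bool → Bool) (ℓ : ℕ) (ε : ℝ) (S : ℕ) : Prop :=
  ∀ C : BoolCircuit, C.size ≤ S →
    wordProb ℓ (fun u => C.eval u = [f u]) < 1 / 2 + ε / 2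

/-- The Nisan–Wigderson hardness `H_f(ℓ)`: the largest `S ≥ 1` such that `f` is `(1/S, S)`-hard at
length `ℓ` (and `0` if there is none). -/
noncomputable def nwHardness (f : List Bool → Bool) (ℓ : ℕ) : ℕ∞ :=
  ⨆ (S : ℕ) (_ : 1 ≤ S ∧ HardAt f ℓ (1 / (S : ℝ)) S), (S : ℕ∞)

/-- `H_f(ℓ) = 2 ^ (ℓ ^ Ω(1))`. -/
def HasExpNWHardness (f : List Bool → Bool) : Prop :=
  ∃ ε : ℝ, 0 < ε ∧ ∀ᶠ ℓ : ℕ in atTop,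
    ((⌈(2 : ℝ) ^ ((ℓ : ℝ) ^ ε)⌉₊ : ℕ) : ℕ∞) ≤ nwHardness f ℓ

/-- At length `ℓ`, no circuit of size at most `t` inverts `h` with probability greater
than `ε`. -/
def OneWayAt (h : List Bool → List Bool) (ℓ : ℕ) (ε t : ℝ) : Prop :=
  ∀ D : BoolCircuit, (D.size : ℝ) ≤ t → wordProb ℓ (fun v => D.eval (h v) = v) ≤ ε

/-- An exponentially hard one-way permutation: a polynomial-time permutation of the binary words
that preserves lengths and is `2 ^ (-ℓ ^ Ω(1))` one-way with security parameter
`2 ^ (ℓ ^ Ω(1))`. -/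
def IsExpHardOneWayPermutation (h : List Bool → List Bool) : Prop :=
  PolyTimeFun h ∧ Function.Bijective h ∧ (∀ v, (h v).length = v.length) ∧
  ∃ a b : ℝ, 0 < a ∧ 0 < b ∧ ∀ᶠ ℓ : ℕ in atTop,
    OneWayAt h ℓ ((2 : ℝ) ^ (-((ℓ : ℝ) ^ a))) ((2 : ℝ) ^ ((ℓ : ℝ) ^ b))

/-- `f` is (the characteristic function of a language) in `NP ∩ coNP` with unique witnesses:
`f(u) = a` iff there is `y`, `|y| ≤ |u| ^ c`, with `F_a(u, y)`, and for each `u` there is exactly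
one witness for the value `f(u)`. -/
def IsNPcoNPUnique (f : List Bool → Bool) : Prop :=
  ∃ (F : Bool → List Bool → List Bool → Bool) (c : ℕ), (∀ a, PolyTimeRel2 (F a)) ∧
    (∀ u a, f u = a ↔ ∃ y : List Bool, y.length ≤ u.length ^ c ∧ F a u y = true) ∧
    ∀ u, ∃! y : List Bool, y.length ≤ u.length ^ c ∧ F (f u) u y = true

/-! ### The Nisan–Wigderson generator -/

/-- A `(d, ℓ)`-design on an `n`-element set, with `m` members. -/
def IsDesign {n m : ℕ} (J : Fin m → Finset (Fin n)) (d ℓ : ℕ) : Prop :=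
  (∀ i, (J i).card = ℓ) ∧ ∀ i j, i ≠ j → (J i ∩ J j).card ≤ d

/-- The block length `ℓ = n ^ (1/3)`, rounded down. -/
noncomputable def blockLen (n : ℕ) : ℕ :=
  ⌊(n : ℝ) ^ ((1 : ℝ) / 3)⌋₊

/-- `log m = n ^ δ`, rounded down. -/
noncomputable def logOut (δ : ℝ) (n : ℕ) : ℕ :=
  ⌊(n : ℝ) ^ δ⌋₊

/-- The output length `m(n) = 2 ^ (n ^ δ)`. -/
noncomputable def outLen (δ : ℝ) (n : ℕ) : ℕ :=
  2 ^ logOut δ n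

/-- The binary expansion of `i` with exactly `k` digits, least significant digit first. -/
def binaryWord (k i : ℕ) : List Bool :=
  List.ofFn (fun j : Fin k => i.testBit j)

/-- The characteristic word of length `n` of a subset of `[n]`. -/
def charWord {n : ℕ} (s : Finset (Fin n)) : List Bool :=
  List.ofFn (fun j : Fin n => decide (j ∈ s))

/-- For a given `δ`, a sequence of designs `A_n = {J_i ⊆ [n] : i ∈ [m]}` with `m = 2 ^ (n ^ δ)`,
`ℓ = n ^ (1/3)` and `d = log m`, such that `J_i` is computable in polynomial time from `i`
(in binary) and `n` (in unary). -/
structure DesignSequence (δ : ℝ) where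
  J : (n : ℕ) → Fin (outLen δ n) → Finset (Fin n)
  isDesign : ∀ n, IsDesign (J n) (logOut δ n) (blockLen n)
  feasible : ∃ g : List Bool × ℕ → List Bool,
    PolyTime (Computability.encodingProd wordEnc Computability.unaryEncodingNat) wordEnc g ∧
    ∀ n i, g (binaryWord (logOut δ n) i.val, n) = charWord (J n i)

/-- The word `x(J) = x_{j_1} … x_{j_ℓ}`, where `J = {j_1 < … < j_ℓ}`. -/
def restrictWord {n : ℕ} (x : Fin n → Bool) (J : Finset (Fin n)) : List Bool :=
  (J.sort (· ≤ ·)).map x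

/-- The Nisan–Wigderson generator `{0,1}^n → {0,1}^m`; the `i`-th bit of its value at `x` is
`f(x(J_i))`. -/
def nwGen {n m : ℕ} (J : Fin m → Finset (Fin n)) (f : List Bool → Bool)
    (x : Fin n → Bool) : List Bool :=
  List.ofFn (fun i : Fin m => f (restrictWord x (J i)))

/-- The range of the generator (over all seed lengths `n ≥ 1`). -/
def nwRange {δ : ℝ} (A : DesignSequence δ) (f : List Bool → Bool) : Set (List Bool) :=
  {b | ∃ n, 1 ≤ n ∧ ∃ x : Fin n → Bool, b = nwGen (A.J n) f x}

/-- The proof complexity conjecture on the Nisan–Wigderson generator, for a fixed choice of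
designs: for every `NP ∩ coNP` function `f` with unique witnesses and with exponential
Nisan–Wigderson hardness there is `δ` such that the range of the generator meets every infinite
`NP` set that has infinitely many elements whose lengths are of the form `m(n)`, `n ≥ 1`. -/
def NWConjecture (A : (δ : Set.Ioc (0 : ℝ) (1 / 3)) → DesignSequence (δ : ℝ)) : Prop :=
  ∀ f : List Bool → Bool, IsNPcoNPUnique f → HasExpNWHardness f →
    ∃ δ : Set.Ioc (0 : ℝ) (1 / 3), ∀ R ∈ ClassNP,
      {z ∈ R | ∃ n, 1 ≤ n ∧ z.length = outLen δ n}.Infinite →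
      (nwRange (A δ) f ∩ R).Nonempty

/-! Let `h` be the one-way permutation and let `f` be its Goldreich–Levin bit `hardCore h`: a word
is split into halves u₁ and r, and `f` is the inner product modulo 2 of r with the preimage of u₁
under `h`. That preimage certifies either value of `f`, and it is unique because `h` is a
permutation, so `f` is an NP ∩ coNP function with unique witnesses (`isNPcoNPUnique_hardCore`). A
circuit predicting `f` with advantage 1/S can be turned, by decoding noisy linear forms, into a
circuit that inverts `h` with probability 1/poly(q, S) on words of length q (`exists_inverter`);
hence `f` is exponentially hard (`hasExpNWHardness_hardCore`). The conjecture applies to `f` and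
yields a δ that does not depend on any NP set.

Let L be in NE ∩ coNE. Its truth table on words of length k has length 2^k, and witnesses of length
2^{O(k)} for L or its complement are polynomial in that length. Guessing a witness for every entry
shows that the truth tables with k ≥ K₀ form an NP set (`setOf_truthTable_mem_NP`). It has elements
of infinitely many of the lengths m(n), so it meets the range of the generator. As K₀ is arbitrary
and δ is fixed, infinitely many truth tables are outputs of the generator.

If the table for k is the output on a seed X of length n, then k = ⌊n^δ⌋, so n is polynomial in k
(`le_logOut_pow`) and X can serve as advice: membership of the i-th word is the value of `f` at the
restriction of X to J_i, where J_i is computable in polynomial time and `f` is in NP ∩ coNP. Since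
`f` is total, exactly one of the two predicates accepts for every advice word, not only for the
right one (`exists_advice_predicates`, `infinitelyOftenIn_of_truthTable_eq_nwGen`).

The statement on TAUT follows because TAUT is in NE by exhaustive search (`TAUT_mem_NE`) and its
complement by guessing a falsifying assignment (`compl_TAUT_mem_NE`).

Polynomial time is established on actual Turing machines. A small language of stack programs with
subroutine calls is compiled to machines (`Exec.outputs`), which gives closure under composition,
pairing, case distinction and bounded iteration. The predicate `FPoly` packages this as an algebra
of functions in which folds over lists do most of the work. -/

/-! ### A structured language for multi-stack machines -/

namespace StackProg

open Turing

section Language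

variable {ι : Type} (tm : ι → FinTM2) {K : Type} (Γ : K → Type)

/-- Structured programs over a family of stacks, which may call the machines `tm i` as
subroutines. -/
inductive Cmd : Type
  | push (k : K) (l : List (Γ k)) : Cmd
  | seq (c d : Cmd) : Cmd
  | case (k : K) (c : Cmd) (d : Γ k → Cmd) : Cmd
  | loop (k : K) (d : Γ k → Cmd) : Cmd
  | call (i : ι) (src dst : K) (inp : Γ src → (tm i).Γ (tm i).k₀)
      (out : (tm i).Γ (tm i).k₁ → Γ dst) : Cmd

/-- The stacks available to the compiled program. -/
abbrev Idx : Type := K ⊕ Σ i, (tm i).K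

/-- The alphabets of the compiled program. -/
abbrev Alph : Idx tm (K := K) → Type
  | .inl k => Γ k
  | .inr ⟨i, k⟩ => (tm i).Γ k

/-- The internal state of the compiled program: one register for each stack, and the states of the
subroutines. -/
abbrev St : Type := (∀ k, Option (Γ k)) × ∀ i, (tm i).σ

variable {tm Γ}

/-- The labels of the compiled program. -/
def Cmd.Lab : Cmd tm Γ → Type
  | .push _ _ => Unit
  | .seq c d => c.Lab ⊕ d.Lab
  | .case k c d => Option (c.Lab ⊕ Σ a : Γ k, (d a).Lab)
  | .loop k d => Option (Σ a : Γ k, (d a).Lab)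
  | .call i src dst _ _ => (tm i).Λ ⊕ (Option (Γ src) ⊕ Option (Γ dst))

noncomputable instance Cmd.labFintype [∀ k, Fintype (Γ k)] : (c : Cmd tm Γ) → Fintype c.Lab
  | .push _ _ => inferInstanceAs (Fintype Unit)
  | .seq c d =>
    letI := c.labFintype
    letI := d.labFintype
    inferInstanceAs (Fintype (c.Lab ⊕ d.Lab))
  | .case k c d =>
    letI := c.labFintype
    letI := fun a => (d a).labFintype
    inferInstanceAs (Fintype (Option (c.Lab ⊕ Σ a : Γ k, (d a).Lab)))
  | .loop k d =>
    letI := fun a => (d a).labFintype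
    inferInstanceAs (Fintype (Option (Σ a : Γ k, (d a).Lab)))
  | .call i src dst _ _ =>
    letI := (tm i).ΛFin
    inferInstanceAs (Fintype ((tm i).Λ ⊕ (Option (Γ src) ⊕ Option (Γ dst))))

/-- The entry label of a program. -/
def Cmd.entry : (c : Cmd tm Γ) → c.Lab
  | .push _ _ => ()
  | .seq c _ => .inl c.entry
  | .case _ _ _ => none
  | .loop _ _ => none
  | .call _ _ _ _ _ => .inr (.inl none)

section

variable [DecidableEq ι] {L : Type}

/-- A statement of a subroutine, run inside the compiled program. -/
def liftStmt (i : ι) (inj : (tm i).Λ → L) (next : TM2.Stmt (Alph tm Γ) L (St tm Γ)) :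
    TM2.Stmt (tm i).Γ (tm i).Λ (tm i).σ → TM2.Stmt (Alph tm Γ) L (St tm Γ)
  | .push k f q => .push (.inr ⟨i, k⟩) (fun s => f (s.2 i)) (liftStmt i inj next q)
  | .peek k f q => .peek (.inr ⟨i, k⟩)
      (fun s o => (s.1, Function.update s.2 i (f (s.2 i) o))) (liftStmt i inj next q)
  | .pop k f q => .pop (.inr ⟨i, k⟩)
      (fun s o => (s.1, Function.update s.2 i (f (s.2 i) o))) (liftStmt i inj next q)
  | .load f q => .load (fun s => (s.1, Function.update s.2 i (f (s.2 i))))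
      (liftStmt i inj next q)
  | .branch p q r => .branch (fun s => p (s.2 i)) (liftStmt i inj next q) (liftStmt i inj next r)
  | .goto f => .goto (fun s => inj (f (s.2 i)))
  -- Halting continues with `next` within the same step, so that returning from a call costs no
  -- extra step.
  | .halt => next

/-- Pushing a list, first element first. -/
def pushAll (k : K) (next : TM2.Stmt (Alph tm Γ) L (St tm Γ)) :
    List (Γ k) → TM2.Stmt (Alph tm Γ) L (St tm Γ)
  | [] => next
  | a :: l => .push (.inl k) (fun _ => a) (pushAll k next l)

variable [DecidableEq K]

/-- The code of a subroutine call: load the input, run the machine, unload the output. -/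
def callCode {L : Type} {i : ι} (src dst : K) (inp : Γ src → (tm i).Γ (tm i).k₀)
    (out : (tm i).Γ (tm i).k₁ → Γ dst) (inj : (tm i).Λ ⊕ (Option (Γ src) ⊕ Option (Γ dst)) → L)
    (next : TM2.Stmt (Alph tm Γ) L (St tm Γ)) :
    (tm i).Λ ⊕ (Option (Γ src) ⊕ Option (Γ dst)) → TM2.Stmt (Alph tm Γ) L (St tm Γ)
  | .inl x =>
    liftStmt i (fun y => inj (.inl y)) (.goto fun _ => inj (.inr (.inr none))) ((tm i).m x)
  | .inr (.inl none) =>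
    .pop (.inl src) (fun s o => (Function.update s.1 src o, s.2))
      (.goto fun s => match s.1 src with
        | none => inj (.inl (tm i).main)
        | some a => inj (.inr (.inl (some a))))
  | .inr (.inl (some a)) =>
    .push (.inr ⟨i, (tm i).k₀⟩) (fun _ => inp a) (.goto fun _ => inj (.inr (.inl none)))
  | .inr (.inr none) =>
    .pop (.inr ⟨i, (tm i).k₁⟩) (fun s o => (Function.update s.1 dst (o.map out), s.2))
      (.branch (fun s => (s.1 dst).isNone) next
        (.goto fun s => inj (.inr (.inr (s.1 dst)))))
  | .inr (.inr (some b)) =>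
    .push (.inl dst) (fun _ => b) (.goto fun _ => inj (.inr (.inr none)))

/-- The statements of the compiled program, followed by the statement `next`. -/
def Cmd.code {L : Type} : (c : Cmd tm Γ) → (inj : c.Lab → L) →
    (next : TM2.Stmt (Alph tm Γ) L (St tm Γ)) → c.Lab → TM2.Stmt (Alph tm Γ) L (St tm Γ)
  | .push k l, _, next, _ => pushAll k next l
  | .seq c d, inj, _, .inl x =>
    c.code (fun y => inj (.inl y)) (.goto fun _ => inj (.inr d.entry)) x
  | .seq _ d, inj, next, .inr x => d.code (fun y => inj (.inr y)) next x
  | .case k c d, inj, _, none =>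
    .pop (.inl k) (fun s o => (Function.update s.1 k o, s.2))
      (.goto fun s => match s.1 k with
        | none => inj (some (.inl c.entry))
        | some a => inj (some (.inr ⟨a, (d a).entry⟩)))
  | .case _ c _, inj, next, some (.inl x) => c.code (fun y => inj (some (.inl y))) next x
  | .case _ _ d, inj, next, some (.inr ⟨a, x⟩) =>
    (d a).code (fun y => inj (some (.inr ⟨a, y⟩))) next x
  | .loop k d, inj, next, none =>
    .pop (.inl k) (fun s o => (Function.update s.1 k o, s.2))
      (.branch (fun s => (s.1 k).isNone) next
        (.goto fun s => match s.1 k with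
          | none => inj none
          | some a => inj (some ⟨a, (d a).entry⟩)))
  | .loop _ d, inj, _, some ⟨a, x⟩ =>
    (d a).code (fun y => inj (some ⟨a, y⟩)) (.goto fun _ => inj none) x
  | .call _ src dst inp out, inj, next, x => callCode src dst inp out inj next x

/-! ### Simulation of single statements inside the compiled program. -/

variable (tm Γ) in
/-- The whole store of the compiled program. -/
def full (O : ∀ k, List (Γ k)) (T : ∀ i k, List ((tm i).Γ k)) :
    ∀ k : Idx tm (K := K), List (Alph tm Γ k)
  | .inl k => O k
  | .inr ⟨i, k⟩ => T i k

theorem update_full_inl (O : ∀ k, List (Γ k)) (T : ∀ i k, List ((tm i).Γ k)) (k : K)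
    (x : List (Γ k)) :
    Function.update (full tm Γ O T) (.inl k) x = full tm Γ (Function.update O k x) T := by
  funext j
  rcases j with j | ⟨i, j⟩
  · by_cases h : j = k
    · subst h; simp [full]
    · rw [Function.update_of_ne (by simpa using h)]
      simp [full, Function.update_of_ne h]
  · rw [Function.update_of_ne (by simp)]; rfl

theorem update_full_inr (O : ∀ k, List (Γ k)) (T : ∀ i k, List ((tm i).Γ k)) (i : ι)
    (k : (tm i).K) (x : List ((tm i).Γ k)) :
    Function.update (full tm Γ O T) (.inr ⟨i, k⟩) x =
      full tm Γ O (Function.update T i (Function.update (T i) k x)) := by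
  funext j
  rcases j with j | ⟨i', j⟩
  · rw [Function.update_of_ne (by simp)]; rfl
  · by_cases h : i' = i
    · subst h
      by_cases h : j = k
      · subst h; simp [full]
      · rw [Function.update_of_ne (by simpa using h)]
        simp [full, Function.update_of_ne h]
    · rw [Function.update_of_ne (by rintro ⟨⟩; exact h rfl)]
      simp [full, Function.update_of_ne h]

/-- A lifted statement touches only the state and the stacks of machine `i`, so its effect can be
read off from the original statement. -/
theorem stepAux_liftStmt (i : ι) (inj : (tm i).Λ → L)
    (next : TM2.Stmt (Alph tm Γ) L (St tm Γ)) (q : TM2.Stmt (tm i).Γ (tm i).Λ (tm i).σ)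
    (r : ∀ k, Option (Γ k)) (v : ∀ i, (tm i).σ) (O : ∀ k, List (Γ k))
    (T : ∀ i k, List ((tm i).Γ k)) :
    TM2.stepAux (liftStmt i inj next q) (r, v) (full tm Γ O T) =
      match TM2.stepAux q (v i) (T i) with
      | ⟨some l, v', T'⟩ =>
        ⟨some (inj l), (r, Function.update v i v'), full tm Γ O (Function.update T i T')⟩
      | ⟨none, v', T'⟩ =>
        TM2.stepAux next (r, Function.update v i v') (full tm Γ O (Function.update T i T')) := by
  induction q generalizing v T with
  | push k f q ih =>
    simp only [liftStmt, TM2.stepAux]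
    rw [update_full_inr, ih]
    simp [full]
  | peek k f q ih =>
    simp only [liftStmt, TM2.stepAux]
    rw [ih]
    simp [full]
  | pop k f q ih =>
    simp only [liftStmt, TM2.stepAux]
    rw [update_full_inr, ih]
    simp [full]
  | load f q ih =>
    simp only [liftStmt, TM2.stepAux]
    rw [ih]
    simp
  | branch p q r ih₁ ih₂ =>
    simp only [liftStmt, TM2.stepAux]
    cases h : p (v i)
    · simpa using ih₂ v T
    · simpa using ih₁ v T
  | goto f => simp [liftStmt, TM2.stepAux]
  | halt => simp [liftStmt, TM2.stepAux]

theorem stepAux_pushAll (k : K) (next : TM2.Stmt (Alph tm Γ) L (St tm Γ)) (l : List (Γ k))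
    (s : St tm Γ) (O : ∀ k, List (Γ k)) (T : ∀ i k, List ((tm i).Γ k)) :
    TM2.stepAux (pushAll k next l) s (full tm Γ O T) =
      TM2.stepAux next s (full tm Γ (Function.update O k (l.reverse ++ O k)) T) := by
  induction l generalizing O with
  | nil => simp [pushAll]
  | cons a l ih =>
    simp only [pushAll, TM2.stepAux]
    rw [update_full_inl, ih]
    simp [full]

/-- A machine with program `M` goes from `a` to `b` within `t` steps. -/
def Reach {L : Type} {K : Type} [DecidableEq K] {Γ : K → Type} {σ : Type}
    (M : L → TM2.Stmt Γ L σ) (a b : TM2.Cfg Γ L σ) (t : ℕ) : Prop :=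
  ∃ n ≤ t, (flip Bind.bind (TM2.step M))^[n] (some a) = some b

section Reach

variable {L : Type} {K : Type} [DecidableEq K] {Γ : K → Type} {σ : Type}
  {M : L → TM2.Stmt Γ L σ}

theorem Reach.refl (a : TM2.Cfg Γ L σ) (t : ℕ) : Reach M a a t := ⟨0, Nat.zero_le _, rfl⟩

theorem Reach.trans {a b c : TM2.Cfg Γ L σ} {t t' : ℕ} (h : Reach M a b t)
    (h' : Reach M b c t') : Reach M a c (t + t') := by
  obtain ⟨n, hn, e⟩ := h
  obtain ⟨m, hm, e'⟩ := h'
  exact ⟨m + n, by omega, by rw [Function.iterate_add_apply, e, e']⟩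

theorem Reach.mono {a b : TM2.Cfg Γ L σ} {t t' : ℕ} (h : Reach M a b t) (ht : t ≤ t') :
    Reach M a b t' := by
  obtain ⟨n, hn, e⟩ := h
  exact ⟨n, hn.trans ht, e⟩

theorem Reach.step (l : L) (v : σ) (S : ∀ k, List (Γ k)) :
    Reach M ⟨some l, v, S⟩ (TM2.stepAux (M l) v S) 1 :=
  ⟨1, le_rfl, rfl⟩

theorem Reach.step' {l : L} {v : σ} {S : ∀ k, List (Γ k)} {b c : TM2.Cfg Γ L σ} {t : ℕ}
    (hb : TM2.stepAux (M l) v S = b) (h : Reach M b c t) :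
    Reach M ⟨some l, v, S⟩ c (t + 1) := by
  subst hb
  rw [add_comm]
  exact (Reach.step l v S).trans h

end Reach

end

variable [DecidableEq K]

/-- Big-step semantics of programs, with a bound on the running time. -/
inductive Exec : Cmd tm Γ → (∀ k, List (Γ k)) → (∀ k, List (Γ k)) → ℕ → Prop
  | push (k l O) : Exec (.push k l) O (Function.update O k (l.reverse ++ O k)) 1
  | seq {c d O₁ O₂ O₃ t₁ t₂} : Exec c O₁ O₂ t₁ → Exec d O₂ O₃ t₂ →
      Exec (.seq c d) O₁ O₃ (t₁ + t₂)
  | case_nil {k c d O O' t} : O k = [] → Exec c O O' t → Exec (.case k c d) O O' (t + 1)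
  | case_cons {k c d O O' t a l} : O k = a :: l → Exec (d a) (Function.update O k l) O' t →
      Exec (.case k c d) O O' (t + 1)
  | loop_nil {k d O} : O k = [] → Exec (.loop k d) O O 1
  | loop_cons {k d O₁ O₂ O₃ t₁ t₂ a l} : O₁ k = a :: l →
      Exec (d a) (Function.update O₁ k l) O₂ t₁ → Exec (.loop k d) O₂ O₃ t₂ →
      Exec (.loop k d) O₁ O₃ (t₁ + t₂ + 1)
  | call {i src dst inp out O l t} :
      Nonempty (TM2OutputsInTime (tm i) ((O src).reverse.map inp) (some l) t) →
      Exec (.call i src dst inp out) O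
        (Function.update (Function.update O src []) dst
          ((l.map out).reverse ++ (Function.update O src []) dst))
        (2 * (O src).length + t + 2 * l.length + 2)

/-! ### Correctness of the compiled programs. -/

theorem initList_stk (M : FinTM2) (s : List (M.Γ M.k₀)) :
    (initList M s).stk = Function.update (fun _ => []) M.k₀ s := by
  funext k
  by_cases h : k = M.k₀
  · subst h; simp [initList]
  · simp [initList, h]

theorem haltList_stk (M : FinTM2) (s : List (M.Γ M.k₁)) :
    (haltList M s).stk = Function.update (fun _ => []) M.k₁ s := by
  funext k
  by_cases h : k = M.k₁
  · subst h; simp [haltList]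
  · simp [haltList, h]

theorem iterate_none {σ : Type} (f : σ → Option σ) (n : ℕ) :
    (flip Bind.bind f)^[n] (none : Option σ) = none := by
  induction n with
  | zero => rfl
  | succ n ih => rw [Function.iterate_succ_apply]; exact ih

variable [DecidableEq ι]

variable (tm) in
/-- The initial states of the subroutines. -/
def initStates : ∀ i, (tm i).σ := fun i => (tm i).initialState

variable (tm) in
/-- Empty internal stacks of the subroutines. -/
def emptyStacks : ∀ i k, List ((tm i).Γ k) := fun _ _ => []

/-- Induction on the number of steps. A run cannot end after zero steps, because its first
configuration has a label and its last has none; and after halting no further step is possible, so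
the halting step is the last one. -/
theorem reach_run {L : Type} {M : L → TM2.Stmt (Alph tm Γ) L (St tm Γ)} {i : ι}
    {inj : (tm i).Λ → L} {next : TM2.Stmt (Alph tm Γ) L (St tm Γ)}
    (hM : ∀ x, M (inj x) = liftStmt i inj next ((tm i).m x))
    (r : ∀ k, Option (Γ k)) (O : ∀ k, List (Γ k)) (n : ℕ) :
    ∀ (l : (tm i).Λ) (v : ∀ i, (tm i).σ) (T : ∀ i k, List ((tm i).Γ k))
      (v' : (tm i).σ) (T' : ∀ k, List ((tm i).Γ k)),
      (flip Bind.bind (TM2.step (tm i).m))^[n] (some ⟨some l, v i, T i⟩) = some ⟨none, v', T'⟩ →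
      Reach M ⟨some (inj l), (r, v), full tm Γ O T⟩
        (TM2.stepAux next (r, Function.update v i v') (full tm Γ O (Function.update T i T')))
        n := by
  induction n with
  | zero =>
    intro l v T v' T' h
    simp at h
  | succ n ih =>
    intro l v T v' T' h
    rw [Function.iterate_succ_apply] at h
    have h' : (flip Bind.bind (TM2.step (tm i).m))^[n]
      (some (TM2.stepAux ((tm i).m l) (v i) (T i))) = some ⟨none, v', T'⟩ := h
    have e := stepAux_liftStmt i inj next ((tm i).m l) r v O T
    rw [← hM] at e
    rcases hs : TM2.stepAux ((tm i).m l) (v i) (T i) with ⟨_ | l₁, v₁, T₁⟩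
    · rw [hs] at h' e
      cases n with
      | zero =>
        simp only [Function.iterate_zero, id, Option.some.injEq] at h'
        cases h'
        exact Reach.step' e (Reach.refl _ _)
      | succ n =>
        rw [Function.iterate_succ_apply] at h'
        have := iterate_none (TM2.step (tm i).m) n
        exact absurd (this.symm.trans h') (by simp)
    · rw [hs] at h' e
      refine Reach.step' e ?_
      have := ih l₁ (Function.update v i v₁) (Function.update T i T₁) v' T' (by simpa using h')
      simpa using this

/-- Each letter costs a pop and a push, and the test for emptiness costs one more step. The transfer
reverses the word, which is why `Exec.call` feeds the machine the reversed contents of `src`. -/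
theorem reach_load {L : Type} {M : L → TM2.Stmt (Alph tm Γ) L (St tm Γ)}
    {i : ι} {src dst : K} {inp : Γ src → (tm i).Γ (tm i).k₀}
    {out : (tm i).Γ (tm i).k₁ → Γ dst} {inj : (tm i).Λ ⊕ (Option (Γ src) ⊕ Option (Γ dst)) → L}
    {next : TM2.Stmt (Alph tm Γ) L (St tm Γ)}
    (hM : ∀ x, M (inj x) = callCode src dst inp out inj next x) (l : List (Γ src)) :
    ∀ (m : List ((tm i).Γ (tm i).k₀)) (r : ∀ k, Option (Γ k)) (v : ∀ i, (tm i).σ)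
      (O : ∀ k, List (Γ k)) (T : ∀ i k, List ((tm i).Γ k)), O src = l → T i (tm i).k₀ = m →
    ∃ r', Reach M ⟨some (inj (.inr (.inl none))), (r, v), full tm Γ O T⟩
      ⟨some (inj (.inl (tm i).main)), (r', v), full tm Γ (Function.update O src [])
        (Function.update T i (Function.update (T i) (tm i).k₀ (l.reverse.map inp ++ m)))⟩
      (2 * l.length + 1) := by
  induction l with
  | nil =>
    intro m r v O T hO hT
    refine ⟨Function.update r src none, Reach.step' ?_ (Reach.refl _ _)⟩
    rw [hM]
    simp only [callCode, TM2.stepAux]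
    rw [update_full_inl]
    subst hT
    simp [full, hO]
  | cons a l ih =>
    intro m r v O T hO hT
    obtain ⟨r', h⟩ := ih (inp a :: m) (Function.update r src (some a)) v
      (Function.update O src l)
      (Function.update T i (Function.update (T i) (tm i).k₀ (inp a :: m))) (by simp) (by simp)
    refine ⟨r', ?_⟩
    have h1 : TM2.stepAux (M (inj (.inr (.inl none)))) (r, v) (full tm Γ O T) =
        ⟨some (inj (.inr (.inl (some a)))), (Function.update r src (some a), v),
          full tm Γ (Function.update O src l) T⟩ := by
      rw [hM]
      simp only [callCode, TM2.stepAux]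
      rw [update_full_inl]
      simp [full, hO]
    have h2 : TM2.stepAux (M (inj (.inr (.inl (some a))))) (Function.update r src (some a), v)
        (full tm Γ (Function.update O src l) T) =
        ⟨some (inj (.inr (.inl none))), (Function.update r src (some a), v),
          full tm Γ (Function.update O src l)
          (Function.update T i (Function.update (T i) (tm i).k₀ (inp a :: m)))⟩ := by
      rw [hM]
      simp only [callCode, TM2.stepAux]
      rw [update_full_inr]
      simp [full, hT]
    have h3 := Reach.step' h1 (Reach.step' h2 h)
    simp only [Function.update_idem, Function.update_self] at h3
    simpa [mul_add, add_assoc] using h3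

theorem reach_unload {L : Type} {M : L → TM2.Stmt (Alph tm Γ) L (St tm Γ)}
    {i : ι} {src dst : K} {inp : Γ src → (tm i).Γ (tm i).k₀}
    {out : (tm i).Γ (tm i).k₁ → Γ dst} {inj : (tm i).Λ ⊕ (Option (Γ src) ⊕ Option (Γ dst)) → L}
    {next : TM2.Stmt (Alph tm Γ) L (St tm Γ)}
    (hM : ∀ x, M (inj x) = callCode src dst inp out inj next x)
    (l : List ((tm i).Γ (tm i).k₁)) :
    ∀ (m : List (Γ dst)) (r : ∀ k, Option (Γ k)) (v : ∀ i, (tm i).σ)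
      (O : ∀ k, List (Γ k)) (T : ∀ i k, List ((tm i).Γ k)), O dst = m → T i (tm i).k₁ = l →
    ∃ r', Reach M ⟨some (inj (.inr (.inr none))), (r, v), full tm Γ O T⟩
      (TM2.stepAux next (r', v) (full tm Γ (Function.update O dst ((l.map out).reverse ++ m))
        (Function.update T i (Function.update (T i) (tm i).k₁ []))))
      (2 * l.length + 1) := by
  induction l with
  | nil =>
    intro m r v O T hO hT
    refine ⟨Function.update r dst none, Reach.step' ?_ (Reach.refl _ _)⟩
    rw [hM]
    simp only [callCode, TM2.stepAux]
    rw [update_full_inr]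
    subst hO
    simp [full, hT]
  | cons a l ih =>
    intro m r v O T hO hT
    obtain ⟨r', h⟩ := ih (out a :: m) (Function.update r dst (some (out a))) v
      (Function.update O dst (out a :: m))
      (Function.update T i (Function.update (T i) (tm i).k₁ l)) (by simp) (by simp)
    refine ⟨r', ?_⟩
    have h1 : TM2.stepAux (M (inj (.inr (.inr none)))) (r, v) (full tm Γ O T) =
        ⟨some (inj (.inr (.inr (some (out a))))), (Function.update r dst (some (out a)), v),
          full tm Γ O (Function.update T i (Function.update (T i) (tm i).k₁ l))⟩ := by
      rw [hM]
      simp only [callCode, TM2.stepAux]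
      rw [update_full_inr]
      simp [full, hT]
    have h2 : TM2.stepAux (M (inj (.inr (.inr (some (out a))))))
        (Function.update r dst (some (out a)), v)
        (full tm Γ O (Function.update T i (Function.update (T i) (tm i).k₁ l))) =
        ⟨some (inj (.inr (.inr none))), (Function.update r dst (some (out a)), v),
          full tm Γ (Function.update O dst (out a :: m))
          (Function.update T i (Function.update (T i) (tm i).k₁ l))⟩ := by
      rw [hM]
      simp only [callCode, TM2.stepAux]
      rw [update_full_inl]
      simp [full, hO]
    have h3 := Reach.step' h1 (Reach.step' h2 h)
    simp only [Function.update_idem, Function.update_self] at h3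
    simpa [mul_add, add_assoc] using h3

/-- The compiled program follows the big-step semantics. -/
theorem Exec.reach {c : Cmd tm Γ} {O O' : ∀ k, List (Γ k)} {t : ℕ} (h : Exec c O O' t) :
    ∀ {L : Type} (M : L → TM2.Stmt (Alph tm Γ) L (St tm Γ)) (inj : c.Lab → L)
      (next : TM2.Stmt (Alph tm Γ) L (St tm Γ)) (_ : ∀ x, M (inj x) = c.code inj next x)
      (r : ∀ k, Option (Γ k)),
      ∃ r', Reach M ⟨some (inj c.entry), (r, initStates tm), full tm Γ O (emptyStacks tm)⟩
        (TM2.stepAux next (r', initStates tm) (full tm Γ O' (emptyStacks tm))) t := by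
  induction h with
  | push k l O =>
    intro L M inj next hM r
    refine ⟨r, Reach.step' ?_ (Reach.refl _ _)⟩
    rw [hM, Cmd.code, stepAux_pushAll]
  | seq _ _ ih₁ ih₂ =>
    intro L M inj next hM r
    obtain ⟨r₁, h₁⟩ := ih₁ M (fun y => inj (.inl y)) (.goto fun _ => inj (.inr (Cmd.entry _)))
      (fun x => hM (.inl x)) r
    obtain ⟨r₂, h₂⟩ := ih₂ M (fun y => inj (.inr y)) next (fun x => hM (.inr x)) r₁
    exact ⟨r₂, h₁.trans h₂⟩
  | @case_nil k c d O O' t hO _ ih =>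
    intro L M inj next hM r
    obtain ⟨r₁, h₁⟩ := ih M (fun y => inj (some (.inl y))) next
      (fun x => hM (some (.inl x))) (Function.update r k none)
    refine ⟨r₁, Reach.step' ?_ h₁⟩
    rw [hM]
    simp only [Cmd.entry, Cmd.code, TM2.stepAux]
    rw [update_full_inl]
    have e : Function.update O k [] = O := by rw [← hO, Function.update_eq_self]
    simp [full, hO, e]
  | @case_cons k c d O O' t a l hO _ ih =>
    intro L M inj next hM r
    obtain ⟨r₁, h₁⟩ := ih M (fun y => inj (some (.inr ⟨a, y⟩))) next
      (fun x => hM (some (.inr ⟨a, x⟩))) (Function.update r k (some a))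
    refine ⟨r₁, Reach.step' ?_ h₁⟩
    rw [hM]
    simp only [Cmd.entry, Cmd.code, TM2.stepAux]
    rw [update_full_inl]
    simp [full, hO]
  | @loop_nil k d O hO =>
    intro L M inj next hM r
    refine ⟨Function.update r k none, Reach.step' ?_ (Reach.refl _ _)⟩
    rw [hM]
    simp only [Cmd.entry, Cmd.code, TM2.stepAux]
    rw [update_full_inl]
    have e : Function.update O k [] = O := by rw [← hO, Function.update_eq_self]
    simp [full, hO, e]
  | @loop_cons k d O₁ O₂ O₃ t₁ t₂ a l hO _ _ ih₁ ih₂ =>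
    intro L M inj next hM r
    obtain ⟨r₁, h₁⟩ := ih₁ M (fun y => inj (some ⟨a, y⟩)) (.goto fun _ => inj none)
      (fun x => hM (some ⟨a, x⟩)) (Function.update r k (some a))
    obtain ⟨r₂, h₂⟩ := ih₂ M inj next hM r₁
    refine ⟨r₂, Reach.step' ?_ (h₁.trans h₂)⟩
    rw [hM]
    simp only [Cmd.entry, Cmd.code, TM2.stepAux]
    rw [update_full_inl]
    simp [full, hO]
  | @call i src dst inp out O l t hl =>
    intro L M inj next hM r
    obtain ⟨⟨⟨n, hn⟩, hnt⟩⟩ := hl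
    obtain ⟨r₁, h₁⟩ := reach_load hM (O src) [] r (initStates tm) O (emptyStacks tm) rfl rfl
    have h₂ := reach_run (M := M) (i := i) (inj := fun y => inj (.inl y))
      (fun x => hM (.inl x)) r₁ (Function.update O src []) n (tm i).main
      (initStates tm) (Function.update (emptyStacks tm) i
        (Function.update (emptyStacks tm i) (tm i).k₀ ((O src).reverse.map inp ++ [])))
      (tm i).initialState (haltList (tm i) l).stk (by
        have e : (⟨some (tm i).main, initStates tm i, (Function.update (emptyStacks tm) i
            (Function.update (emptyStacks tm i) (tm i).k₀ ((O src).reverse.map inp ++ []))) i⟩ :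
            TM2.Cfg (tm i).Γ (tm i).Λ (tm i).σ) =
            initList (tm i) ((O src).reverse.map inp) := by
          have := initList_stk (tm i) ((O src).reverse.map inp)
          rw [Function.update_self, List.append_nil]
          show _ = (⟨_, _, (initList (tm i) ((O src).reverse.map inp)).stk⟩ :
            TM2.Cfg (tm i).Γ (tm i).Λ (tm i).σ)
          rw [this]
          rfl
        rw [e]
        exact hn)
    obtain ⟨r₂, h₃⟩ := reach_unload hM l ((Function.update O src []) dst) r₁ (initStates tm)
      (Function.update O src []) (Function.update (emptyStacks tm) i (haltList (tm i) l).stk)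
      rfl (by rw [Function.update_self, haltList_stk, Function.update_self])
    refine ⟨r₂, ?_⟩
    -- A run ending in `haltList` is in the initial state and has only the output stack nonempty.
    -- After unloading, the subroutine is exactly as before the call and can be called again.
    have e₁ : Function.update (initStates tm) i (tm i).initialState = initStates tm :=
      Function.update_eq_self i (initStates tm)
    have e₂ : Function.update (Function.update (emptyStacks tm) i (haltList (tm i) l).stk) i
        (Function.update ((Function.update (emptyStacks tm) i (haltList (tm i) l).stk) i)
          (tm i).k₁ []) = emptyStacks tm := by
      rw [Function.update_self, Function.update_idem, haltList_stk, Function.update_idem]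
      have : Function.update (fun _ => [] : ∀ k, List ((tm i).Γ k)) (tm i).k₁ [] =
        emptyStacks tm i := Function.update_eq_self _ _
      rw [this, Function.update_eq_self]
    rw [Function.update_idem, e₁] at h₂
    rw [e₂] at h₃
    have hnt' : n ≤ t := hnt
    exact ((h₁.trans h₂).trans h₃).mono (by omega)

variable [Fintype ι] [Fintype K] [∀ k, Fintype (Γ k)]

/-- The machine of a program, with input stack `kin` and output stack `kout`. -/
noncomputable def Cmd.machine (c : Cmd tm Γ) (kin kout : K) : FinTM2 :=
  letI := fun i => (tm i).kFin
  letI := fun i => (tm i).σFin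
  letI : DecidableEq (Idx tm (K := K)) := inferInstance
  { K := Idx tm (K := K)
    k₀ := .inl kin
    k₁ := .inl kout
    Γ := Alph tm Γ
    Λ := c.Lab
    main := c.entry
    ΛFin := c.labFintype
    σ := St tm Γ
    initialState := (fun _ => none, initStates tm)
    Γk₀Fin := inferInstanceAs (Fintype (Γ kin))
    -- The registers are cleared at the end because `haltList` demands that the final state be the
    -- initial one.
    m := c.code id (.load (fun s => (fun _ => none, s.2)) .halt) }

theorem Exec.outputs {c : Cmd tm Γ} {kin kout : K} {x : List (Γ kin)} {y : List (Γ kout)} {t : ℕ}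
    (h : Exec c (Function.update (fun _ => []) kin x) (Function.update (fun _ => []) kout y) t) :
    Nonempty (TM2OutputsInTime (c.machine kin kout) x (some y) t) := by
  obtain ⟨r, n, hn, e⟩ := h.reach (c.code id (.load (fun s => (fun _ => none, s.2)) .halt)) id
    (.load (fun s => (fun _ => none, s.2)) .halt) (fun x => rfl) (fun _ => none)
  have e₀ : full tm Γ (fun _ => []) (emptyStacks tm) = fun _ => [] := by
    funext k
    rcases k with k | k <;> rfl
  refine ⟨⟨⟨n, ?_⟩, hn⟩⟩
  refine Eq.trans ?_ (e.trans ?_)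
  · congr 2
    have := initList_stk (c.machine kin kout) x
    show (⟨_, _, (initList (c.machine kin kout) x).stk⟩ : TM2.Cfg (Alph tm Γ) c.Lab (St tm Γ)) = _
    rw [this, ← update_full_inl, e₀]
    rfl
  · simp only [TM2.stepAux]
    congr 1
    have := haltList_stk (c.machine kin kout) y
    show _ = (⟨_, _, (haltList (c.machine kin kout) y).stk⟩ :
      TM2.Cfg (Alph tm Γ) c.Lab (St tm Γ))
    rw [this, ← update_full_inl, e₀]
    rfl

end Language

end StackProg

/-! ### Polynomial bounds -/

/-- `t` is bounded by a polynomial in `s`. -/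
def PolyBdd {α : Type} (s t : α → ℕ) : Prop := ∃ p : Polynomial ℕ, ∀ a, t a ≤ p.eval (s a)

theorem Polynomial.eval_nat_mono (p : Polynomial ℕ) {m n : ℕ} (h : m ≤ n) :
    p.eval m ≤ p.eval n := by
  rw [Polynomial.eval_eq_sum, Polynomial.eval_eq_sum]
  exact Finset.sum_le_sum fun i _ => Nat.mul_le_mul_left _ (Nat.pow_le_pow_left h i)

namespace PolyBdd

variable {α : Type} {s t u : α → ℕ}

theorem self : PolyBdd s s := ⟨Polynomial.X, fun a => by simp⟩

theorem const (c : ℕ) : PolyBdd s (fun _ => c) := ⟨Polynomial.C c, fun a => by simp⟩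

theorem add (ht : PolyBdd s t) (hu : PolyBdd s u) : PolyBdd s (fun a => t a + u a) := by
  obtain ⟨p, hp⟩ := ht
  obtain ⟨q, hq⟩ := hu
  exact ⟨p + q, fun a => by rw [Polynomial.eval_add]; exact add_le_add (hp a) (hq a)⟩

theorem mul (ht : PolyBdd s t) (hu : PolyBdd s u) : PolyBdd s (fun a => t a * u a) := by
  obtain ⟨p, hp⟩ := ht
  obtain ⟨q, hq⟩ := hu
  exact ⟨p * q, fun a => by rw [Polynomial.eval_mul]; exact Nat.mul_le_mul (hp a) (hq a)⟩

theorem mono (ht : PolyBdd s t) (h : ∀ a, u a ≤ t a) : PolyBdd s u := by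
  obtain ⟨p, hp⟩ := ht
  exact ⟨p, fun a => (h a).trans (hp a)⟩

/-- A monotone majorant allows the running time of a second machine to be bounded through an
intermediate output whose length is itself only known up to a polynomial. -/
theorem exists_mono (ht : PolyBdd s t) :
    ∃ F : ℕ → ℕ, Monotone F ∧ (∀ a, t a ≤ F (s a)) ∧
      ∀ {β : Type} {v w : β → ℕ}, PolyBdd v w → PolyBdd v (fun b => F (w b)) := by
  obtain ⟨p, hp⟩ := ht
  refine ⟨fun n => p.eval n, fun m n h => p.eval_nat_mono h, hp, ?_⟩
  rintro β v w ⟨q, hq⟩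
  refine ⟨p.comp q, fun b => ?_⟩
  rw [Polynomial.eval_comp]
  exact p.eval_nat_mono (hq b)

end PolyBdd

/-! ### Closure properties of polynomial time -/

section MachineConstructions

open Turing StackProg

/-- Polynomial-time computability with respect to arbitrary encoding functions. -/
def PT {α β Γ₁ Γ₂ : Type} (ea : α → List Γ₁) (eb : β → List Γ₂) (f : α → β) : Prop :=
  Nonempty (TM2ComputableInPolyTime ea eb f)

namespace StackProg

/-! ### Length of the output in terms of the running time. -/

section Growth

variable {K : Type} [DecidableEq K] {Γ : K → Type} {Λ σ : Type}

/-- The number of push instructions in a statement. -/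
def pushes : TM2.Stmt Γ Λ σ → ℕ
  | .push _ _ q => pushes q + 1
  | .peek _ _ q => pushes q
  | .pop _ _ q => pushes q
  | .load _ q => pushes q
  | .branch _ q r => pushes q + pushes r
  | .goto _ => 0
  | .halt => 0

theorem length_stepAux_le (q : TM2.Stmt Γ Λ σ) (v : σ) (S : ∀ k, List (Γ k)) (k : K) :
    ((TM2.stepAux q v S).stk k).length ≤ (S k).length + pushes q := by
  induction q generalizing v S with
  | push j f q ih =>
    refine (ih _ _).trans ?_
    by_cases h : k = j
    · subst h; simp [pushes]; omega
    · simp [pushes, Function.update_of_ne h]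
  | peek j f q ih => exact ih _ _
  | pop j f q ih =>
    refine (ih _ _).trans ?_
    by_cases h : k = j
    · subst h; simp [pushes]
    · simp [pushes, Function.update_of_ne h]
  | load f q ih => exact ih _ _
  | branch p q r ih₁ ih₂ =>
    simp only [TM2.stepAux, pushes]
    cases p v
    · exact (ih₂ _ _).trans (by omega)
    · exact (ih₁ _ _).trans (by omega)
  | goto f => simp [TM2.stepAux, pushes]
  | halt => simp [TM2.stepAux, pushes]

theorem length_iterate_step_le {M : Λ → TM2.Stmt Γ Λ σ} {C : ℕ} (hC : ∀ l, pushes (M l) ≤ C)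
    (k : K) (n : ℕ) : ∀ (a b : TM2.Cfg Γ Λ σ),
    (flip Bind.bind (TM2.step M))^[n] (some a) = some b →
      (b.stk k).length ≤ (a.stk k).length + C * n := by
  induction n with
  | zero =>
    intro a b h
    simp only [Function.iterate_zero, id, Option.some.injEq] at h
    simp [h]
  | succ n ih =>
    rintro ⟨_ | l, v, S⟩ b h
    · rw [Function.iterate_succ_apply] at h
      exact absurd ((iterate_none (TM2.step M) n).symm.trans h) (by simp)
    · rw [Function.iterate_succ_apply] at h
      have := ih (TM2.stepAux (M l) v S) b h
      have h2 := length_stepAux_le (M l) v S k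
      have h3 := hC l
      have h4 : C * (n + 1) = C * n + C := by ring
      show _ ≤ (S k).length + C * (n + 1)
      omega

end Growth

/-- There are finitely many labels, so one constant bounds the number of pushes made in a single
step. -/
theorem outputs_length_le (M : FinTM2) : ∃ C, ∀ x y t, Nonempty (TM2OutputsInTime M x (some y) t) →
    y.length ≤ x.length + C * t := by
  let _ := M.ΛFin
  refine ⟨Finset.univ.sup fun l => pushes (M.m l), ?_⟩
  rintro x y t ⟨⟨⟨n, hn⟩, hnt⟩⟩
  have h := length_iterate_step_le (M := M.m)
    (C := Finset.univ.sup fun l => pushes (M.m l))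
    (fun l => Finset.le_sup (f := fun l => pushes (M.m l)) (Finset.mem_univ l)) M.k₁ n _ _ hn
  have h1 := congrFun (haltList_stk M y) M.k₁
  have h2 := congrFun (initList_stk M x) M.k₁
  have h3 : ((initList M x).stk M.k₁).length ≤ x.length := by
    rw [h2]
    by_cases h : M.k₁ = M.k₀
    · rw [h]; simp
    · simp [Function.update_of_ne h]
  rw [h1, Function.update_self] at h
  have h4 : n ≤ t := hnt
  have := Nat.mul_le_mul_left (Finset.univ.sup fun l => pushes (M.m l)) h4
  omega

end StackProg

/-- The bound on the output length accompanies the time bound because in the constructions below the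
output of one machine becomes the input of another. -/
theorem PT.elim {α β Γ₁ Γ₂ : Type} {ea : α → List Γ₁} {eb : β → List Γ₂} {f : α → β}
    (h : PT ea eb f) : ∃ (M : FinTM2) (e₁ : M.Γ M.k₀ ≃ Γ₁) (e₂ : M.Γ M.k₁ ≃ Γ₂) (t : α → ℕ),
      PolyBdd (fun a => (ea a).length) t ∧
      (∀ a, Nonempty (TM2OutputsInTime M ((ea a).map e₁.symm)
        (some ((eb (f a)).map e₂.symm)) (t a))) ∧
      PolyBdd (fun a => (ea a).length) (fun a => (eb (f a)).length) := by
  obtain ⟨⟨⟨M, e₁, e₂⟩, p, h⟩⟩ := h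
  refine ⟨M, e₁, e₂, fun a => p.eval (ea a).length, ⟨p, fun a => le_rfl⟩, fun a => ⟨h a⟩, ?_⟩
  obtain ⟨C, hC⟩ := outputs_length_le M
  have hb : PolyBdd (fun a => (ea a).length)
      (fun a => (ea a).length + C * p.eval (ea a).length) :=
    PolyBdd.self.add ((PolyBdd.const C).mul ⟨p, fun a => le_rfl⟩)
  exact hb.mono fun a => by simpa using hC _ _ _ ⟨h a⟩

theorem PT.length_bdd {α β Γ₁ Γ₂ : Type} {ea : α → List Γ₁} {eb : β → List Γ₂} {f : α → β}
    (h : PT ea eb f) : PolyBdd (fun a => (ea a).length) (fun a => (eb (f a)).length) := by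
  obtain ⟨_, _, _, _, _, _, h⟩ := h.elim
  exact h

/-! ### Programs on a fixed family of seven stacks. -/

namespace StackProg

/-- A program ends in a given state within a given time. -/
def ExecLe {ι : Type} {tm : ι → FinTM2} {K : Type} {Γ : K → Type} [DecidableEq K]
    (c : Cmd tm Γ) (O O' : ∀ k, List (Γ k)) (t : ℕ) : Prop :=
  ∃ t' ≤ t, Exec c O O' t'

section Generic

variable {ι : Type} {tm : ι → FinTM2} {K : Type} {Γ : K → Type} [DecidableEq K]

theorem ExecLe.seq {c d : Cmd tm Γ} {O₁ O₂ O₃ : ∀ k, List (Γ k)} {t₁ t₂ : ℕ}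
    (h₁ : ExecLe c O₁ O₂ t₁) (h₂ : ExecLe d O₂ O₃ t₂) : ExecLe (.seq c d) O₁ O₃ (t₁ + t₂) := by
  obtain ⟨s₁, h₁, e₁⟩ := h₁
  obtain ⟨s₂, h₂, e₂⟩ := h₂
  exact ⟨_, add_le_add h₁ h₂, e₁.seq e₂⟩

theorem ExecLe.of_eq {c : Cmd tm Γ} {O O' O'' : ∀ k, List (Γ k)} {t : ℕ} (h : Exec c O O' t)
    (e : O' = O'') : ExecLe c O O'' t := ⟨t, le_rfl, e ▸ h⟩

theorem ExecLe.mono {c : Cmd tm Γ} {O O' : ∀ k, List (Γ k)} {t t' : ℕ} (h : ExecLe c O O' t)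
    (e : t ≤ t') : ExecLe c O O' t' := by
  obtain ⟨s, h, e'⟩ := h
  exact ⟨s, h.trans e, e'⟩

/-- Moves the contents of a stack to another one, reversing it and replacing each letter by a
word. -/
def Cmd.move (k k' : K) (g : Γ k → List (Γ k')) : Cmd tm Γ := .loop k fun a => .push k' (g a)

theorem Exec.move {k k' : K} (hk : k ≠ k') (g : Γ k → List (Γ k')) (l : List (Γ k)) :
    ∀ O : ∀ k, List (Γ k), O k = l → Exec (Cmd.move (tm := tm) k k' g) O
      (Function.update (Function.update O k []) k' ((l.flatMap g).reverse ++ O k'))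
      (2 * l.length + 1) := by
  induction l with
  | nil =>
    intro O hO
    have e : Function.update (Function.update O k []) k' ((List.flatMap g []).reverse ++ O k') =
        O := by
      rw [← hO, Function.update_eq_self, hO]
      simp
    rw [e]
    exact .loop_nil hO
  | cons a l ih =>
    intro O hO
    have h := ih (Function.update (Function.update O k l) k' ((g a).reverse ++ O k'))
      (by rw [Function.update_of_ne hk, Function.update_self])
    have h1 := Exec.push (tm := tm) k' (g a) (Function.update O k l)
    rw [Function.update_of_ne hk.symm] at h1
    have h2 := Exec.loop_cons (d := fun a => .push k' (g a)) hO h1 h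
    have e : Function.update (Function.update (Function.update (Function.update O k l) k'
        ((g a).reverse ++ O k')) k []) k' ((l.flatMap g).reverse ++
        Function.update (Function.update O k l) k' ((g a).reverse ++ O k') k') =
        Function.update (Function.update O k []) k' (((a :: l).flatMap g).reverse ++ O k') := by
      rw [Function.update_self, Function.update_comm hk, Function.update_idem,
        Function.update_comm hk.symm, Function.update_idem]
      simp
    rw [e] at h2
    have e' : 2 * (a :: l).length + 1 = 1 + (2 * l.length + 1) + 1 := by simp; ring
    rw [e']
    exact h2

/-- A call expects its argument reversed on `src` and leaves its result reversed on `dst`. Calls can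
therefore be chained directly; only the first input and the last output have to be turned round. -/
theorem Exec.call_map {i : ι} {src dst : K} {e₁ : (tm i).Γ (tm i).k₀ ≃ Γ src}
    {e₂ : (tm i).Γ (tm i).k₁ ≃ Γ dst} {x : List (Γ src)} {y : List (Γ dst)} {t : ℕ}
    (h : Nonempty (TM2OutputsInTime (tm i) (x.map e₁.symm) (some (y.map e₂.symm)) t))
    {O : ∀ k, List (Γ k)} (hO : O src = x.reverse) :
    Exec (.call i src dst e₁.symm e₂) O
      (Function.update (Function.update O src []) dst
        (y.reverse ++ (Function.update O src []) dst))
      (2 * x.length + t + 2 * y.length + 2) := by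
  have := Exec.call (tm := tm) (src := src) (dst := dst) (inp := e₁.symm) (out := e₂) (O := O)
    (l := y.map e₂.symm) (t := t) (by rwa [hO, List.reverse_reverse])
  simpa [hO, Function.comp_def] using this

end Generic

/-- The stacks of the programs below: input, auxiliary and output stacks. -/
inductive Stk : Type
  | i₁ | i₂ | i₃ | m₁ | m₂ | o₁ | o₂
  deriving DecidableEq

instance : Fintype Stk :=
  ⟨{.i₁, .i₂, .i₃, .m₁, .m₂, .o₁, .o₂}, fun x => by cases x <;> decide⟩

section Store

variable (A B C : Type)

/-- The alphabets of the stacks. -/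
abbrev stkAlph : Stk → Type
  | .i₁ => A
  | .i₂ => A
  | .i₃ => A
  | .m₁ => B
  | .m₂ => B
  | .o₁ => C
  | .o₂ => C

instance stkAlphFintype [Fintype A] [Fintype B] [Fintype C] : ∀ k, Fintype (stkAlph A B C k)
  | .i₁ => inferInstanceAs (Fintype A)
  | .i₂ => inferInstanceAs (Fintype A)
  | .i₃ => inferInstanceAs (Fintype A)
  | .m₁ => inferInstanceAs (Fintype B)
  | .m₂ => inferInstanceAs (Fintype B)
  | .o₁ => inferInstanceAs (Fintype C)
  | .o₂ => inferInstanceAs (Fintype C)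

variable {A B C}

/-- The contents of the stacks. -/
def store (x₁ x₂ x₃ : List A) (y₁ y₂ : List B) (z₁ z₂ : List C) : ∀ k, List (stkAlph A B C k)
  | .i₁ => x₁
  | .i₂ => x₂
  | .i₃ => x₃
  | .m₁ => y₁
  | .m₂ => y₂
  | .o₁ => z₁
  | .o₂ => z₂

variable {x₁ x₂ x₃ x : List A} {y₁ y₂ y : List B} {z₁ z₂ z : List C}

@[simp] theorem store_i₁ : store x₁ x₂ x₃ y₁ y₂ z₁ z₂ .i₁ = x₁ := rfl
@[simp] theorem store_i₂ : store x₁ x₂ x₃ y₁ y₂ z₁ z₂ .i₂ = x₂ := rfl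
@[simp] theorem store_i₃ : store x₁ x₂ x₃ y₁ y₂ z₁ z₂ .i₃ = x₃ := rfl
@[simp] theorem store_m₁ : store x₁ x₂ x₃ y₁ y₂ z₁ z₂ .m₁ = y₁ := rfl
@[simp] theorem store_m₂ : store x₁ x₂ x₃ y₁ y₂ z₁ z₂ .m₂ = y₂ := rfl
@[simp] theorem store_o₁ : store x₁ x₂ x₃ y₁ y₂ z₁ z₂ .o₁ = z₁ := rfl
@[simp] theorem store_o₂ : store x₁ x₂ x₃ y₁ y₂ z₁ z₂ .o₂ = z₂ := rfl

@[simp] theorem update_store_i₁ : Function.update (store x₁ x₂ x₃ y₁ y₂ z₁ z₂) .i₁ x =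
    store x x₂ x₃ y₁ y₂ z₁ z₂ := by funext k; cases k <;> rfl
@[simp] theorem update_store_i₂ : Function.update (store x₁ x₂ x₃ y₁ y₂ z₁ z₂) .i₂ x =
    store x₁ x x₃ y₁ y₂ z₁ z₂ := by funext k; cases k <;> rfl
@[simp] theorem update_store_i₃ : Function.update (store x₁ x₂ x₃ y₁ y₂ z₁ z₂) .i₃ x =
    store x₁ x₂ x y₁ y₂ z₁ z₂ := by funext k; cases k <;> rfl
@[simp] theorem update_store_m₁ : Function.update (store x₁ x₂ x₃ y₁ y₂ z₁ z₂) .m₁ y =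
    store x₁ x₂ x₃ y y₂ z₁ z₂ := by funext k; cases k <;> rfl
@[simp] theorem update_store_m₂ : Function.update (store x₁ x₂ x₃ y₁ y₂ z₁ z₂) .m₂ y =
    store x₁ x₂ x₃ y₁ y z₁ z₂ := by funext k; cases k <;> rfl
@[simp] theorem update_store_o₁ : Function.update (store x₁ x₂ x₃ y₁ y₂ z₁ z₂) .o₁ z =
    store x₁ x₂ x₃ y₁ y₂ z z₂ := by funext k; cases k <;> rfl
@[simp] theorem update_store_o₂ : Function.update (store x₁ x₂ x₃ y₁ y₂ z₁ z₂) .o₂ z =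
    store x₁ x₂ x₃ y₁ y₂ z₁ z := by funext k; cases k <;> rfl

theorem empty_eq_store : (fun _ => [] : ∀ k, List (stkAlph A B C k)) =
    store [] [] [] [] [] [] [] := by funext k; cases k <;> rfl

end Store

end StackProg

/-! ### Composition, transduction, pairing, case distinction, iteration. -/

theorem PT.of_exec {α β A B C : Type} [Fintype A] [Fintype B] [Fintype C] {ι : Type}
    [DecidableEq ι] [Fintype ι] {tm : ι → FinTM2} {ea : α → List A} {ec : β → List C} {f : α → β}
    (c : Cmd tm (stkAlph A B C)) (t : α → ℕ) (ht : PolyBdd (fun a => (ea a).length) t)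
    (h : ∀ a, ExecLe c (store (ea a) [] [] [] [] [] []) (store [] [] [] [] [] [] (ec (f a))) (t a)) :
    PT ea ec f := by
  obtain ⟨p, hp⟩ := ht
  refine ⟨⟨⟨c.machine .i₁ .o₂, Equiv.refl A, Equiv.refl C⟩, p, fun a => ?_⟩⟩
  have h1 : Nonempty (TM2OutputsInTime (c.machine .i₁ .o₂) (ea a) (some (ec (f a)))
      (p.eval (ea a).length)) := by
    obtain ⟨s, hs, e⟩ := h a
    have : Exec c (Function.update (fun _ => []) .i₁ (ea a))
        (Function.update (fun _ => []) .o₂ (ec (f a))) s := by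
      rw [empty_eq_store]; simpa using e
    obtain ⟨⟨r, hr⟩⟩ := this.outputs
    exact ⟨⟨r, hr.trans (hs.trans (hp a))⟩⟩
  have key : ∀ x y, x = ea a → y = ec (f a) → Nonempty (TM2OutputsInTime (c.machine .i₁ .o₂) x
      (some y) (p.eval (ea a).length)) := by
    rintro _ _ rfl rfl
    exact h1
  exact (key _ _ (List.map_id _) (List.map_id _)).some

theorem PT.comp {α β γ A B C : Type} [Fintype A] [Fintype B] [Fintype C] {ea : α → List A}
    {eb : β → List B} {ec : γ → List C} {f : α → β} {g : β → γ} (hf : PT ea eb f)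
    (hg : PT eb ec g) : PT ea ec (fun a => g (f a)) := by
  obtain ⟨M, e₁, e₂, t, ht, hM, hl⟩ := hf.elim
  obtain ⟨M', e₁', e₂', t', ht', hM', hl'⟩ := hg.elim
  obtain ⟨F, -, hF, hF'⟩ := ht'.exists_mono
  obtain ⟨G, -, hG, hG'⟩ := hl'.exists_mono
  let tm : Bool → FinTM2 := fun b => Bool.rec M M' b
  refine PT.of_exec (tm := tm) (.seq (Cmd.move .i₁ .i₂ fun a => [a])
    (.seq (.call false .i₂ .m₁ e₁.symm e₂) (.seq (.call true .m₁ .o₁ e₁'.symm e₂')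
    (Cmd.move .o₁ .o₂ fun a => [a]))))
    (fun a => (2 * (ea a).length + 1) + ((2 * (ea a).length + t a + 2 * (eb (f a)).length + 2) +
      ((2 * (eb (f a)).length + F (eb (f a)).length + 2 * G (eb (f a)).length + 2) +
      (2 * G (eb (f a)).length + 1)))) ?_ fun a => ?_
  · have h2 : PolyBdd (fun a => (ea a).length) fun _ => 2 := .const 2
    have h1 : PolyBdd (fun a => (ea a).length) fun _ => 1 := .const 1
    exact ((h2.mul .self).add h1).add (((((h2.mul .self).add ht).add (h2.mul hl)).add h2).add
      (((((h2.mul hl).add (hF' hl)).add (h2.mul (hG' hl))).add h2).add ((h2.mul (hG' hl)).add h1)))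
  · refine ExecLe.seq (O₂ := store [] (ea a).reverse [] [] [] [] [])
      (.of_eq (Exec.move (by decide) _ _ _ rfl) (by simp)) ?_
    refine ExecLe.seq (O₂ := store [] [] [] (eb (f a)).reverse [] [] [])
      (.of_eq (Exec.call_map (tm := tm) (Γ := stkAlph A B C) (i := false) (src := .i₂) (dst := .m₁) (hM a) rfl)
        (by simp)) ?_
    refine ExecLe.seq (O₂ := store [] [] [] [] [] (ec (g (f a))).reverse [])
      ((ExecLe.of_eq (Exec.call_map (tm := tm) (Γ := stkAlph A B C) (i := true) (src := .m₁) (dst := .o₁)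
        (hM' (f a)) rfl) (by simp)).mono ?_) ?_
    · have := hF (f a); have := hG (f a); omega
    · refine (ExecLe.of_eq (Exec.move (by decide) _ _ _ rfl) (by simp)).mono ?_
      have := hG (f a)
      simp only [store_o₁, List.length_reverse]
      omega

/-- The output of a finite-state transducer. -/
def transduce {S A C : Type} (step : S → A → S × List C) (fin : S → List C) : S → List A → List C
  | s, [] => fin s
  | s, a :: l => (step s a).2 ++ transduce step fin (step s a).1 l

/-- The current state of the transducer is the only letter on the stack `m₁`, whose alphabet is the
set of states. As there are finitely many transitions, the output is at most linear in the input. -/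
theorem PT.transduce {α β S A C : Type} [Fintype S] [Fintype A] [Fintype C] {ea : α → List A}
    {ec : β → List C} {f : α → β} (step : S → A → S × List C) (fin : S → List C) (s : S)
    (h : ∀ a, ec (f a) = transduce step fin s (ea a)) : PT ea ec f := by
  let tm : Empty → FinTM2 := fun x => x.elim
  have hloop : ∀ (l : List A) (s : S) (z : List C),
      ∃ (s' : S) (w : List C), w ++ fin s' = _root_.transduce step fin s l ∧
      ExecLe (tm := tm) (Γ := stkAlph A S C) (.loop .i₁ fun a => .case .m₁ (.push .m₁ [])
        (fun s => .seq (.push .o₁ (step s a).2) (.push .m₁ [(step s a).1])))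
        (store l [] [] [s] [] z []) (store [] [] [] [s'] [] (w.reverse ++ z) [])
        (4 * l.length + 1) := by
    intro l
    induction l with
    | nil =>
      intro s z
      exact ⟨s, [], rfl, _, le_rfl, .loop_nil rfl⟩
    | cons a l ih =>
      intro s z
      obtain ⟨s', w, hw, r, hr, e⟩ := ih (step s a).1 ((step s a).2.reverse ++ z)
      refine ⟨s', (step s a).2 ++ w, by simp [_root_.transduce, hw], 3 + r + 1, ?_, ?_⟩
      · simp only [List.length_cons]; omega
      · refine .loop_cons (a := a) (l := l) rfl (O₂ := store l [] [] [(step s a).1] []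
          ((step s a).2.reverse ++ z) []) ?_ (by simpa using e)
        refine .case_cons (a := s) (l := []) (by simp) ?_
        have h1 := Exec.push (tm := tm) (Γ := stkAlph A S C) .o₁ (step s a).2
          (store l [] [] [] [] z [])
        have h2 := Exec.push (tm := tm) (Γ := stkAlph A S C) .m₁ [(step s a).1]
          (store l [] [] [] [] ((step s a).2.reverse ++ z) [])
        have h3 := Exec.seq (by simpa using h1) (by simpa using h2)
        simpa using h3
  have hout : ∀ (l : List A) (s : S) , ∃ C₀ : ℕ, ∀ l s,
      (_root_.transduce step fin s l).length ≤ C₀ * (l.length + 1) := by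
    intro _ _
    refine ⟨(Finset.univ.sup fun p : S × A => (step p.1 p.2).2.length) +
      Finset.univ.sup fun s : S => (fin s).length, fun l => ?_⟩
    induction l with
    | nil =>
      intro s
      have := Finset.le_sup (f := fun s : S => (fin s).length) (Finset.mem_univ s)
      simp only [_root_.transduce, List.length_nil, zero_add, mul_one]
      omega
    | cons a l ih =>
      intro s
      have := Finset.le_sup (f := fun p : S × A => (step p.1 p.2).2.length)
        (Finset.mem_univ (s, a))
      have h2 := ih (step s a).1
      simp only [_root_.transduce, List.length_append, List.length_cons]
      rw [mul_add _ (l.length + 1) 1, mul_one]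
      simp only at this
      omega
  obtain ⟨C₀, hC⟩ := hout [] s
  refine PT.of_exec (tm := tm) (.seq (.push .m₁ [s]) (.seq (.loop .i₁ fun a => .case .m₁
    (.push .m₁ []) (fun s => .seq (.push .o₁ (step s a).2) (.push .m₁ [(step s a).1])))
    (.seq (.case .m₁ (.push .m₁ []) fun s => .push .o₁ (fin s))
    (Cmd.move .o₁ .o₂ fun a => [a]))))
    (fun a => 1 + ((4 * (ea a).length + 1) + (2 + (2 * (C₀ * ((ea a).length + 1)) + 1)))) ?_
    fun a => ?_
  · have hc : ∀ c, PolyBdd (fun a => (ea a).length) fun _ => c := fun c => .const c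
    exact (hc 1).add ((((hc 4).mul .self).add (hc 1)).add ((hc 2).add
      (((hc 2).mul ((hc C₀).mul (PolyBdd.self.add (hc 1)))).add (hc 1))))
  · obtain ⟨s', w, hw, e⟩ := hloop (ea a) s []
    refine ExecLe.seq (O₂ := store (ea a) [] [] [s] [] [] [])
      (.of_eq (Exec.push _ _ _) (by simp)) (ExecLe.seq e ?_)
    refine ExecLe.seq (O₂ := store [] [] [] [] [] (w ++ fin s').reverse [])
      (.of_eq (.case_cons (a := s') (l := []) rfl (Exec.push _ _ _)) (by simp)) ?_
    refine (ExecLe.of_eq (Exec.move (by decide) _ _ _ rfl) ?_).mono ?_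
    · simp [hw, h]
    · have := hC (ea a) s
      rw [← hw] at this
      simp only [store_o₁, List.length_reverse]
      omega

/-- The code of a pair of words. -/
def pairCode (u v : List Bool) : List Bool := u.flatMap (fun b => [true, b]) ++ false :: v

theorem StackProg.exec_copy {A ι : Type} {tm : ι → FinTM2} : ∀ (l u v : List A),
      Exec (tm := tm) (Γ := stkAlph A Bool Bool) (.loop .i₁ fun a => .seq (.push .i₂ [a])
        (.push .i₃ [a])) (store l u v [] [] [] [])
        (store [] (l.reverse ++ u) (l.reverse ++ v) [] [] [] []) (3 * l.length + 1) := by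
  intro l
  induction l with
  | nil => intro u v; exact .loop_nil rfl
  | cons a l ih =>
    intro u v
    have h1 := Exec.push (tm := tm) (Γ := stkAlph A Bool Bool) .i₂ [a]
      (store l u v [] [] [] [])
    have h2 := Exec.push (tm := tm) (Γ := stkAlph A Bool Bool) .i₃ [a]
      (store l (a :: u) v [] [] [] [])
    have h3 := Exec.loop_cons (k := .i₁) (a := a) (l := l) (O₁ := store (a :: l) u v [] [] [] [])
      (d := fun a => .seq (.push .i₂ [a]) (.push .i₃ [a])) rfl
      (by simpa using Exec.seq (by simpa using h1) (by simpa using h2)) (ih (a :: u) (a :: v))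
    have e : 1 + 1 + (3 * l.length + 1) + 1 = 3 * (a :: l).length + 1 := by simp; ring
    rw [e] at h3
    simpa using h3

theorem PT.pair {α β γ A : Type} [Fintype A] {ea : α → List A}
    {eb : β → List Bool} {ec : γ → List Bool} {f : α → β} {g : α → γ} (hf : PT ea eb f)
    (hg : PT ea ec g) : PT ea (fun p : β × γ => pairCode (eb p.1) (ec p.2))
      (fun a => (f a, g a)) := by
  obtain ⟨M, e₁, e₂, t, ht, hM, hl⟩ := hf.elim
  obtain ⟨M', e₁', e₂', t', ht', hM', hl'⟩ := hg.elim
  let tm : Bool → FinTM2 := fun b => Bool.rec M M' b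
  -- A stack is filled from the bottom: the second component is written first, then the separator,
  -- then the marked letters of the first component.
  refine PT.of_exec (tm := tm) (.seq (.loop .i₁ fun a => .seq (.push .i₂ [a])
        (.push .i₃ [a])) (.seq (.call false .i₂ .m₁ e₁.symm e₂) (.seq (.call true .i₃ .m₂ e₁'.symm
        e₂') (.seq (Cmd.move .m₂ .o₂ fun a => [a]) (.seq (.push .o₂ [false])
        (Cmd.move .m₁ .o₂ fun b => [b, true]))))))
    (fun a => (3 * (ea a).length + 1) + ((2 * (ea a).length + t a + 2 * (eb (f a)).length + 2) +
      ((2 * (ea a).length + t' a + 2 * (ec (g a)).length + 2) +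
      ((2 * (ec (g a)).length + 1) + (1 + (2 * (eb (f a)).length + 1)))))) ?_ fun a => ?_
  · have hc : ∀ c, PolyBdd (fun a => (ea a).length) fun _ => c := fun c => .const c
    exact (((hc 3).mul .self).add (hc 1)).add ((((((hc 2).mul .self).add ht).add
      ((hc 2).mul hl)).add (hc 2)).add ((((((hc 2).mul .self).add ht').add
      ((hc 2).mul hl')).add (hc 2)).add ((((hc 2).mul hl').add (hc 1)).add
      ((hc 1).add (((hc 2).mul hl).add (hc 1))))))
  · refine ExecLe.seq (.of_eq (exec_copy _ _ _) rfl) ?_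
    refine ExecLe.seq (O₂ := store [] [] (ea a).reverse (eb (f a)).reverse [] [] [])
      (.of_eq (Exec.call_map (tm := tm) (Γ := stkAlph A Bool Bool) (i := false) (src := .i₂) (dst := .m₁) (hM a) (by simp))
        (by simp)) ?_
    refine ExecLe.seq (O₂ := store [] [] [] (eb (f a)).reverse (ec (g a)).reverse [] [])
      (.of_eq (Exec.call_map (tm := tm) (Γ := stkAlph A Bool Bool) (i := true) (src := .i₃) (dst := .m₂)
        (hM' a) rfl) (by simp)) ?_
    refine ExecLe.seq (O₂ := store [] [] [] (eb (f a)).reverse [] [] (ec (g a)))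
      ((ExecLe.of_eq (Exec.move (by decide) _ _ _ rfl) (by simp)).mono (by simp)) ?_
    refine ExecLe.seq (O₂ := store [] [] [] (eb (f a)).reverse [] [] (false :: ec (g a)))
      (.of_eq (Exec.push _ _ _) (by simp)) ?_
    refine (ExecLe.of_eq (Exec.move (by decide) _ _ _ rfl) ?_).mono (by simp)
    have : ∀ l : List Bool, (l.reverse.flatMap fun b => [b, true]).reverse =
        l.flatMap fun b => [true, b] := by
      intro l
      induction l with
      | nil => rfl
      | cons a l ih => simp [List.flatMap_append, ih]
    simp [pairCode, this]

theorem PT.sumElim {α β γ C : Type} [Fintype C] {ea : α → List Bool}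
    {eb : β → List Bool} {ec : γ → List C} {f : α → γ} {g : β → γ} (hf : PT ea ec f)
    (hg : PT eb ec g) : PT (Sum.elim (fun a => false :: ea a) (fun b => true :: eb b)) ec
      (Sum.elim f g) := by
  obtain ⟨M, e₁, e₂, t, ht, hM, hl⟩ := hf.elim
  obtain ⟨M', e₁', e₂', t', ht', hM', hl'⟩ := hg.elim
  let tm : Bool → FinTM2 := fun b => Bool.rec M M' b
  let sz : α ⊕ β → ℕ := Sum.elim (fun a => (ea a).length) (fun b => (eb b).length)
  let code : α ⊕ β → List Bool := Sum.elim (fun a => false :: ea a) (fun b => true :: eb b)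
  have hsz : ∀ x, (code x).length = sz x + 1 := by rintro (a | b) <;> rfl
  let T : α ⊕ β → ℕ := Sum.elim t t'
  have hjoin : ∀ {u : α → ℕ} {v : β → ℕ}, PolyBdd (fun a => (ea a).length) u →
      PolyBdd (fun b => (eb b).length) v → PolyBdd (fun x => (code x).length) (Sum.elim u v) := by
    rintro u v ⟨p, hp⟩ ⟨q, hq⟩
    refine ⟨p + q, ?_⟩
    rintro (a | b)
    · rw [Polynomial.eval_add]
      exact (hp a).trans ((p.eval_nat_mono (by simp [code])).trans (Nat.le_add_right _ _))
    · rw [Polynomial.eval_add]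
      exact (hq b).trans ((q.eval_nat_mono (by simp [code])).trans (Nat.le_add_left _ _))
  refine PT.of_exec (tm := tm) (A := Bool) (B := Bool) (.case .i₁ (.push .m₁ []) fun b => Bool.rec
    (.seq (Cmd.move .i₁ .i₂ fun a => [a]) (.seq (.call false .i₂ .o₁ e₁.symm e₂)
      (Cmd.move .o₁ .o₂ fun a => [a])))
    (.seq (Cmd.move .i₁ .i₂ fun a => [a]) (.seq (.call true .i₂ .o₁ e₁'.symm e₂')
      (Cmd.move .o₁ .o₂ fun a => [a]))) b)
    (fun x => (2 * (code x).length + 1) + ((2 * (code x).length + T x +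
      2 * (ec (Sum.elim f g x)).length + 2) + (2 * (ec (Sum.elim f g x)).length + 1)) + 1) ?_ ?_
  · have hc : ∀ c, PolyBdd (fun x => (code x).length) fun _ => c := fun c => .const c
    have h1 : PolyBdd (fun x => (code x).length) T := hjoin ht ht'
    have h2 : PolyBdd (fun x => (code x).length) fun x => (ec (Sum.elim f g x)).length :=
      (hjoin hl hl').mono (by rintro (a | b) <;> exact le_rfl)
    exact ((((hc 2).mul .self).add (hc 1)).add ((((((hc 2).mul .self).add h1).add
      ((hc 2).mul h2)).add (hc 2)).add (((hc 2).mul h2).add (hc 1)))).add (hc 1)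
  · rintro (a | b)
    · have key := ExecLe.seq (O₂ := store [] (ea a).reverse [] [] [] [] [])
        (.of_eq (Exec.move (tm := tm) (Γ := stkAlph Bool Bool C) (k := .i₁) (k' := .i₂)
          (by decide) (fun a => [a]) (ea a) (store (ea a) [] [] [] [] [] []) rfl) (by simp))
        (ExecLe.seq (O₂ := store [] [] [] [] [] (ec (f a)).reverse [])
          (.of_eq (Exec.call_map (tm := tm) (Γ := stkAlph Bool Bool C) (i := false) (src := .i₂) (dst := .o₁) (hM a) rfl)
            (by simp))
          (ExecLe.of_eq (O'' := store [] [] [] [] [] [] (ec (f a)))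
            (Exec.move (Γ := stkAlph Bool Bool C) (k := .o₁) (k' := .o₂) (by decide) (fun a => [a]) _ _ rfl) (by simp)))
      obtain ⟨r, hr, e⟩ := key
      refine ⟨r + 1, ?_, .case_cons (a := false) (l := ea a) rfl (by simpa using e)⟩
      simp only [store_o₁, List.length_reverse] at hr
      simp only [code, T, Sum.elim_inl, List.length_cons]
      omega
    · have key := ExecLe.seq (O₂ := store [] (eb b).reverse [] [] [] [] [])
        (.of_eq (Exec.move (tm := tm) (Γ := stkAlph Bool Bool C) (k := .i₁) (k' := .i₂)
          (by decide) (fun a => [a]) (eb b) (store (eb b) [] [] [] [] [] []) rfl) (by simp))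
        (ExecLe.seq (O₂ := store [] [] [] [] [] (ec (g b)).reverse [])
          (.of_eq (Exec.call_map (tm := tm) (Γ := stkAlph Bool Bool C) (i := true) (src := .i₂) (dst := .o₁) (hM' b) rfl)
            (by simp))
          (ExecLe.of_eq (O'' := store [] [] [] [] [] [] (ec (g b)))
            (Exec.move (Γ := stkAlph Bool Bool C) (k := .o₁) (k' := .o₂) (by decide) (fun a => [a]) _ _ rfl) (by simp)))
      obtain ⟨r, hr, e⟩ := key
      refine ⟨r + 1, ?_, .case_cons (a := true) (l := eb b) rfl (by simpa using e)⟩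
      simp only [store_o₁, List.length_reverse] at hr
      simp only [code, T, Sum.elim_inr, List.length_cons]
      omega

/-- The length of a code serves as the loop counter. The bound on all intermediate values is
essential, since iterating a polynomial-time function may otherwise produce exponentially long
words. -/
theorem PT.iterate {α β γ A : Type} [Fintype A] {ea : α → List A}
    {eb : β → List Bool} {ec : γ → List Bool} {n : α → γ} {f : α → β} {g : β → β}
    (hn : PT ea ec n) (hf : PT ea eb f) (hg : PT eb eb g)
    (hb : ∃ s : α → ℕ, PolyBdd (fun a => (ea a).length) s ∧
      ∀ a, ∀ i ≤ (ec (n a)).length, (eb (g^[i] (f a))).length ≤ s a) :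
    PT ea eb (fun a => g^[(ec (n a)).length] (f a)) := by
  obtain ⟨M, e₁, e₂, t, ht, hM, hl⟩ := hn.elim
  obtain ⟨M', e₁', e₂', t', ht', hM', hl'⟩ := hf.elim
  obtain ⟨M'', e₁'', e₂'', t'', ht'', hM'', hl''⟩ := hg.elim
  obtain ⟨F, hFm, hF, hF'⟩ := ht''.exists_mono
  obtain ⟨s, hs, hsb⟩ := hb
  let tm : Option Bool → FinTM2 := fun i => match i with
    | none => M
    | some false => M'
    | some true => M''
  have hloop : ∀ (l : List Bool) (b : β) (m : ℕ),
      (∀ i ≤ l.length, (eb (g^[i] b)).length ≤ m) →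
      ExecLe (tm := tm) (Γ := stkAlph A Bool Bool) (.loop .m₁ fun _ =>
        .call (some true) .m₂ .m₂ e₁''.symm e₂'') (store [] [] [] l (eb b).reverse [] [])
        (store [] [] [] [] (eb (g^[l.length] b)).reverse [] [])
        ((4 * m + F m + 3) * l.length + 1) := by
    intro l
    induction l with
    | nil => intro b m _; exact ⟨_, by simp, .loop_nil rfl⟩
    | cons x l ih =>
      intro b m hm
      obtain ⟨r, hr, e⟩ := ih (g b) m (fun i hi => by
        rw [← Function.iterate_succ_apply]
        exact hm (i + 1) (by simp; omega))
      have h1 := Exec.call_map (tm := tm) (Γ := stkAlph A Bool Bool) (i := some true) (src := .m₂)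
        (dst := .m₂) (hM'' b) (O := store [] [] [] l (eb b).reverse [] []) rfl
      have h5 : ExecLe (tm := tm) (Γ := stkAlph A Bool Bool)
          (.call (some true) .m₂ .m₂ e₁''.symm e₂'') (store [] [] [] l (eb b).reverse [] [])
          (store [] [] [] l (eb (g b)).reverse [] []) _ := .of_eq h1 (by simp)
      obtain ⟨r', hr', e'⟩ := h5
      refine ⟨_, ?_, Exec.loop_cons (a := x) (l := l) rfl (by simpa using e') e⟩
      have h2 : (eb b).length ≤ m := hm 0 (by simp)
      have h3 : (eb (g b)).length ≤ m := hm 1 (by simp)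
      have h4 := (hF b).trans (hFm h2)
      simp only [List.length_cons, mul_add _ l.length 1, mul_one]
      omega
  refine PT.of_exec (tm := tm) (.seq (.loop .i₁ fun a => .seq (.push .i₂ [a])
        (.push .i₃ [a])) (.seq (.call none .i₂ .m₁ e₁.symm e₂) (.seq (.call (some false) .i₃ .m₂ e₁'.symm
        e₂') (.seq (.loop .m₁ fun _ => .call (some true) .m₂ .m₂ e₁''.symm e₂'')
        (Cmd.move .m₂ .o₂ fun a => [a])))))
    (fun a => (3 * (ea a).length + 1) + ((2 * (ea a).length + t a + 2 * (ec (n a)).length + 2) +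
      ((2 * (ea a).length + t' a + 2 * (eb (f a)).length + 2) +
      (((4 * s a + F (s a) + 3) * (ec (n a)).length + 1) + (2 * s a + 1))))) ?_ fun a => ?_
  · have hc : ∀ c, PolyBdd (fun a => (ea a).length) fun _ => c := fun c => .const c
    exact (((hc 3).mul .self).add (hc 1)).add ((((((hc 2).mul .self).add ht).add
      ((hc 2).mul hl)).add (hc 2)).add ((((((hc 2).mul .self).add ht').add
      ((hc 2).mul hl')).add (hc 2)).add ((((((hc 4).mul hs).add (hF' hs)).add (hc 3)).mul hl
      |>.add (hc 1)).add (((hc 2).mul hs).add (hc 1)))))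
  · refine ExecLe.seq (.of_eq (exec_copy _ _ _) rfl) ?_
    refine ExecLe.seq (O₂ := store [] [] (ea a).reverse (ec (n a)).reverse [] [] [])
      (.of_eq (Exec.call_map (tm := tm) (Γ := stkAlph A Bool Bool) (i := none) (src := .i₂) (dst := .m₁) (hM a) (by simp))
        (by simp)) ?_
    refine ExecLe.seq (O₂ := store [] [] [] (ec (n a)).reverse (eb (f a)).reverse [] [])
      (.of_eq (Exec.call_map (tm := tm) (Γ := stkAlph A Bool Bool) (i := some false) (src := .i₃) (dst := .m₂)
        (hM' a) rfl) (by simp)) ?_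
    have h1 := hloop (ec (n a)).reverse (f a) (s a) (by simpa using hsb a)
    rw [List.length_reverse] at h1
    refine ExecLe.seq h1 ?_
    refine (ExecLe.of_eq (Exec.move (by decide) _ _ _ rfl) (by simp)).mono ?_
    have := hsb a _ le_rfl
    simp only [store_m₂, List.length_reverse]
    omega

end MachineConstructions

/-! ### An algebra of polynomial-time functions -/

/-- A type whose elements are encoded by binary words. -/
class PEnc (α : Type) where
  enc : α → List Bool
  enc_injective : Function.Injective enc

section FeasibleFunctions

open PEnc

theorem pairCode_nil (v : List Bool) : pairCode [] v = false :: v := rfl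

theorem pairCode_cons (b : Bool) (u v : List Bool) :
    pairCode (b :: u) v = true :: b :: pairCode u v := rfl

theorem length_pairCode (u v : List Bool) : (pairCode u v).length = 2 * u.length + 1 + v.length := by
  induction u with
  | nil => simp [pairCode_nil]; ring
  | cons b u ih => simp only [pairCode_cons, List.length_cons, ih]; ring

theorem pairCode_inj {u v u' v' : List Bool} (h : pairCode u v = pairCode u' v') :
    u = u' ∧ v = v' := by
  induction u generalizing u' with
  | nil =>
    cases u' with
    | nil => simpa [pairCode_nil] using h
    | cons b u' => simp [pairCode_nil, pairCode_cons] at h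
  | cons b u ih =>
    cases u' with
    | nil => simp [pairCode_nil, pairCode_cons] at h
    | cons b' u' =>
      simp only [pairCode_cons, List.cons.injEq, true_and] at h
      obtain ⟨rfl, h⟩ := h
      obtain ⟨rfl, rfl⟩ := ih h
      exact ⟨rfl, rfl⟩

namespace PEnc

instance : PEnc Unit := ⟨fun _ => [], fun _ _ _ => rfl⟩

instance : PEnc Bool := ⟨fun b => [b], fun a b h => by simpa using h⟩

instance {α β : Type} [PEnc α] [PEnc β] : PEnc (α × β) :=
  ⟨fun p => pairCode (enc p.1) (enc p.2), fun p q h => by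
    obtain ⟨h1, h2⟩ := pairCode_inj h
    exact Prod.ext (enc_injective h1) (enc_injective h2)⟩

instance {α β : Type} [PEnc α] [PEnc β] : PEnc (α ⊕ β) :=
  ⟨Sum.elim (fun a => false :: enc a) (fun b => true :: enc b), by
    rintro (a | a) (b | b) h
    · exact congrArg _ (enc_injective (by simpa using h))
    · simp at h
    · simp at h
    · exact congrArg _ (enc_injective (by simpa using h))⟩

/-- The code of a list. -/
def encList {α : Type} [PEnc α] : List α → List Bool
  | [] => []
  | a :: l => pairCode (enc a) (encList l)

theorem encList_injective {α : Type} [PEnc α] : Function.Injective (encList (α := α)) := by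
  intro l
  induction l with
  | nil =>
    rintro (_ | ⟨b, l'⟩) h
    · rfl
    · have := congrArg List.length h
      simp [encList, length_pairCode] at this
      omega
  | cons a l ih =>
    rintro (_ | ⟨b, l'⟩) h
    · have := congrArg List.length h
      simp [encList, length_pairCode] at this
    · obtain ⟨h1, h2⟩ := pairCode_inj h
      rw [enc_injective h1, ih h2]

instance {α : Type} [PEnc α] : PEnc (List α) := ⟨encList, encList_injective⟩

variable {α β : Type} [PEnc α] [PEnc β]

theorem enc_unit (u : Unit) : enc u = [] := rfl
theorem enc_bool (b : Bool) : enc b = [b] := rfl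
theorem enc_prod (a : α) (b : β) : enc (a, b) = pairCode (enc a) (enc b) := rfl
theorem enc_inl (a : α) : enc (Sum.inl a : α ⊕ β) = false :: enc a := rfl
theorem enc_inr (b : β) : enc (Sum.inr b : α ⊕ β) = true :: enc b := rfl
theorem enc_nil : enc ([] : List α) = [] := rfl
theorem enc_cons (a : α) (l : List α) : enc (a :: l) = pairCode (enc a) (enc l) := rfl

/-- The length of the code. -/
def size (a : α) : ℕ := (enc a).length

theorem size_unit (u : Unit) : size u = 0 := rfl
theorem size_bool (b : Bool) : size b = 1 := rfl
theorem size_prod (a : α) (b : β) : size (a, b) = 2 * size a + 1 + size b := length_pairCode _ _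
theorem size_inl (a : α) : size (Sum.inl a : α ⊕ β) = size a + 1 := rfl
theorem size_inr (b : β) : size (Sum.inr b : α ⊕ β) = size b + 1 := rfl
theorem size_nil : size ([] : List α) = 0 := rfl
theorem size_cons (a : α) (l : List α) : size (a :: l) = 2 * size a + 1 + size l :=
  length_pairCode _ _

theorem size_append (l l' : List α) : size (l ++ l') = size l + size l' := by
  induction l with
  | nil => simp [size_nil]
  | cons a l ih => simp only [List.cons_append, size_cons, ih]; ring

theorem size_reverse (l : List α) : size l.reverse = size l := by
  induction l with
  | nil => rfl
  | cons a l ih => simp only [List.reverse_cons, size_append, size_cons, ih, size_nil]; ring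

theorem length_le_size (l : List α) : l.length ≤ size l := by
  induction l with
  | nil => simp
  | cons a l ih => simp only [List.length_cons, size_cons]; omega

theorem size_le_of_mem {a : α} {l : List α} (h : a ∈ l) : size a ≤ size l := by
  induction l with
  | nil => simp at h
  | cons b l ih =>
    rw [size_cons]
    rcases List.mem_cons.1 h with rfl | h
    · omega
    · have := ih h; omega

theorem size_word (w : List Bool) : size w = 3 * w.length := by
  induction w with
  | nil => rfl
  | cons a l ih => simp only [size_cons, size_bool, List.length_cons, ih]; ring

theorem size_drop_le (l : List α) (i : ℕ) : size (l.drop i) ≤ size l := by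
  induction l generalizing i with
  | nil => simp
  | cons a l ih =>
    cases i with
    | zero => simp
    | succ i => have := ih i; simp only [List.drop_succ_cons, size_cons]; omega

end PEnc

/-- Polynomial-time functions between encoded types. -/
@[fun_prop]
def FPoly {α β : Type} [PEnc α] [PEnc β] (f : α → β) : Prop := PT (enc : α → List Bool) enc f

/-- Case distinction on lists. -/
def List.elimCons {α δ : Type} (l : List α) (d : δ) (g : α → List α → δ) : δ :=
  match l with
  | [] => d
  | a :: t => g a t

@[simp] theorem List.elimCons_nil {α δ : Type} (d : δ) (g : α → List α → δ) :
    ([] : List α).elimCons d g = d := rfl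

@[simp] theorem List.elimCons_cons {α δ : Type} (a : α) (l : List α) (d : δ)
    (g : α → List α → δ) : (a :: l).elimCons d g = g a l := rfl

namespace FPoly

variable {α β γ δ : Type} [PEnc α] [PEnc β] [PEnc γ] [PEnc δ]

protected theorem size_bdd {f : α → β} (h : FPoly f) : PolyBdd (fun a => size a) (fun a => size (f a)) :=
  PT.length_bdd h

theorem of_transduce {S : Type} [Fintype S] {f : α → β} (step : S → Bool → S × List Bool)
    (fin : S → List Bool) (s : S) (h : ∀ a, enc (f a) = transduce step fin s (enc a)) : FPoly f :=
  PT.transduce step fin s h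

@[fun_prop]
protected theorem comp {f : β → γ} {g : α → β} (hf : FPoly f) (hg : FPoly g) : FPoly fun a => f (g a) :=
  PT.comp hg hf

theorem transduce_copy (l : List Bool) :
    transduce (fun (_ : Unit) b => ((), [b])) (fun _ => []) () l = l := by
  induction l with
  | nil => rfl
  | cons a l ih => simp [transduce, ih]

theorem of_enc_eq {f : α → β} (h : ∀ a, enc (f a) = enc a) : FPoly f :=
  of_transduce (fun (_ : Unit) b => ((), [b])) (fun _ => []) ()
    fun a => by rw [h, transduce_copy]

@[fun_prop]
protected theorem id : FPoly fun a : α => a := of_enc_eq fun _ => rfl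

@[fun_prop]
protected theorem const (b : β) : FPoly fun _ : α => b :=
  of_transduce (fun (_ : Unit) _ => ((), [])) (fun _ => enc b) () fun a => by
    generalize enc a = l
    induction l with
    | nil => rfl
    | cons a l ih => simpa [transduce] using ih

@[fun_prop]
protected theorem pair {f : α → β} {g : α → γ} (hf : FPoly f) (hg : FPoly g) : FPoly fun a => (f a, g a) :=
  PT.pair hf hg

theorem of_fst : FPoly (Prod.fst : α × β → α) := by
  -- `some false` expects a marker, `some true` expects a letter of the first component, and `none`
  -- means that the separator has been passed.
  let step : Option Bool → Bool → Option Bool × List Bool := fun s b => match s with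
    | none => (none, [])
    | some false => (if b then some true else none, [])
    | some true => (some false, [b])
  refine of_transduce step (fun _ => []) (some false) ?_
  rintro ⟨a, b⟩
  rw [enc_prod]
  have h0 : ∀ v : List Bool, transduce step (fun _ => []) none v = [] := by
    intro v
    induction v with
    | nil => rfl
    | cons c v ih => simpa [transduce, step] using ih
  generalize enc b = v
  show enc a = _
  generalize enc a = u
  induction u with
  | nil => simp [pairCode_nil, transduce, step, h0]
  | cons c u ih => simpa [pairCode_cons, transduce, step] using ih

theorem of_snd : FPoly (Prod.snd : α × β → β) := by
  let step : Option Bool → Bool → Option Bool × List Bool := fun s b => match s with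
    | none => (none, [b])
    | some false => (if b then some true else none, [])
    | some true => (some false, [])
  refine of_transduce step (fun _ => []) (some false) ?_
  rintro ⟨a, b⟩
  rw [enc_prod]
  have h0 : ∀ v : List Bool, transduce step (fun _ => []) none v = v := by
    intro v
    induction v with
    | nil => rfl
    | cons c v ih => simpa [transduce, step] using ih
  show enc b = _
  generalize enc b = v
  generalize enc a = u
  induction u with
  | nil => simp [pairCode_nil, transduce, step, h0]
  | cons c u ih => simpa [pairCode_cons, transduce, step] using ih

@[fun_prop]
protected theorem fst {f : γ → α × β} (hf : FPoly f) : FPoly fun x => (f x).1 := of_fst.comp hf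

@[fun_prop]
protected theorem snd {f : γ → α × β} (hf : FPoly f) : FPoly fun x => (f x).2 := of_snd.comp hf

/-- Two letters are treated specially, the others are copied. -/
theorem of_prefix {f : α → β} (g : Bool → List Bool) (h : ∀ a, ∃ b l, enc a = b :: l ∧
    enc (f a) = g b ++ l) : FPoly f := by
  let step : Bool → Bool → Bool × List Bool := fun s b => if s then (true, [b]) else (true, g b)
  refine of_transduce step (fun _ => []) false fun a => ?_
  have h0 : ∀ v : List Bool, transduce step (fun _ => []) true v = v := by
    intro v
    induction v with
    | nil => rfl
    | cons c v ih => simpa [transduce, step] using ih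
  obtain ⟨b, l, e, e'⟩ := h a
  rw [e, e']
  simp [transduce, step, h0]

theorem of_prepend {f : α → β} (u : List Bool) (h : ∀ a, enc (f a) = u ++ enc a) : FPoly f := by
  let step : Bool → Bool → Bool × List Bool :=
    fun s b => if s then (true, [b]) else (true, u ++ [b])
  refine of_transduce step (fun s => if s then [] else u) false fun a => ?_
  have h0 : ∀ v : List Bool, transduce step (fun s => if s then [] else u) true v = v := by
    intro v
    induction v with
    | nil => rfl
    | cons c v ih => simpa [transduce, step] using ih
  rw [h]
  cases enc a with
  | nil => simp [transduce]
  | cons c v => simp [transduce, step, h0]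

@[fun_prop]
protected theorem inl {f : γ → α} (hf : FPoly f) : FPoly fun x => (Sum.inl (f x) : α ⊕ β) :=
  (of_prepend (f := fun a : α => (Sum.inl a : α ⊕ β)) [false] fun _ => rfl).comp hf

@[fun_prop]
protected theorem inr {f : γ → β} (hf : FPoly f) : FPoly fun x => (Sum.inr (f x) : α ⊕ β) :=
  (of_prepend (f := fun a : β => (Sum.inr a : α ⊕ β)) [true] fun _ => rfl).comp hf

@[fun_prop]
protected theorem cons {f : γ → α} {g : γ → List α} (hf : FPoly f) (hg : FPoly g) :
    FPoly fun x => f x :: g x :=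
  (of_enc_eq (f := fun p : α × List α => p.1 :: p.2) fun _ => rfl).comp (hf.pair hg)

protected theorem sumElim {f : α → γ} {g : β → γ} (hf : FPoly f) (hg : FPoly g) : FPoly (Sum.elim f g) := by
  have h := PT.sumElim hf hg
  have e : (Sum.elim (fun a => false :: enc a) (fun b => true :: enc b) :
      α ⊕ β → List Bool) = enc := rfl
  rw [e] at h
  exact h

@[fun_prop]
protected theorem cond {b : γ → Bool} {f g : γ → α} (hb : FPoly b) (hf : FPoly f) (hg : FPoly g) :
    FPoly fun x => bif b x then f x else g x := by
  -- The code of `(b, x)` is `1 b 0` followed by that of `x`; the code of the corresponding summand,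
  -- padded with a unit, is `b 0` followed by that of `x`. The distinction of cases therefore just
  -- deletes the first letter.
  let d : Bool × γ → (Unit × γ) ⊕ (Unit × γ) :=
    fun p => bif p.1 then .inr ((), p.2) else .inl ((), p.2)
  have hd : FPoly d := by
    let step : Bool → Bool → Bool × List Bool := fun s b => if s then (true, [b]) else (true, [])
    refine of_transduce step (fun _ => []) false ?_
    have h0 : ∀ v : List Bool, transduce step (fun _ => []) true v = v := by
      intro v
      induction v with
      | nil => rfl
      | cons c v ih => simpa [transduce, step] using ih
    rintro ⟨_ | _, x⟩ <;>
    simp [d, enc_inl, enc_inr, enc_prod, enc_unit, enc_bool, pairCode_cons, pairCode_nil,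
      transduce, step, h0]
  have h := (FPoly.sumElim (hg.comp (of_snd (α := Unit))) (hf.comp (of_snd (α := Unit)))).comp
    (hd.comp (hb.pair FPoly.id))
  refine cast (congrArg _ ?_) h
  funext x
  cases b x <;> simp [d]

@[fun_prop]
protected theorem not {b : γ → Bool} (hb : FPoly b) : FPoly fun x => !(b x) := by
  have : (fun x => !(b x)) = fun x => bif b x then false else true := by
    funext x; cases b x <;> rfl
  rw [this]; fun_prop

@[fun_prop]
protected theorem and {b c : γ → Bool} (hb : FPoly b) (hc : FPoly c) : FPoly fun x => b x && c x := by
  have : (fun x => b x && c x) = fun x => bif b x then c x else false := by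
    funext x; cases b x <;> rfl
  rw [this]; fun_prop

@[fun_prop]
protected theorem or {b c : γ → Bool} (hb : FPoly b) (hc : FPoly c) : FPoly fun x => b x || c x := by
  have : (fun x => b x || c x) = fun x => bif b x then true else c x := by
    funext x; cases b x <;> rfl
  rw [this]; fun_prop

@[fun_prop]
protected theorem beq {b c : γ → Bool} (hb : FPoly b) (hc : FPoly c) : FPoly fun x => b x == c x := by
  have : (fun x => b x == c x) = fun x => bif b x then c x else !(c x) := by
    funext x; cases b x <;> cases c x <;> rfl
  rw [this]; fun_prop

@[fun_prop]
protected theorem xor {b c : γ → Bool} (hb : FPoly b) (hc : FPoly c) : FPoly fun x => Bool.xor (b x) (c x) := by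
  have : (fun x => Bool.xor (b x) (c x)) = fun x => bif b x then !(c x) else c x := by
    funext x; cases b x <;> cases c x <;> rfl
  rw [this]; fun_prop

protected theorem sumCases {s : γ → α ⊕ β} {f : γ → α → δ} {g : γ → β → δ} (hs : FPoly s)
    (hf : FPoly fun p : α × γ => f p.2 p.1) (hg : FPoly fun p : β × γ => g p.2 p.1) :
    FPoly fun x => Sum.elim (f x) (g x) (s x) := by
  let d : (α ⊕ β) × γ → (α × γ) ⊕ (β × γ) :=
    fun p => Sum.elim (fun a => .inl (a, p.2)) (fun b => .inr (b, p.2)) p.1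
  have hd : FPoly d := by
    let step : Bool → Bool → Bool × List Bool := fun s b => if s then (true, [b]) else (true, [])
    refine of_transduce step (fun _ => []) false ?_
    have h0 : ∀ v : List Bool, transduce step (fun _ => []) true v = v := by
      intro v
      induction v with
      | nil => rfl
      | cons c v ih => simpa [transduce, step] using ih
    rintro ⟨_ | _, x⟩ <;>
    simp [d, enc_inl, enc_inr, enc_prod, pairCode_cons, transduce, step, h0]
  have h := (FPoly.sumElim hf hg).comp (hd.comp (hs.pair FPoly.id))
  refine cast (congrArg _ ?_) h
  funext x
  rcases s x with a | a <;> simp [d]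

protected theorem elimCons {l : γ → List α} {f : γ → δ} {g : γ → α → List α → δ} (hl : FPoly l)
    (hf : FPoly f) (hg : FPoly fun p : (α × List α) × γ => g p.2 p.1.1 p.1.2) :
    FPoly fun x => (l x).elimCons (f x) (g x) := by
  -- A nonempty list has the same code as the pair of its head and its tail, so the two cases are
  -- separated by rewriting the first letter: `0` stays and `1` becomes `1 1`.
  let d : List α × γ → γ ⊕ ((α × List α) × γ) :=
    fun p => p.1.elimCons (.inl p.2) fun a t => .inr ((a, t), p.2)
  have hd : FPoly d := by
    refine of_prefix (fun b => if b then [true, true] else [false]) ?_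
    rintro ⟨_ | ⟨a, t⟩, x⟩
    · exact ⟨false, enc x, rfl, rfl⟩
    · have : enc (a :: t) ≠ [] := by
        intro h
        have := congrArg List.length h
        simp [enc_cons, length_pairCode] at this
      obtain ⟨b, u, e⟩ := List.exists_cons_of_ne_nil this
      refine ⟨true, b :: pairCode u (enc x), ?_, ?_⟩
      · rw [enc_prod, e, pairCode_cons]
      · simp only [d, List.elimCons_cons]
        rw [enc_inr, enc_prod, enc_prod, ← enc_cons, e, pairCode_cons]
        rfl
  have h := (FPoly.sumElim hf hg).comp (hd.comp (hl.pair FPoly.id))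
  refine cast (congrArg _ ?_) h
  funext x
  rcases l x with _ | ⟨a, t⟩ <;> simp [d]

/-- The codes have bounded length, so a transducer can remember the whole input in its state and
write the answer at the end. -/
protected theorem of_finite [Finite α] (f : α → β) : FPoly f := by
  classical
  obtain ⟨N, hN⟩ : ∃ N, ∀ a : α, (enc a).length ≤ N := by
    have := (Set.finite_range fun a : α => (enc a).length).bddAbove
    obtain ⟨N, hN⟩ := this
    exact ⟨N, fun a => hN ⟨a, rfl⟩⟩
  have hfin : Finite {l : List Bool // l.length ≤ N} := List.finite_length_le Bool N
  let _ := Fintype.ofFinite {l : List Bool // l.length ≤ N}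
  let step : {l : List Bool // l.length ≤ N} → Bool → {l : List Bool // l.length ≤ N} × List Bool :=
    fun s b => (if h : (s.1 ++ [b]).length ≤ N then ⟨s.1 ++ [b], h⟩ else s, [])
  let fin : {l : List Bool // l.length ≤ N} → List Bool :=
    fun s => if h : ∃ a : α, enc a = s.1 then enc (f h.choose) else []
  refine of_transduce step fin ⟨[], Nat.zero_le _⟩ fun a => ?_
  have h0 : ∀ (v : List Bool) (s : {l : List Bool // l.length ≤ N})
      (h : (s.1 ++ v).length ≤ N), transduce step fin s v = fin ⟨s.1 ++ v, h⟩ := by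
    intro v
    induction v with
    | nil => intro s h; simp [transduce]
    | cons c v ih =>
      intro s h
      have h' : (s.1 ++ [c]).length ≤ N := by simp at h ⊢; omega
      have e : step s c = (⟨s.1 ++ [c], h'⟩, []) := by simp only [step, dif_pos h']
      simp only [transduce, e, List.nil_append]
      rw [ih _ (by simpa using h)]
      simp
  rw [h0 _ _ (by simpa using hN a)]
  have hex : ∃ a' : α, enc a' = ([] : List Bool) ++ enc a := ⟨a, rfl⟩
  have e : hex.choose = a := enc_injective hex.choose_spec
  simp only [fin, dif_pos hex, e]

protected theorem iterate {n : α → γ} {f : α → β} {g : β → β} (hn : FPoly n) (hf : FPoly f) (hg : FPoly g)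
    (hb : ∃ s : α → ℕ, PolyBdd (fun a => size a) s ∧
      ∀ a, ∀ i ≤ size (n a), size (g^[i] (f a)) ≤ s a) :
    FPoly fun a => g^[size (n a)] (f a) :=
  PT.iterate hn hf hg hb

/-- Each step enlarges the accumulator by at most an additive amount that depends on `x` alone, so
the intermediate values stay polynomial. The step is iterated `size (l x)` times, at least as often
as the list has entries; surplus rounds change nothing. -/
protected theorem foldl {l : γ → List α} {b : γ → β} {f : γ → β → α → β} (hl : FPoly l) (hb : FPoly b)
    (hf : FPoly fun p : γ × β × α => f p.1 p.2.1 p.2.2)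
    (hB : ∃ K : γ → ℕ, PolyBdd (fun x => size x) K ∧
      ∀ x b, ∀ a ∈ l x, size (f x b a) ≤ size b + K x) :
    FPoly fun x => (l x).foldl (f x) (b x) := by
  obtain ⟨K, hK, hfK⟩ := hB
  let g : γ × List α × β → γ × List α × β :=
    fun s => s.2.1.elimCons s fun a t => (s.1, t, f s.1 s.2.2 a)
  have hg : FPoly g := by
    refine FPoly.elimCons (by fun_prop) (by fun_prop) ?_
    have h1 : FPoly fun p : (α × List α) × γ × List α × β => f p.2.1 p.2.2.2 p.1.1 :=
      hf.comp (g := fun p : (α × List α) × γ × List α × β => (p.2.1, p.2.2.2, p.1.1))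
        (by fun_prop)
    fun_prop
  have hit : ∀ (i : ℕ) (x : γ) (l : List α) (b : β),
      g^[i] (x, l, b) = (x, l.drop i, (l.take i).foldl (f x) b) := by
    intro i
    induction i with
    | zero => intro x l b; simp
    | succ i ih =>
      intro x l b
      rw [Function.iterate_succ_apply]
      cases l with
      | nil =>
        have : g (x, [], b) = (x, [], b) := rfl
        rw [this, ih]
        simp
      | cons a l =>
        have : g (x, a :: l, b) = (x, l, f x b a) := rfl
        rw [this, ih]
        simp
  have hsz : ∀ x (l' : List α), (∀ a ∈ l', a ∈ l x) → ∀ b,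
      size (l'.foldl (f x) b) ≤ size b + l'.length * K x := by
    intro x l'
    induction l' with
    | nil => intro _ b; simp
    | cons a l' ih =>
      intro h b
      have h1 := ih (fun c hc => h c (List.mem_cons_of_mem _ hc)) (f x b a)
      have h2 := hfK x b a (h a List.mem_cons_self)
      simp only [List.foldl_cons, List.length_cons, add_mul, one_mul]
      omega
  have hl' := hl.size_bdd
  have hb' := hb.size_bdd
  have h := FPoly.iterate (n := l) (f := fun x => (x, l x, b x)) hl (by fun_prop) hg
    ⟨fun x => 2 * size x + 1 + (2 * size (l x) + 1 + (size (b x) + size (l x) * K x)),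
      ((((PolyBdd.const 2).mul .self).add (.const 1)).add
        ((((PolyBdd.const 2).mul hl').add (.const 1)).add (hb'.add (hl'.mul hK)))), by
      intro x i _
      rw [hit, size_prod, size_prod]
      have h1 := size_drop_le (l x) i
      have h2 := hsz x ((l x).take i) (fun a ha => List.mem_of_mem_take ha) (b x)
      have h3 : ((l x).take i).length ≤ size (l x) :=
        (List.length_take_le' _ _).trans (length_le_size _)
      have h4 := Nat.mul_le_mul_right (K x) h3
      dsimp only
      omega⟩
  have h5 : FPoly fun x => (g^[size (l x)] (x, l x, b x)).2.2 := by fun_prop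
  refine cast (congrArg _ ?_) h5
  funext x
  rw [hit, List.take_of_length_le (length_le_size _)]

end FPoly

/-! ### Operations on lists and words. -/

namespace FPoly

variable {α β γ δ : Type} [PEnc α] [PEnc β] [PEnc γ] [PEnc δ]

@[fun_prop]
theorem tail {l : γ → List α} (hl : FPoly l) : FPoly fun x => (l x).tail := by
  have h := FPoly.elimCons (g := fun _ _ t => t) hl (FPoly.const []) (by fun_prop)
  refine cast (congrArg _ ?_) h
  funext x
  rcases l x with _ | ⟨a, t⟩ <;> rfl

@[fun_prop]
theorem headD {l : γ → List α} {d : γ → α} (hl : FPoly l) (hd : FPoly d) :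
    FPoly fun x => (l x).headD (d x) := by
  have h := FPoly.elimCons (g := fun _ a _ => a) hl hd (by fun_prop)
  refine cast (congrArg _ ?_) h
  funext x
  rcases l x with _ | ⟨a, t⟩ <;> rfl

@[fun_prop]
theorem isEmpty {l : γ → List α} (hl : FPoly l) : FPoly fun x => (l x).isEmpty := by
  have h := FPoly.elimCons (g := fun _ _ _ => false) hl (FPoly.const true) (by fun_prop)
  refine cast (congrArg _ ?_) h
  funext x
  rcases l x with _ | ⟨a, t⟩ <;> rfl

theorem exists_size_bdd {f : α → β} (hf : FPoly f) :
    ∃ F : ℕ → ℕ, Monotone F ∧ (∀ a, size (f a) ≤ F (size a)) ∧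
      ∀ {δ : Type} {v w : δ → ℕ}, PolyBdd v w → PolyBdd v (fun b => F (w b)) :=
  hf.size_bdd.exists_mono

theorem foldl_reverse_cons {α : Type} (l acc : List α) :
    l.foldl (fun acc a => a :: acc) acc = l.reverse ++ acc := by
  induction l generalizing acc with
  | nil => rfl
  | cons a l ih => simp [ih]

@[fun_prop]
theorem reverse {l : γ → List α} (hl : FPoly l) : FPoly fun x => (l x).reverse := by
  have h := FPoly.foldl (b := fun _ => []) (f := fun _ acc a => a :: acc) hl (FPoly.const [])
    (by fun_prop) ⟨fun x => 2 * size (l x) + 1,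
      ((PolyBdd.const 2).mul hl.size_bdd).add (.const 1), fun x b a ha => by
        have := size_le_of_mem ha
        rw [size_cons]; dsimp only; omega⟩
  simpa only [foldl_reverse_cons, List.append_nil] using h

@[fun_prop]
theorem append {l l' : γ → List α} (hl : FPoly l) (hl' : FPoly l') :
    FPoly fun x => l x ++ l' x := by
  have h := FPoly.foldl (l := fun x => (l x).reverse) (f := fun _ acc a => a :: acc)
    hl.reverse hl' (by fun_prop) ⟨fun x => 2 * size (l x) + 1,
      ((PolyBdd.const 2).mul hl.size_bdd).add (.const 1), fun x b a ha => by
        have := size_le_of_mem (List.mem_reverse.1 ha)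
        rw [size_cons]; dsimp only; omega⟩
  simpa only [foldl_reverse_cons, List.reverse_reverse] using h

theorem map {l : γ → List α} {f : γ → α → β} (hl : FPoly l)
    (hf : FPoly fun p : γ × α => f p.1 p.2) : FPoly fun x => (l x).map (f x) := by
  obtain ⟨F, hFm, hF, hF'⟩ := hf.exists_size_bdd
  have h := FPoly.foldl (b := fun _ => []) (f := fun x acc a => f x a :: acc) hl (FPoly.const [])
    (by
      have : FPoly fun p : γ × List β × α => f p.1 p.2.2 :=
        hf.comp (g := fun p : γ × List β × α => (p.1, p.2.2)) (by fun_prop)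
      fun_prop)
    ⟨fun x => 2 * F (2 * size x + 1 + size (l x)) + 1,
      ((PolyBdd.const 2).mul (hF' ((((PolyBdd.const 2).mul .self).add (.const 1)).add
        hl.size_bdd))).add (.const 1), fun x b a ha => by
        have h1 := size_le_of_mem ha
        have h2 := hF (x, a)
        rw [size_prod] at h2
        have h3 := hFm (show 2 * size x + 1 + size a ≤ 2 * size x + 1 + size (l x) by omega)
        rw [size_cons]
        dsimp only at *
        omega⟩
  have e : ∀ (g : α → β) (l : List α) acc, l.foldl (fun acc a => g a :: acc) acc =
      (l.map g).reverse ++ acc := by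
    intro g l
    induction l with
    | nil => intro acc; rfl
    | cons a l ih => intro acc; simp [ih]
  have h2 := h.reverse
  refine cast (congrArg _ ?_) h2
  funext x
  rw [e]
  simp

theorem filter {l : γ → List α} {f : γ → α → Bool} (hl : FPoly l)
    (hf : FPoly fun p : γ × α => f p.1 p.2) : FPoly fun x => (l x).filter (f x) := by
  have h := FPoly.foldl (b := fun _ => []) (f := fun x acc a => bif f x a then a :: acc else acc)
    hl (FPoly.const [])
    (by
      have : FPoly fun p : γ × List α × α => f p.1 p.2.2 :=
        hf.comp (g := fun p : γ × List α × α => (p.1, p.2.2)) (by fun_prop)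
      fun_prop)
    ⟨fun x => 2 * size (l x) + 1,
      ((PolyBdd.const 2).mul hl.size_bdd).add (.const 1), fun x b a ha => by
        have := size_le_of_mem ha
        cases f x a
        · simp
        · rw [cond_true, size_cons]; dsimp only; omega⟩
  have e : ∀ (g : α → Bool) (l : List α) acc,
      l.foldl (fun acc a => bif g a then a :: acc else acc) acc = (l.filter g).reverse ++ acc := by
    intro g l
    induction l with
    | nil => intro acc; rfl
    | cons a l ih => intro acc; cases h : g a <;> simp [ih, h]
  have h2 := h.reverse
  refine cast (congrArg _ ?_) h2
  funext x
  rw [e]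
  simp

theorem all {l : γ → List α} {f : γ → α → Bool} (hl : FPoly l)
    (hf : FPoly fun p : γ × α => f p.1 p.2) : FPoly fun x => (l x).all (f x) := by
  have h := ((FPoly.filter (f := fun x a => !(f x a)) hl hf.not)).isEmpty
  refine cast (congrArg _ ?_) h
  funext x
  rw [Bool.eq_iff_iff]
  simp [List.filter_eq_nil_iff]

@[fun_prop]
theorem drop_length {l : γ → List α} {v : γ → List β} (hl : FPoly l) (hv : FPoly v) :
    FPoly fun x => (v x).drop (l x).length := by
  have h := FPoly.foldl (f := fun _ acc _ => acc.tail) hl hv (by fun_prop)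
    ⟨fun _ => 0, .const 0, fun x b a _ => by
      rw [← List.drop_one]; exact size_drop_le _ _⟩
  refine cast (congrArg _ ?_) h
  funext x
  generalize v x = w
  generalize l x = l
  induction l generalizing w with
  | nil => rfl
  | cons a l ih => rw [List.foldl_cons, ih]; simp

@[fun_prop]
theorem length_le {l : γ → List α} {v : γ → List β} (hl : FPoly l) (hv : FPoly v) :
    FPoly fun x => decide ((l x).length ≤ (v x).length) := by
  have h := (FPoly.drop_length hv hl).isEmpty
  refine cast (congrArg _ ?_) h
  funext x
  rw [Bool.eq_iff_iff]
  simp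

@[fun_prop]
theorem zip {u : γ → List α} {v : γ → List β} (hu : FPoly u) (hv : FPoly v) :
    FPoly fun x => (u x).zip (v x) := by
  have h := FPoly.foldl (b := fun x => (v x, ([] : List (α × β))))
    (f := fun _ s a => s.1.elimCons s fun b t => (t, (a, b) :: s.2)) hu (by fun_prop)
    (FPoly.elimCons (by fun_prop) (by fun_prop) (by fun_prop))
    ⟨fun x => 4 * size (u x) + 4, ((PolyBdd.const 4).mul hu.size_bdd).add (.const 4), by
      rintro x ⟨_ | ⟨b, t⟩, o⟩ a ha
      · simp
      · have := size_le_of_mem ha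
        simp only [List.elimCons_cons, size_prod, size_cons]
        omega⟩
  have e : ∀ (u : List α) (v : List β) (o : List (α × β)),
      (u.foldl (fun s a => s.1.elimCons s fun b t => (t, (a, b) :: s.2)) (v, o)).2 =
        (u.zip v).reverse ++ o := by
    intro u
    induction u with
    | nil => intro v o; rfl
    | cons a u ih =>
      rintro (_ | ⟨b, v⟩) o
      · rw [List.foldl_cons]
        show (u.foldl _ ([], o)).2 = _
        rw [ih]
        simp
      · rw [List.foldl_cons]
        show (u.foldl _ (v, (a, b) :: o)).2 = _
        rw [ih]
        simp
  have h2 := h.snd.reverse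
  refine cast (congrArg _ ?_) h2
  funext x
  rw [e]
  simp

@[fun_prop]
theorem word_eq {u v : γ → List Bool} (hu : FPoly u) (hv : FPoly v) :
    FPoly fun x => decide (u x = v x) := by
  have h0 : FPoly fun x => ((u x).zip (v x)).all fun p => p.1 == p.2 :=
    FPoly.all (f := fun _ p => p.1 == p.2) (hu.zip hv) (by fun_prop)
  have h : FPoly fun x => (decide ((u x).length ≤ (v x).length) &&
      decide ((v x).length ≤ (u x).length)) && ((u x).zip (v x)).all fun p => p.1 == p.2 := by
    fun_prop
  refine cast (congrArg _ ?_) h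
  funext x
  rw [Bool.eq_iff_iff]
  generalize u x = u
  generalize v x = v
  simp only [Bool.and_eq_true, decide_eq_true_eq]
  constructor
  · rintro ⟨⟨h1, h2⟩, h3⟩
    induction u generalizing v with
    | nil => simpa [eq_comm] using h2
    | cons a u ih =>
      cases v with
      | nil => simp at h1
      | cons b v =>
        simp only [List.zip_cons_cons, List.all_cons, Bool.and_eq_true, beq_iff_eq] at h3
        rw [h3.1, ih v h3.2 (by simpa using h1) (by simpa using h2)]
  · rintro rfl
    refine ⟨⟨le_rfl, le_rfl⟩, ?_⟩
    induction u with
    | nil => rfl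
    | cons a u ih => simpa using ih

theorem any {l : γ → List α} {f : γ → α → Bool} (hl : FPoly l)
    (hf : FPoly fun p : γ × α => f p.1 p.2) : FPoly fun x => (l x).any (f x) := by
  have h := (FPoly.all (f := fun x a => !(f x a)) hl hf.not).not
  refine cast (congrArg _ ?_) h
  funext x
  rw [Bool.eq_iff_iff]
  simp

/-- Powers of lengths are computable in unary. -/
theorem exists_pow (c : ℕ) : ∃ p : List α → List Bool, FPoly p ∧
    ∀ x, (p x).length = x.length ^ c := by
  induction c with
  | zero => exact ⟨fun _ => [true], FPoly.const _, fun _ => rfl⟩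
  | succ c ih =>
    obtain ⟨p, hp, hlen⟩ := ih
    refine ⟨fun x => x.foldl (fun acc _ => p x ++ acc) [], ?_, fun x => ?_⟩
    · refine FPoly.foldl (l := fun x => x) (f := fun x acc _ => p x ++ acc) FPoly.id
        (FPoly.const []) (by fun_prop) ⟨fun x => size (p x), hp.size_bdd, fun x b a _ => ?_⟩
      rw [size_append]; dsimp only; omega
    · have : ∀ (u acc : List Bool) (l : List α),
          (l.foldl (fun acc _ => u ++ acc) acc).length = l.length * u.length + acc.length := by
        intro u acc l
        induction l generalizing acc with
        | nil => simp
        | cons a l ih => rw [List.foldl_cons, ih, List.length_append, List.length_cons]; ring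
      rw [this, hlen, List.length_nil, add_zero, pow_succ, mul_comm]

end FPoly

/-! ### Translation between encodings -/

theorem wordEnc_encode (w : List Bool) : wordEnc.encode w = w := rfl

theorem wordEnc2_encode (u v : List Bool) :
    wordEnc2.encode (u, v) = u.map Sum.inl ++ v.map Sum.inr := rfl

theorem wordEnc3_encode (u v w : List Bool) :
    wordEnc3.encode (u, v, w) =
    u.map Sum.inl ++ (v.map Sum.inl ++ w.map Sum.inr).map Sum.inr := rfl

theorem enc_word_cons (b : Bool) (w : List Bool) : enc (b :: w) = true :: b :: false :: enc w := rfl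

theorem PT.word_to_enc : PT wordEnc.encode (enc : List Bool → List Bool) (fun w => w) := by
  refine PT.transduce (fun (_ : Unit) b => ((), [true, b, false])) (fun _ => []) () fun w => ?_
  rw [wordEnc_encode]
  induction w with
  | nil => rfl
  | cons b w ih => rw [enc_word_cons, ih]; rfl

theorem PT.enc_to_word : PT (enc : List Bool → List Bool) wordEnc.encode (fun w => w) := by
  refine PT.transduce (fun (s : Fin 3) b => (s + 1, if s = 1 then [b] else [])) (fun _ => []) 0
    fun w => ?_
  rw [wordEnc_encode]
  induction w with
  | nil => rfl
  | cons b w ih =>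
    rw [enc_word_cons]
    simp only [_root_.transduce]
    simpa using ih

/-- A letter `b` is coded as `1 b 0`, and in the first component each of these three letters is
marked once more, giving `1 1 1 b 1 0`. The separator `0` is written at the first letter of the
second word, or at the end if there is none. -/
theorem PT.pair_to_enc : PT wordEnc2.encode (enc : List Bool × List Bool → List Bool)
    (fun p => p) := by
  refine PT.transduce (S := Bool) (fun s x => match s, x with
    | false, .inl b => (false, [true, true, true, b, true, false])
    | false, .inr b => (true, [false, true, b, false])
    | true, .inl _ => (true, [])
    | true, .inr b => (true, [true, b, false])) (fun s => if s then [] else [false]) false ?_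
  rintro ⟨u, v⟩
  rw [wordEnc2_encode, enc_prod]
  have h1 : ∀ v : List Bool, enc v = _root_.transduce (S := Bool) (A := Bool ⊕ Bool)
    (fun s x => match s, x with
    | false, .inl b => (false, [true, true, true, b, true, false])
    | false, .inr b => (true, [false, true, b, false])
    | true, .inl _ => (true, [])
    | true, .inr b => (true, [true, b, false])) (fun s => if s then [] else [false]) true
      (v.map .inr) := by
    intro v
    induction v with
    | nil => rfl
    | cons b v ih => rw [enc_word_cons, ih]; rfl
  induction u with
  | nil =>
    cases v with
    | nil => rfl
    | cons b v => rw [enc_word_cons, h1 v]; rfl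
  | cons b u ih => rw [enc_word_cons, pairCode_cons, pairCode_cons, pairCode_cons, ih]; rfl

theorem PT.triple_to_enc : PT wordEnc3.encode
    (enc : List Bool × List Bool × List Bool → List Bool) (fun p => p) := by
  let step : Fin 3 → Bool ⊕ (Bool ⊕ Bool) → Fin 3 × List Bool := fun s x => match s, x with
    | 0, .inl b => (0, [true, true, true, b, true, false])
    | 0, .inr (.inl b) => (1, [false, true, true, true, b, true, false])
    | 0, .inr (.inr b) => (2, [false, false, true, b, false])
    | 1, .inr (.inl b) => (1, [true, true, true, b, true, false])
    | 1, .inr (.inr b) => (2, [false, true, b, false])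
    | 2, .inr (.inr b) => (2, [true, b, false])
    | s, _ => (s, [])
  let fin : Fin 3 → List Bool := fun s => match s with
    | 0 => [false, false]
    | 1 => [false]
    | 2 => []
  refine PT.transduce step fin 0 ?_
  rintro ⟨u, v, w⟩
  rw [wordEnc3_encode, enc_prod, enc_prod]
  have h2 : ∀ w : List Bool, enc w = _root_.transduce step fin 2
      ((w.map Sum.inr : List (Bool ⊕ Bool)).map .inr) := by
    intro w
    induction w with
    | nil => rfl
    | cons b w ih => rw [enc_word_cons, ih]; rfl
  have h1 : ∀ v : List Bool, pairCode (enc v) (enc w) = _root_.transduce step fin 1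
      ((v.map .inl ++ w.map .inr : List (Bool ⊕ Bool)).map .inr) := by
    intro v
    induction v with
    | nil =>
      cases w with
      | nil => rfl
      | cons b w => rw [enc_word_cons, h2 w]; rfl
    | cons b v ih => rw [enc_word_cons, pairCode_cons, pairCode_cons, pairCode_cons, ih]; rfl
  induction u with
  | nil =>
    cases v with
    | nil =>
      cases w with
      | nil => rfl
      | cons b w => rw [enc_word_cons, h2 w]; rfl
    | cons b v =>
      rw [enc_word_cons, pairCode_cons, pairCode_cons, pairCode_cons, h1]; rfl
  | cons b u ih => rw [enc_word_cons, pairCode_cons, pairCode_cons, pairCode_cons, ih]; rfl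

/-- Translation of the code of a pair of words; the letters of the second word are replaced. -/
theorem PT.enc_to_pair {β : Type} {eb : β → List (Bool ⊕ Bool)} (φ : Bool → Bool)
    (f : List Bool × List Bool → β) (hf : ∀ u v, eb (f (u, v)) = u.map .inl ++ (v.map φ).map .inr) :
    PT (enc : List Bool × List Bool → List Bool) eb f := by
  -- The state is the position inside the block of six (first word) or three (second word) letters
  -- that codes one letter. Counted from zero, the letter itself stands at position 3 or 1.
  let step : Fin 6 ⊕ Fin 3 → Bool → (Fin 6 ⊕ Fin 3) × List (Bool ⊕ Bool) := fun s b => match s with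
    | .inl 0 => (if b then .inl 1 else .inr 0, [])
    | .inl k => (.inl (k + 1), if k = 3 then [.inl b] else [])
    | .inr k => (.inr (k + 1), if k = 1 then [.inr (φ b)] else [])
  refine PT.transduce step (fun _ => []) (.inl 0) ?_
  rintro ⟨u, v⟩
  rw [hf, enc_prod]
  have h2 : ∀ v : List Bool, (v.map φ).map Sum.inr =
      _root_.transduce step (fun _ => []) (.inr 0) (enc v) := by
    intro v
    induction v with
    | nil => rfl
    | cons b v ih =>
      rw [List.map_cons, List.map_cons, ih, enc_word_cons]
      rfl
  induction u with
  | nil =>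
    rw [h2]
    rfl
  | cons b u ih =>
    rw [List.map_cons, List.cons_append, ih, enc_word_cons, pairCode_cons, pairCode_cons,
      pairCode_cons]
    rfl

theorem FPoly.of_polyTimeFun {f : List Bool → List Bool} (h : PolyTimeFun f) : FPoly f :=
  (PT.enc_to_word.comp h).comp PT.word_to_enc

theorem FPoly.of_polyTimeRel2 {F : List Bool → List Bool → Bool} (h : PolyTimeRel2 F) :
    FPoly fun p : List Bool × List Bool => F p.1 p.2 :=
  (PT.enc_to_pair (eb := wordEnc2.encode) (fun b => b) (fun p => p)
    fun u v => by rw [wordEnc2_encode, List.map_id']).comp h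

theorem FPoly.polyTimeRel2 {F : List Bool → List Bool → Bool}
    (h : FPoly fun p : List Bool × List Bool => F p.1 p.2) : PolyTimeRel2 F :=
  PT.pair_to_enc.comp h

theorem FPoly.polyTimeRel3 {F : List Bool → List Bool → List Bool → Bool}
    (h : FPoly fun p : List Bool × List Bool × List Bool => F p.1 p.2.1 p.2.2) : PolyTimeRel3 F :=
  PT.triple_to_enc.comp h

/-- A number in unary is presented as the length of a word, and all letters of that word are
replaced by ones. -/
theorem FPoly.of_unary {g : List Bool × ℕ → List Bool}
    (h : PolyTime (Computability.encodingProd wordEnc Computability.unaryEncodingNat) wordEnc g) :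
    FPoly fun p : List Bool × List Bool => g (p.1, p.2.length) := by
  refine ((PT.enc_to_pair (eb := (Computability.encodingProd wordEnc
    Computability.unaryEncodingNat).encode) (fun _ => true) (fun p => (p.1, p.2.length))
    fun u v => ?_).comp h).comp PT.word_to_enc
  have : Computability.unaryEncodeNat v.length = v.map (fun _ => true) := by
    induction v with
    | nil => rfl
    | cons b v ih => rw [List.length_cons, Computability.unaryEncodeNat, ih, List.map_cons]
  show u.map Sum.inl ++ (Computability.unaryEncodeNat v.length).map Sum.inr = _
  rw [this]

/-! ### The hard-core predicate of a permutation -/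

/-- The inner product modulo two (the longer word is truncated). -/
def innerBit (y r : List Bool) : Bool := (y.zip r).foldr (fun p acc => (p.1 && p.2) ^^ acc) false

@[fun_prop]
theorem FPoly.innerBit {γ : Type} [PEnc γ] {y r : γ → List Bool} (hy : FPoly y) (hr : FPoly r) :
    FPoly fun x => innerBit (y x) (r x) := by
  have h := FPoly.foldl (l := fun x => ((y x).zip (r x)).reverse) (b := fun _ => false)
    (f := fun _ acc p => (p.1 && p.2) ^^ acc) (by fun_prop) (by fun_prop) (by fun_prop)
    ⟨fun _ => 1, .const 1, fun x b a _ => by simp [size_bool]⟩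
  simpa only [List.foldl_reverse, _root_.innerBit] using h

/-- The Goldreich–Levin predicate of a permutation: the word is split into two halves `u₁`, `r`
(possibly with an additional letter at the end), and `r` is multiplied with the preimage of `u₁`. -/
noncomputable def hardCore (h : List Bool → List Bool) (u : List Bool) : Bool :=
  innerBit (Function.invFun h (u.take (u.length / 2))) (u.drop (u.length / 2))

/-- The verifier for the value `a` of the hard-core predicate. -/
def hardCoreVerifier (h : List Bool → List Bool) (a : Bool) (u y : List Bool) : Bool :=
  decide (u = h y ++ u.drop y.length) && (decide (y.length ≤ (u.drop y.length).length) &&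
    (decide ((u.drop y.length).length ≤ (true :: y).length) &&
      (innerBit y (u.drop y.length) == a)))

/-- The conditions `|y| ≤ |u| - |y| ≤ |y| + 1` force `|y| = |u| / 2`. Then `h y` is the first half
of `u`, and `y` is its preimage by injectivity of `h`. -/
theorem hardCoreVerifier_iff {h : List Bool → List Bool} (hb : Function.Bijective h)
    (hl : ∀ v, (h v).length = v.length) (a : Bool) (u y : List Bool) :
    hardCoreVerifier h a u y = true ↔
      y = Function.invFun h (u.take (u.length / 2)) ∧ hardCore h u = a := by
  have hinv : ∀ v, h (Function.invFun h v) = v := Function.rightInverse_invFun hb.2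
  simp only [hardCoreVerifier, Bool.and_eq_true, decide_eq_true_eq, beq_iff_eq, List.length_cons]
  constructor
  · rintro ⟨h1, h2, h3, h4⟩
    have h5 : y.length = u.length / 2 := by
      have := congrArg List.length h1
      rw [List.length_append, hl] at this
      omega
    have h6 : y = Function.invFun h (u.take (u.length / 2)) := by
      apply hb.1
      rw [hinv, ← h5]
      conv_rhs => rw [h1]
      rw [← hl y, List.take_left']
      rfl
    refine ⟨h6, ?_⟩
    rw [hardCore, ← h6, ← h5, h4]
  · rintro ⟨rfl, h2⟩
    have h3 : (Function.invFun h (u.take (u.length / 2))).length = u.length / 2 := by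
      rw [← hl, hinv, List.length_take]
      omega
    rw [h3, hinv, List.take_append_drop, List.length_drop]
    exact ⟨rfl, by omega, by omega, h2⟩

theorem isNPcoNPUnique_hardCore {h : List Bool → List Bool} (hp : PolyTimeFun h)
    (hb : Function.Bijective h) (hl : ∀ v, (h v).length = v.length) :
    IsNPcoNPUnique (hardCore h) := by
  have hlen : ∀ u : List Bool,
      (Function.invFun h (u.take (u.length / 2))).length ≤ u.length ^ 1 := by
    intro u
    rw [← hl, Function.rightInverse_invFun hb.2, List.length_take, pow_one]
    omega
  refine ⟨hardCoreVerifier h, 1, fun a => ?_, fun u a => ?_, fun u => ?_⟩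
  · refine FPoly.polyTimeRel2 ?_
    have h1 : FPoly h := FPoly.of_polyTimeFun hp
    unfold hardCoreVerifier
    fun_prop
  · simp only [hardCoreVerifier_iff hb hl]
    constructor
    · intro e
      exact ⟨_, hlen u, rfl, e⟩
    · rintro ⟨_, -, -, e⟩
      exact e
  · simp only [hardCoreVerifier_iff hb hl]
    exact ⟨_, ⟨hlen u, rfl, trivial⟩, fun y hy => hy.2.1⟩

/-! ### Binary counters -/

/-- The value of a binary word, least significant digit first. -/
def wordVal : List Bool → ℕ
  | [] => 0
  | b :: w => b.toNat + 2 * wordVal w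

/-- The successor of a binary word; the word gets longer if it consists of ones only. -/
def wordSucc : List Bool → List Bool
  | [] => [true]
  | false :: w => true :: w
  | true :: w => false :: wordSucc w

@[simp] theorem wordVal_wordSucc (w : List Bool) : wordVal (wordSucc w) = wordVal w + 1 := by
  induction w with
  | nil => rfl
  | cons b w ih => cases b <;> simp [wordSucc, wordVal, ih] <;> ring

theorem wordVal_lt (w : List Bool) : wordVal w < 2 ^ w.length := by
  induction w with
  | nil => simp [wordVal]
  | cons b w ih => cases b <;> simp [wordVal, pow_succ] <;> omega

theorem wordVal_iterate (j : ℕ) (w : List Bool) : wordVal (wordSucc^[j] w) = wordVal w + j := by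
  induction j generalizing w with
  | zero => rfl
  | succ j ih => rw [Function.iterate_succ_apply, ih, wordVal_wordSucc]; ring

theorem length_wordSucc (w : List Bool) (h : wordVal w + 1 < 2 ^ w.length) :
    (wordSucc w).length = w.length := by
  induction w with
  | nil => simp [wordVal] at h
  | cons b w ih =>
    cases b
    · rfl
    · simp only [wordSucc, List.length_cons]
      rw [ih]
      simp [wordVal, pow_succ] at h
      omega

theorem length_iterate_wordSucc (j : ℕ) (w : List Bool) (h : wordVal w + j < 2 ^ w.length) :
    (wordSucc^[j] w).length = w.length := by
  induction j generalizing w with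
  | zero => rfl
  | succ j ih =>
    have h1 := length_wordSucc w (by omega)
    rw [Function.iterate_succ_apply, ih, h1]
    rw [wordVal_wordSucc, h1]
    omega

theorem eq_of_wordVal_eq {u v : List Bool} (hl : u.length = v.length)
    (h : wordVal u = wordVal v) : u = v := by
  induction u generalizing v with
  | nil => simpa [eq_comm] using hl
  | cons a u ih =>
    cases v with
    | nil => simp at hl
    | cons b v =>
      have : a = b ∧ wordVal u = wordVal v := by
        cases a <;> cases b <;> simp [wordVal] at h ⊢ <;> omega
      rw [this.1, ih (by simpa using hl) this.2]

theorem binaryWord_succ (k i : ℕ) :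
    binaryWord (k + 1) i = i.testBit 0 :: binaryWord k (i / 2) := by
  simp [binaryWord, List.ofFn_succ, Nat.testBit_succ]

@[simp] theorem length_binaryWord (k i : ℕ) : (binaryWord k i).length = k := by
  simp [binaryWord]

theorem wordVal_binaryWord (k i : ℕ) (h : i < 2 ^ k) : wordVal (binaryWord k i) = i := by
  induction k generalizing i with
  | zero => simp at h; simp [h, binaryWord, wordVal]
  | succ k ih =>
    rw [binaryWord_succ, wordVal, ih _ (by rw [pow_succ] at h; omega)]
    rw [Nat.testBit_zero]
    rcases Nat.mod_two_eq_zero_or_one i with h | h <;> simp [h] <;> omega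

theorem binaryWord_wordVal (w : List Bool) : binaryWord w.length (wordVal w) = w :=
  eq_of_wordVal_eq (by simp) (wordVal_binaryWord _ _ (wordVal_lt w))

theorem wordVal_replicate_append (k : ℕ) (w : List Bool) :
    wordVal (List.replicate k false ++ w) = 2 ^ k * wordVal w := by
  induction k with
  | zero => simp
  | succ k ih => simp [List.replicate_succ, wordVal, ih, pow_succ]; ring

theorem wordVal_replicate (k : ℕ) : wordVal (List.replicate k false) = 0 := by
  simpa [wordVal] using wordVal_replicate_append k []

theorem iterate_wordSucc_replicate {k i : ℕ} (h : i < 2 ^ k) :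
    wordSucc^[i] (List.replicate k false) = binaryWord k i := by
  refine eq_of_wordVal_eq ?_ ?_
  · rw [length_iterate_wordSucc _ _ (by simpa [wordVal_replicate] using h)]; simp
  · rw [wordVal_iterate, wordVal_binaryWord _ _ h, wordVal_replicate, zero_add]

/-- Counting from `k` zeros, the overflow from `2 ^ k - 1` to `2 ^ k` appends a digit. A verifier
recognizes by it that a word has length exactly `2 ^ k`. -/
theorem iterate_wordSucc_eq_iff {k i : ℕ} :
    wordSucc^[i] (List.replicate k false) = List.replicate k false ++ [true] ↔ i = 2 ^ k := by
  have h1 : wordVal (List.replicate k false ++ [true]) = 2 ^ k := by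
    rw [wordVal_replicate_append]; simp [wordVal]
  constructor
  · intro h
    have := congrArg wordVal h
    rwa [wordVal_iterate, h1, wordVal_replicate, zero_add] at this
  · rintro rfl
    have h2 : ∀ k, wordSucc^[2 ^ k - 1] (List.replicate k false) = List.replicate k true := by
      intro k
      have h0 := Nat.one_le_two_pow (n := k)
      refine eq_of_wordVal_eq ?_ ?_
      · rw [length_iterate_wordSucc _ _ (by rw [wordVal_replicate]; simp)]; simp
      · rw [wordVal_iterate, wordVal_replicate, zero_add]
        clear h1 h0
        induction k with
        | zero => rfl
        | succ k ih =>
          rw [List.replicate_succ, wordVal, ← ih, pow_succ]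
          have := Nat.one_le_two_pow (n := k)
          simp only [Bool.toNat_true]
          omega
    have h3 : 2 ^ k = (2 ^ k - 1) + 1 := by have := Nat.one_le_two_pow (n := k); omega
    rw [h3, Function.iterate_succ_apply', h2]
    clear h1 h2 h3
    induction k with
    | zero => rfl
    | succ k ih => simp [List.replicate_succ, wordSucc, ih]

@[fun_prop]
theorem FPoly.wordSucc {γ : Type} [PEnc γ] {w : γ → List Bool} (hw : FPoly w) :
    FPoly fun x => wordSucc (w x) := by
  -- The accumulator consists of the carry, initially one, and of the digits written so far in
  -- reverse order.
  have h := FPoly.foldl (b := fun _ => (true, ([] : List Bool)))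
    (f := fun _ s b => (s.1 && b, (s.1 ^^ b) :: s.2)) hw (by fun_prop) (by fun_prop)
    ⟨fun _ => 10, .const 10, by
      rintro x ⟨c, l⟩ b _
      simp only [size_prod, size_cons, size_bool]
      omega⟩
  have h2 : FPoly fun x => ((bif ((w x).foldl (fun s b => (s.1 && b, (s.1 ^^ b) :: s.2))
      (true, ([] : List Bool))).1 then [true] else []) ++ ((w x).foldl
      (fun s b => (s.1 && b, (s.1 ^^ b) :: s.2)) (true, ([] : List Bool))).2).reverse := by
    fun_prop
  refine cast (congrArg _ ?_) h2
  funext x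
  have e0 : ∀ (w l : List Bool), w.foldl (fun s b => (s.1 && b, (s.1 ^^ b) :: s.2)) (false, l) =
      (false, w.reverse ++ l) := by
    intro w
    induction w with
    | nil => intro l; rfl
    | cons b w ih => intro l; rw [List.foldl_cons]; simp [ih]
  have e1 : ∀ (w l : List Bool), ((bif (w.foldl (fun s b => (s.1 && b, (s.1 ^^ b) :: s.2))
      (true, l)).1 then [true] else []) ++ (w.foldl
      (fun s b => (s.1 && b, (s.1 ^^ b) :: s.2)) (true, l)).2).reverse =
      l.reverse ++ _root_.wordSucc w := by
    intro w
    induction w with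
    | nil => intro l; simp [_root_.wordSucc]
    | cons b w ih =>
      intro l
      rw [List.foldl_cons]
      cases b
      · simp [e0, _root_.wordSucc]
      · simp only [Bool.and_true, Bool.xor_true, Bool.not_true]
        rw [ih]
        simp [_root_.wordSucc]
  simpa using e1 (w x) []

/-! ### Lists of words, encoded as words -/

/-- The word encoding a list of words. -/
def encodeBlocks (L : List (List Bool)) : List Bool :=
  L.flatMap fun w => w.flatMap (fun b => [true, b]) ++ [false]

/-- One step of the decoding of a list of words. -/
def decodeStep (s : Bool × List Bool × List (List Bool)) (b : Bool) :
    Bool × List Bool × List (List Bool) :=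
  bif s.1 then (false, b :: s.2.1, s.2.2)
  else bif b then (true, s.2) else (false, [], s.2.1.reverse :: s.2.2)

/-- The list of words encoded by a word. -/
def decodeBlocks (w : List Bool) : List (List Bool) :=
  (w.foldl decodeStep (false, [], [])).2.2.reverse

theorem decodeBlocks_encodeBlocks (L : List (List Bool)) : decodeBlocks (encodeBlocks L) = L := by
  have h1 : ∀ (w u : List Bool) (o : List (List Bool)),
      (w.flatMap fun b => [true, b]).foldl decodeStep (false, u, o) =
        (false, w.reverse ++ u, o) := by
    intro w
    induction w with
    | nil => intro u o; rfl
    | cons b w ih =>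
      intro u o
      simp only [List.flatMap_cons, List.foldl_append, List.foldl_cons, List.foldl_nil]
      have : decodeStep (decodeStep (false, u, o) true) b = (false, b :: u, o) := rfl
      rw [this, ih]
      simp
  have h2 : ∀ (L o : List (List Bool)), (encodeBlocks L).foldl decodeStep (false, [], o) =
      (false, [], L.reverse ++ o) := by
    intro L
    induction L with
    | nil => intro o; rfl
    | cons w L ih =>
      intro o
      have e : encodeBlocks (w :: L) =
          w.flatMap (fun b => [true, b]) ++ [false] ++ encodeBlocks L := rfl
      rw [e, List.foldl_append, List.foldl_append, h1]
      have : [false].foldl decodeStep (false, w.reverse ++ [], o) = (false, [], w :: o) := by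
        simp [decodeStep]
      rw [this, ih]
      simp
  rw [decodeBlocks, h2]
  simp

theorem length_encodeBlocks (L : List (List Bool)) :
    (encodeBlocks L).length = (L.map fun w => 2 * w.length + 1).sum := by
  induction L with
  | nil => rfl
  | cons w L ih =>
    have e : encodeBlocks (w :: L) =
        w.flatMap (fun b => [true, b]) ++ [false] ++ encodeBlocks L := rfl
    rw [e, List.length_append, ih]
    have : (w.flatMap fun b => [true, b]).length = 2 * w.length := by
      induction w with
      | nil => rfl
      | cons b w ih => simp [List.flatMap_cons] at ih ⊢; omega
    simp [this]

@[fun_prop]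
theorem FPoly.decodeBlocks {γ : Type} [PEnc γ] {w : γ → List Bool} (hw : FPoly w) :
    FPoly fun x => decodeBlocks (w x) := by
  have h := FPoly.foldl (b := fun _ => (false, ([] : List Bool), ([] : List (List Bool))))
    (f := fun _ s b => decodeStep s b) hw (by fun_prop)
    (by unfold decodeStep; fun_prop)
    ⟨fun _ => 10, .const 10, by
      rintro x ⟨c, l, o⟩ b _
      cases c <;> cases b <;>
        simp only [decodeStep, cond_true, cond_false, size_prod, size_cons, size_bool,
          size_reverse, size_nil] <;> omega⟩
  exact h.snd.snd.reverse

/-! ### Truth tables of languages in `NE ∩ coNE` -/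

open Classical in
/-- The truth table of a language on the words of length `k`. -/
noncomputable def truthTable (L : Set (List Bool)) (k : ℕ) : List Bool :=
  List.ofFn fun i : Fin (2 ^ k) => decide (binaryWord k i ∈ L)

theorem length_truthTable (L : Set (List Bool)) (k : ℕ) : (truthTable L k).length = 2 ^ k := by
  simp [truthTable]

/-- One step of a loop that runs through a word and checks each letter, together with the value of
a counter and a word from a list. -/
def scanStep (chk : Bool → List Bool → List Bool → Bool)
    (s : List Bool × List (List Bool) × Bool) (b : Bool) : List Bool × List (List Bool) × Bool :=
  (wordSucc s.1, s.2.1.tail, s.2.2 && chk b s.1 (s.2.1.headD []))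

theorem foldl_scanStep (chk : Bool → List Bool → List Bool → Bool) (z : List Bool) :
    ∀ (c : List Bool) (L : List (List Bool)) (ok : Bool),
      (z.foldl (scanStep chk) (c, L, ok)).1 = wordSucc^[z.length] c ∧
      ((z.foldl (scanStep chk) (c, L, ok)).2.2 = true ↔ ok = true ∧
        ∀ i (h : i < z.length), chk z[i] (wordSucc^[i] c) (L.getD i []) = true) := by
  induction z with
  | nil => intro c L ok; simp
  | cons b z ih =>
    intro c L ok
    obtain ⟨h1, h2⟩ := ih (wordSucc c) L.tail (ok && chk b c (L.headD []))
    rw [List.foldl_cons]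
    refine ⟨h1, ?_⟩
    have e : ∀ i, L.tail.getD i [] = L.getD (i + 1) [] := by
      intro i; cases L <;> simp
    have e0 : L.headD [] = L.getD 0 [] := by cases L <;> simp
    refine h2.trans ?_
    rw [Bool.and_eq_true, and_assoc]
    refine and_congr_right fun _ => ?_
    constructor
    · rintro ⟨h3, h4⟩ i hi
      cases i with
      | zero => rw [e0] at h3; exact h3
      | succ i =>
        have := h4 i (by simpa using hi)
        rw [e] at this
        simpa using this
    · intro h3
      refine ⟨by rw [e0]; exact h3 0 (by simp), fun i hi => ?_⟩
      have := h3 (i + 1) (by simpa using hi)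
      rw [e]
      simpa using this

theorem length_wordSucc_le (w : List Bool) : (wordSucc w).length ≤ w.length + 1 := by
  induction w with
  | nil => simp [wordSucc]
  | cons b w ih => cases b <;> simp [wordSucc, ih]

theorem FPoly.foldl_scanStep {γ : Type} [PEnc γ] {chk : γ → Bool → List Bool → List Bool → Bool}
    {z c : γ → List Bool} {L : γ → List (List Bool)}
    (hchk : FPoly fun p : γ × Bool × List Bool × List Bool => chk p.1 p.2.1 p.2.2.1 p.2.2.2)
    (hz : FPoly z) (hc : FPoly c) (hL : FPoly L) :
    FPoly fun x => (z x).foldl (scanStep (chk x)) (c x, L x, true) := by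
  refine FPoly.foldl (f := fun x => scanStep (chk x)) hz (by fun_prop) ?_ ⟨fun _ => 6, .const 6, ?_⟩
  · have : FPoly fun p : γ × (List Bool × List (List Bool) × Bool) × Bool =>
        chk p.1 p.2.2 p.2.1.1 (p.2.1.2.1.headD []) :=
      hchk.comp (g := fun p : γ × (List Bool × List (List Bool) × Bool) × Bool =>
        (p.1, p.2.2, p.2.1.1, p.2.1.2.1.headD [])) (by fun_prop)
    unfold scanStep
    fun_prop
  · rintro x ⟨c, L, ok⟩ a _
    have h2 := length_wordSucc_le c
    have h3 : size L.tail ≤ size L := by rw [← List.drop_one]; exact size_drop_le _ _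
    simp only [scanStep, size_prod, size_word, size_bool]
    omega

/-- The verifier for truth tables of length at least `2 ^ K₀`. -/
def tableVerifier (K₀ : ℕ) (chk : List Bool → Bool → List Bool → List Bool → Bool)
    (z y : List Bool) : Bool :=
  let c := (decodeBlocks y).headD []
  let s := z.foldl (scanStep (chk z)) (c, (decodeBlocks y).tail, true)
  decide ((List.replicate K₀ true).length ≤ c.length) && (c.all (fun b => !b) &&
    (s.2.2 && decide (s.1 = c ++ [true])))

/-- The first block of the witness is the initial counter, `k` zeros. The counter runs through all
words of length `k` and ends at that block followed by a one exactly if the table has `2 ^ k`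
entries. The other blocks are witnesses for the entries; missing ones read as empty. -/
theorem tableVerifier_iff {K₀ : ℕ} {chk : List Bool → Bool → List Bool → List Bool → Bool}
    {z y : List Bool} : tableVerifier K₀ chk z y = true ↔
      ∃ k, K₀ ≤ k ∧ (decodeBlocks y).headD [] = List.replicate k false ∧ z.length = 2 ^ k ∧
        ∀ i (h : i < z.length), chk z z[i] (binaryWord k i) ((decodeBlocks y).tail.getD i []) =
          true := by
  set c := (decodeBlocks y).headD [] with hc
  obtain ⟨h1, h2⟩ := foldl_scanStep (chk z) z c (decodeBlocks y).tail true
  have h3 : c.all (fun b => !b) = true ↔ c = List.replicate c.length false := by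
    rw [List.eq_replicate_iff]
    simp
  simp only [tableVerifier, Bool.and_eq_true, decide_eq_true_eq, ← hc, h2, h1, h3, true_and,
    List.length_replicate]
  constructor
  · rintro ⟨h4, h5, h6, h7⟩
    rw [h5, iterate_wordSucc_eq_iff] at h7
    refine ⟨c.length, h4, h5, h7, fun i hi => ?_⟩
    rw [← iterate_wordSucc_replicate (h7 ▸ hi), ← h5]
    exact h6 i hi
  · rintro ⟨k, h4, h5, h6, h7⟩
    have hk : c.length = k := by rw [h5]; simp
    refine ⟨by omega, by rw [hk]; exact h5, fun i hi => ?_, ?_⟩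
    · rw [h5, iterate_wordSucc_replicate (h6 ▸ hi)]
      exact h7 i hi
    · rw [h5, iterate_wordSucc_eq_iff, h6]

/-- A witness bound `2 ^ (c * k)` is `(2 ^ k) ^ c`, polynomial in the length of the table. Every
entry is accompanied by a witness for the side it claims, `L` or its complement, so a wrong entry
cannot be certified and a right one always can. -/
theorem setOf_truthTable_mem_NP {L : Set (List Bool)} (h₁ : L ∈ ClassNE) (h₀ : Lᶜ ∈ ClassNE)
    {K₀ : ℕ} (hK : 1 ≤ K₀) : {z | ∃ k, K₀ ≤ k ∧ z = truthTable L k} ∈ ClassNP := by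
  classical
  obtain ⟨F₁, c₁, hF₁, hL₁⟩ := h₁
  obtain ⟨F₀, c₀, hF₀, hL₀⟩ := h₀
  obtain ⟨p₁, hp₁, hlen₁⟩ := FPoly.exists_pow (α := Bool) c₁
  obtain ⟨p₀, hp₀, hlen₀⟩ := FPoly.exists_pow (α := Bool) c₀
  have hF₁' := FPoly.of_polyTimeRel2 hF₁
  have hF₀' := FPoly.of_polyTimeRel2 hF₀
  let chk : List Bool → Bool → List Bool → List Bool → Bool := fun z b c y =>
    bif b then decide (y.length ≤ (p₁ z).length) && F₁ c y
    else decide (y.length ≤ (p₀ z).length) && F₀ c y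
  have hchk : FPoly fun p : List Bool × Bool × List Bool × List Bool =>
      chk p.1 p.2.1 p.2.2.1 p.2.2.2 := by
    have h1 : FPoly fun p : List Bool × Bool × List Bool × List Bool => F₁ p.2.2.1 p.2.2.2 :=
      hF₁'.comp (g := fun p : List Bool × Bool × List Bool × List Bool => p.2.2) (by fun_prop)
    have h0 : FPoly fun p : List Bool × Bool × List Bool × List Bool => F₀ p.2.2.1 p.2.2.2 :=
      hF₀'.comp (g := fun p : List Bool × Bool × List Bool × List Bool => p.2.2) (by fun_prop)
    fun_prop
  have key : ∀ (z : List Bool) (k i : ℕ) (b : Bool), z.length = 2 ^ k →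
      ((∃ y, chk z b (binaryWord k i) y = true) ↔ b = decide (binaryWord k i ∈ L)) := by
    intro z k i b hz
    have e1 := hL₁ (binaryWord k i)
    have e0 := hL₀ (binaryWord k i)
    rw [length_binaryWord, mul_comm, pow_mul] at e1 e0
    cases b
    · simp only [chk, cond_false, Bool.and_eq_true, decide_eq_true_eq, hlen₀, hz, ← e0]
      simp
    · simp only [chk, cond_true, Bool.and_eq_true, decide_eq_true_eq, hlen₁, hz, ← e1]
      simp
  have hchklen : ∀ z b c y, 2 ≤ z.length → chk z b c y = true →
      y.length ≤ z.length ^ (c₀ + c₁) := by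
    intro z b c y hz h
    have h1 := Nat.pow_le_pow_right (show 0 < z.length by omega) (Nat.le_add_right c₀ c₁)
    have h2 := Nat.pow_le_pow_right (show 0 < z.length by omega) (Nat.le_add_left c₁ c₀)
    cases b
    · simp only [chk, cond_false, Bool.and_eq_true, decide_eq_true_eq, hlen₀] at h
      omega
    · simp only [chk, cond_true, Bool.and_eq_true, decide_eq_true_eq, hlen₁] at h
      omega
  -- With `m = 2 ^ k ≥ 2` entries and witnesses of length at most `M = m ^ (c₀ + c₁)`, the blocks
  -- together with the counter take at most `m (2 M + 1) + 2 m + 1 ≤ M m ^ 4` letters.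
  refine ⟨tableVerifier K₀ chk, c₀ + c₁ + 4, ?_, fun z => ?_⟩
  · refine FPoly.polyTimeRel2 ?_
    have h1 := FPoly.foldl_scanStep (γ := List Bool × List Bool) (chk := fun p => chk p.1)
      (z := fun p => p.1) (c := fun p => (decodeBlocks p.2).headD [])
      (L := fun p => (decodeBlocks p.2).tail)
      (hchk.comp (g := fun p : (List Bool × List Bool) × Bool × List Bool × List Bool =>
        (p.1.1, p.2)) (by fun_prop)) (by fun_prop) (by fun_prop) (by fun_prop)
    have h2 : FPoly fun p : List Bool × List Bool =>
        ((decodeBlocks p.2).headD []).all fun b => !b :=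
      FPoly.all (f := fun _ b => !b) (by fun_prop) (by fun_prop)
    simp only [tableVerifier]
    fun_prop
  · constructor
    · rintro ⟨k, hk, rfl⟩
      have hlen := length_truthTable L k
      have hm : 2 ≤ 2 ^ k := by
        calc 2 = 2 ^ 1 := rfl
          _ ≤ 2 ^ k := Nat.pow_le_pow_right (by norm_num) (by omega)
      have hex : ∀ i : Fin (2 ^ k), ∃ y, chk (truthTable L k) (decide (binaryWord k i ∈ L))
          (binaryWord k i) y = true := fun i => (key _ k i _ hlen).2 rfl
      choose y hy using hex
      refine ⟨encodeBlocks (List.replicate k false :: List.ofFn y), ?_, ?_⟩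
      · rw [length_encodeBlocks, List.map_cons, List.sum_cons, List.length_replicate, List.map_ofFn,
          List.sum_ofFn, hlen]
        have h1 : ∀ i : Fin (2 ^ k), 2 * (y i).length + 1 ≤ 2 * (2 ^ k) ^ (c₀ + c₁) + 1 := by
          intro i
          have := hchklen _ _ _ _ (by rw [hlen]; exact hm) (hy i)
          rw [hlen] at this
          omega
        have h2 := Finset.sum_le_card_nsmul Finset.univ
          (fun i : Fin (2 ^ k) => 2 * (y i).length + 1) _ (fun i _ => h1 i)
        rw [Finset.card_univ, Fintype.card_fin, smul_eq_mul] at h2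
        have h3 : k < 2 ^ k := Nat.lt_two_pow_self
        simp only [Function.comp_apply]
        generalize 2 ^ k = m at *
        have h4 : 1 ≤ m ^ (c₀ + c₁) := Nat.one_le_pow _ _ (by omega)
        generalize hM : m ^ (c₀ + c₁) = M at *
        have h5 : m ^ (c₀ + c₁ + 4) = M * m ^ 4 := by rw [pow_add, hM]
        rw [h5]
        have h6 : m * (2 * M + 1) + (2 * m + 1) ≤ M * m ^ 4 := by
          have h7 : 8 * m ≤ m ^ 4 := by
            rw [pow_succ]
            exact Nat.mul_le_mul_right m (Nat.pow_le_pow_left hm 3)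
          have h8 : M * (8 * m) ≤ M * m ^ 4 := Nat.mul_le_mul_left M h7
          nlinarith
        omega
      · rw [tableVerifier_iff]
        refine ⟨k, hk, by rw [decodeBlocks_encodeBlocks]; rfl, hlen, fun i hi => ?_⟩
        rw [decodeBlocks_encodeBlocks]
        have hi' : i < 2 ^ k := hlen ▸ hi
        have := hy ⟨i, hi'⟩
        simp only [List.tail_cons]
        rw [List.getD_eq_getElem _ _ (by simpa using hi')]
        simpa [truthTable] using this
    · rintro ⟨y, -, hy⟩
      obtain ⟨k, hk, -, hlen, h⟩ := tableVerifier_iff.1 hy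
      refine ⟨k, hk, List.ext_getElem (by rw [hlen, length_truthTable]) fun i hi _ => ?_⟩
      rw [(key z k i z[i] hlen).1 ⟨_, h i hi⟩]
      simp [truthTable]

/-! ### Circuit size of families of Boolean functions -/

/-- The wires of a straight-line program. -/
def circuitWires (G : List CircuitGate) (x : List Bool) : List Bool :=
  G.foldl (fun w g => w ++ [g.op (w.getD g.left false) (w.getD g.right false)]) x

theorem circuitWires_append (G G' : List CircuitGate) (x : List Bool) :
    circuitWires (G ++ G') x = circuitWires G' (circuitWires G x) := by
  simp [circuitWires]

theorem circuitWires_concat (G : List CircuitGate) (g : CircuitGate) (x : List Bool) :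
    circuitWires (G ++ [g]) x = circuitWires G x ++
      [g.op ((circuitWires G x).getD g.left false) ((circuitWires G x).getD g.right false)] := by
  simp [circuitWires]

theorem prefix_circuitWires (G : List CircuitGate) (x : List Bool) : x <+: circuitWires G x := by
  induction G using List.reverseRecOn with
  | nil => simp [circuitWires]
  | append_singleton G g ih =>
    rw [circuitWires_concat]
    exact ih.trans (List.prefix_append _ _)

theorem length_circuitWires (G : List CircuitGate) (x : List Bool) :
    (circuitWires G x).length = x.length + G.length := by
  induction G using List.reverseRecOn with
  | nil => simp [circuitWires]
  | append_singleton G g ih => rw [circuitWires_concat]; simp [ih, add_assoc]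

/-- Some wire of the program `G` carries the function `f` on all words of length `ℓ`. -/
def Carries (ℓ : ℕ) (G : List CircuitGate) (f : List Bool → Bool) : Prop :=
  ∃ i < ℓ + G.length, ∀ x : List Bool, x.length = ℓ → (circuitWires G x).getD i false = f x

theorem Carries.append {ℓ : ℕ} {G : List CircuitGate} {f : List Bool → Bool} (h : Carries ℓ G f)
    (G' : List CircuitGate) : Carries ℓ (G ++ G') f := by
  obtain ⟨i, hi, hf⟩ := h
  refine ⟨i, by simp; omega, fun x hx => ?_⟩
  rw [← hf x hx, circuitWires_append]
  obtain ⟨w, hw⟩ := prefix_circuitWires G' (circuitWires G x)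
  rw [← hw, List.getD_append]
  rw [length_circuitWires]; omega

/-- With `k` additional gates, every program that carries the functions in `P` can be extended to
one that carries the functions in `Q`. -/
def Derives (ℓ k : ℕ) (P Q : Set (List Bool → Bool)) : Prop :=
  ∀ G, (∀ f ∈ P, Carries ℓ G f) → ∃ G' : List CircuitGate, G'.length ≤ k ∧
    ∀ g ∈ Q, Carries ℓ (G ++ G') g

namespace Derives

variable {ℓ k k' : ℕ} {P Q R : Set (List Bool → Bool)}

theorem of_subset (h : Q ⊆ P) : Derives ℓ 0 P Q :=
  fun _ hG => ⟨[], le_rfl, fun g hg => by simpa using hG g (h hg)⟩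

theorem mono (h : Derives ℓ k P Q) (hk : k ≤ k') {P' Q' : Set (List Bool → Bool)} (hP : P ⊆ P')
    (hQ : Q' ⊆ Q) : Derives ℓ k' P' Q' := fun G hG => by
  obtain ⟨G', h₁, h₂⟩ := h G fun f hf => hG f (hP hf)
  exact ⟨G', h₁.trans hk, fun g hg => h₂ g (hQ hg)⟩

theorem union_left (h : Derives ℓ k P Q) : Derives ℓ k P (P ∪ Q) := fun G hG => by
  obtain ⟨G', h₁, h₂⟩ := h G hG
  exact ⟨G', h₁, fun g hg => hg.elim (fun hg => (hG g hg).append G') (h₂ g)⟩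

theorem trans (h : Derives ℓ k P Q) (h' : Derives ℓ k' (P ∪ Q) R) : Derives ℓ (k + k') P R :=
  fun G hG => by
  obtain ⟨G₁, h₁, h₂⟩ := h.union_left G hG
  obtain ⟨G₂, h₃, h₄⟩ := h' (G ++ G₁) h₂
  refine ⟨G₁ ++ G₂, by simp; omega, fun g hg => ?_⟩
  rw [← List.append_assoc]
  exact h₄ g hg

theorem const (b : Bool) : Derives ℓ 1 P {fun _ => b} := fun G _ => by
  refine ⟨[⟨fun _ _ => b, 0, 0⟩], le_rfl, ?_⟩
  rintro _ rfl
  refine ⟨ℓ + G.length, by simp, fun x hx => ?_⟩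
  rw [circuitWires_concat, List.getD_append_right _ _ _ _ (by rw [length_circuitWires, hx]),
    length_circuitWires, hx]
  simp

theorem gate {f g : List Bool → Bool} (op : Bool → Bool → Bool) (hf : f ∈ P) (hg : g ∈ P) :
    Derives ℓ 1 P {fun x => op (f x) (g x)} := fun G hG => by
  obtain ⟨i, hi, hfi⟩ := hG f hf
  obtain ⟨j, hj, hgj⟩ := hG g hg
  refine ⟨[⟨op, i, j⟩], le_rfl, ?_⟩
  rintro _ rfl
  refine ⟨ℓ + G.length, by simp, fun x hx => ?_⟩
  rw [circuitWires_concat, List.getD_append_right _ _ _ _ (by rw [length_circuitWires, hx]),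
    length_circuitWires, hx]
  rw [hfi x hx, hgj x hx]
  simp

theorem biUnion {ι : Type*} (I : Finset ι) {F : ι → Set (List Bool → Bool)}
    (h : ∀ i ∈ I, Derives ℓ k P (F i)) : Derives ℓ (I.card * k) P (⋃ i ∈ I, F i) := by
  classical
  induction I using Finset.induction_on with
  | empty => exact (of_subset (by simp)).mono (by simp) subset_rfl subset_rfl
  | insert i I hi ih =>
    have h₁ := ih fun j hj => h j (Finset.mem_insert_of_mem hj)
    have h₂ := ((h i (Finset.mem_insert_self i I)).mono le_rfl
      (Set.subset_union_left (t := ⋃ i ∈ I, F i)) subset_rfl).union_left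
    refine (h₁.trans h₂).mono ?_ subset_rfl ?_
    · rw [Finset.card_insert_of_notMem hi]; ring_nf; omega
    · intro f hf
      simp only [Finset.mem_insert, Set.iUnion_iUnion_eq_or_left, Set.mem_union] at hf ⊢
      tauto

/-- Copying a program, with arbitrary functions in the place of its inputs. -/
theorem subst (H : List CircuitGate) (fs : List (List Bool → Bool)) (hfs : ∀ f ∈ fs, f ∈ P)
    (h₀ : (fun _ => false) ∈ P) :
    Derives ℓ H.length P {g | ∃ i, g = fun x =>
      (circuitWires H (fs.map fun f => f x)).getD i false} := by
  -- A reference to a wire that does not exist reads as `0`; this is why the constant has to be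
  -- available in `P`.
  have key : ∀ (gs : List (List Bool → Bool)) (Q : Set (List Bool → Bool)), (∀ f ∈ gs, f ∈ Q) →
      (fun _ => false) ∈ Q → ∀ i, (fun x => (gs.map fun f => f x).getD i false) ∈ Q := by
    intro gs Q hgs hQ i
    by_cases hi : i < gs.length
    · have : (fun x => (gs.map fun f => f x).getD i false) = gs[i] := by
        funext x; simp [hi]
      rw [this]; exact hgs _ (List.getElem_mem hi)
    · have : (fun x => (gs.map fun f => f x).getD i false) = fun _ => false := by
        funext x; simp [Nat.le_of_not_lt hi]
      rwa [this]
  induction H generalizing P fs with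
  | nil =>
    refine of_subset ?_
    rintro _ ⟨i, rfl⟩
    exact key fs P hfs h₀ i
  | cons g H ih =>
    have h₁ : Derives ℓ 1 P _ := gate g.op (key fs P hfs h₀ g.left) (key fs P hfs h₀ g.right)
    have h₂ := ih (P := P ∪ {fun x => g.op ((fs.map fun f => f x).getD g.left false)
      ((fs.map fun f => f x).getD g.right false)}) (fs ++ [fun x =>
        g.op ((fs.map fun f => f x).getD g.left false) ((fs.map fun f => f x).getD g.right false)])
      (by
        intro f hf
        rcases List.mem_append.1 hf with hf | hf
        · exact Or.inl (hfs f hf)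
        · exact Or.inr (by simpa using hf)) (Or.inl h₀)
    refine (h₁.trans h₂).mono (by simp; omega) subset_rfl ?_
    rintro _ ⟨i, rfl⟩
    refine ⟨i, ?_⟩
    funext x
    simp [circuitWires]

/-- The threshold functions of a list of functions. -/
theorem threshold (gs : List (List Bool → Bool)) (n : ℕ) (hgs : ∀ g ∈ gs, g ∈ P)
    (h₀ : (fun _ => false) ∈ P) (h₁ : (fun _ => true) ∈ P) :
    Derives ℓ (gs.length * (n * 2)) P
      {g | ∃ i ≤ n, g = fun x => decide (i ≤ gs.countP fun f => f x)} := by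
  induction gs with
  | nil =>
    refine (of_subset ?_).mono (by simp) subset_rfl subset_rfl
    rintro _ ⟨i, -, rfl⟩
    cases i <;> simpa
  | cons g gs ih =>
    have h₂ := ih fun f hf => hgs f (List.mem_cons_of_mem _ hf)
    set Q : Set (List Bool → Bool) :=
      {g | ∃ i ≤ n, g = fun x => decide (i ≤ gs.countP fun f => f x)}
    have hg : g ∈ P := hgs g (by simp)
    -- At least `i + 1` of `g :: gs` hold iff at least `i + 1` of `gs` hold, or at least `i` of them
    -- hold and so does `g`. This takes two gates for each threshold.
    have h₃ : Derives ℓ ((Finset.Icc 1 n).card * 2) (P ∪ Q)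
        (⋃ i ∈ Finset.Icc 1 n, {fun x => decide (i ≤ (g :: gs).countP fun f => f x)}) := by
      refine biUnion _ fun i hi => ?_
      obtain ⟨hi, hin⟩ := Finset.mem_Icc.1 hi
      obtain ⟨i, rfl⟩ : ∃ j, i = j + 1 := ⟨i - 1, by omega⟩
      have ha : (fun x => decide (i ≤ gs.countP fun f => f x)) ∈ P ∪ Q :=
        Or.inr ⟨i, by omega, rfl⟩
      have hb : (fun x => decide (i + 1 ≤ gs.countP fun f => f x)) ∈ P ∪ Q :=
        Or.inr ⟨i + 1, hin, rfl⟩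
      have e₁ := gate (ℓ := ℓ) and ha (Or.inl hg)
      have e₂ := gate (ℓ := ℓ) (P := (P ∪ Q) ∪
        {fun x => decide (i ≤ gs.countP fun f => f x) && g x}) or (Or.inl hb) (Or.inr rfl)
      refine (e₁.trans e₂).mono le_rfl subset_rfl ?_
      rintro _ rfl
      simp only [Set.mem_singleton_iff]
      funext x
      rw [List.countP_cons]
      cases g x
      · simp
      · simp only [Bool.and_true, if_true, add_le_add_iff_right]
        rw [← Bool.decide_or, decide_eq_decide]
        omega
    refine (h₂.trans h₃.union_left).mono ?_ subset_rfl ?_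
    · simp; ring_nf; omega
    · rintro _ ⟨i, hi, rfl⟩
      rcases Nat.eq_zero_or_pos i with rfl | hi'
      · left; left; simpa
      · right
        simp only [Set.mem_iUnion]
        exact ⟨i, Finset.mem_Icc.2 ⟨hi', hi⟩, rfl⟩

/-- The majority of a list of functions. -/
theorem majority (gs : List (List Bool → Bool)) (hgs : ∀ g ∈ gs, g ∈ P)
    (h₀ : (fun _ => false) ∈ P) (h₁ : (fun _ => true) ∈ P) :
    Derives ℓ (gs.length * (gs.length * 2 + 2)) P
      {fun x => decide (gs.length < 2 * gs.countP fun f => f x)} := by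
  refine (threshold gs (gs.length + 1) hgs h₀ h₁).mono (by ring_nf; omega) subset_rfl ?_
  rintro _ rfl
  refine ⟨gs.length / 2 + 1, by omega, ?_⟩
  funext x
  rw [decide_eq_decide]
  omega

/-- Functions that can be derived from the inputs are the outputs of a circuit. -/
theorem exists_circuit (fs : List (List Bool → Bool))
    (h : Derives ℓ k {g | ∃ i < ℓ, g = fun x => x.getD i false} {f | f ∈ fs}) :
    ∃ D : BoolCircuit, D.size ≤ k ∧ ∀ x : List Bool, x.length = ℓ → D.eval x = fs.map fun f => f x := by
  obtain ⟨G, hG, hfs⟩ := h [] (by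
    rintro _ ⟨i, hi, rfl⟩
    exact ⟨i, by simpa, fun x _ => rfl⟩)
  choose! out _ hout using hfs
  refine ⟨⟨G, fs.map out⟩, hG, fun x hx => ?_⟩
  simp only [BoolCircuit.eval, List.map_map]
  refine List.map_congr_left fun f hf => ?_
  exact hout f hf x hx

end Derives

/-! ### The Goldreich–Levin decoder -/

section PairwiseIndependence

variable {V : Type*} [AddCommGroup V] [Fintype V] {t : ℕ}

/-- Translating the coordinate `j` lets the argument of `ψ` run uniformly through the group while
`g` stays fixed. Averaging over all translations leaves the mean of `ψ`, which is zero. -/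
theorem sum_mul_eq_zero_of_shift_invariant {ψ : V → ℝ} (hψ : ∑ r, ψ r = 0) {T : Finset (Fin t)}
    {j : Fin t} (hj : j ∈ T) {g : (Fin t → V) → ℝ}
    (hg : ∀ s w, g (s + Pi.single j w) = g s) : ∑ s : Fin t → V, ψ (∑ i ∈ T, s i) * g s = 0 := by
  have hshift : ∀ w : V, ∑ s : Fin t → V, ψ (∑ i ∈ T, s i) * g s =
      ∑ s : Fin t → V, ψ (w + ∑ i ∈ T, s i) * g s := by
    intro w
    rw [← Equiv.sum_comp (Equiv.addRight (Pi.single j w : Fin t → V))]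
    refine Finset.sum_congr rfl fun s _ => ?_
    rw [Equiv.coe_addRight, hg]
    congr 2
    simp only [Pi.add_apply, Finset.sum_add_distrib, Finset.sum_pi_single', if_pos hj]
    abel
  have h : (Fintype.card V : ℝ) * ∑ s : Fin t → V, ψ (∑ i ∈ T, s i) * g s = 0 := by
    calc (Fintype.card V : ℝ) * ∑ s : Fin t → V, ψ (∑ i ∈ T, s i) * g s
        = ∑ w : V, ∑ s : Fin t → V, ψ (w + ∑ i ∈ T, s i) * g s := by
          rw [Finset.sum_congr rfl fun w _ => (hshift w).symm]; simp
      _ = ∑ s : Fin t → V, (∑ w : V, ψ (w + ∑ i ∈ T, s i)) * g s := by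
          rw [Finset.sum_comm]; simp_rw [Finset.sum_mul]
      _ = 0 := by
          refine Finset.sum_eq_zero fun s _ => ?_
          have := Equiv.sum_comp (Equiv.addRight (∑ i ∈ T, s i)) ψ
          simp only [Equiv.coe_addRight] at this
          rw [this, hψ, zero_mul]
  exact (mul_eq_zero.1 h).resolve_left (by simp [Fintype.card_ne_zero])

open Classical in
/-- The sums of the non-empty subfamilies of a random family are pairwise independent, so by
Chebyshev's inequality a positive bias is visible in most samples. -/
theorem card_sum_nonpos_mul_le {φ : V → ℝ} (hφ : ∀ r, φ r ^ 2 ≤ 1) {μ : ℝ} (hμ : 0 ≤ μ)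
    (hφμ : ∑ r, φ r = Fintype.card V * μ) (𝒯 : Finset (Finset (Fin t))) (h𝒯 : ∅ ∉ 𝒯) :
    ((Finset.univ.filter fun s : Fin t → V => ∑ T ∈ 𝒯, φ (∑ i ∈ T, s i) ≤ 0).card : ℝ) *
      (𝒯.card * μ ^ 2) ≤ Fintype.card (Fin t → V) := by
  set ψ : V → ℝ := fun r => φ r - μ with hψ
  have hψ0 : ∑ r, ψ r = 0 := by simp [hψ, Finset.sum_sub_distrib, hφμ]
  have hcross : ∀ T ∈ 𝒯, ∀ T' ∈ 𝒯, T ≠ T' →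
      ∑ s : Fin t → V, ψ (∑ i ∈ T, s i) * ψ (∑ i ∈ T', s i) = 0 := by
    have aux : ∀ (T T' : Finset (Fin t)) (j : Fin t), j ∈ T → j ∉ T' →
        ∑ s : Fin t → V, ψ (∑ i ∈ T, s i) * ψ (∑ i ∈ T', s i) = 0 := by
      intro T T' j hj hj'
      refine sum_mul_eq_zero_of_shift_invariant hψ0 hj fun s w => ?_
      congr 1
      simp only [Pi.add_apply, Finset.sum_add_distrib, Finset.sum_pi_single', if_neg hj', add_zero]
    intro T _ T' _ hne
    -- Distinct index sets differ in a coordinate that belongs to only one of them, and the factor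
    -- of the other set does not depend on it.
    by_cases h : T ⊆ T'
    · obtain ⟨j, hj, hj'⟩ := Finset.exists_of_ssubset (h.ssubset_of_ne hne)
      simp_rw [mul_comm (ψ (∑ i ∈ T, _))]
      exact aux T' T j hj hj'
    · obtain ⟨j, hj, hj'⟩ := Finset.not_subset.1 h
      exact aux T T' j hj hj'
  have hdiag : ∀ T ∈ 𝒯, ∑ s : Fin t → V, ψ (∑ i ∈ T, s i) * ψ (∑ i ∈ T, s i) ≤
      Fintype.card (Fin t → V) := by
    intro T hT
    obtain ⟨j, hj⟩ : T.Nonempty := Finset.nonempty_iff_ne_empty.2 fun h => h𝒯 (h ▸ hT)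
    have h0 : ∑ s : Fin t → V, ψ (∑ i ∈ T, s i) * 1 = 0 :=
      sum_mul_eq_zero_of_shift_invariant (g := fun _ => 1) hψ0 hj fun _ _ => rfl
    -- As `φ = ψ + μ` and `φ² ≤ 1`, one has `ψ² ≤ 1 - 2 μ ψ`, and the linear term averages to zero.
    calc ∑ s : Fin t → V, ψ (∑ i ∈ T, s i) * ψ (∑ i ∈ T, s i)
        ≤ ∑ s : Fin t → V, (1 - 2 * μ * (ψ (∑ i ∈ T, s i) * 1)) := by
          refine Finset.sum_le_sum fun s _ => ?_
          have := hφ (∑ i ∈ T, s i)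
          simp only [hψ]
          nlinarith [sq_nonneg μ]
      _ = Fintype.card (Fin t → V) := by
          rw [Finset.sum_sub_distrib, ← Finset.mul_sum, h0]; simp
  have hvar : ∑ s : Fin t → V, (∑ T ∈ 𝒯, ψ (∑ i ∈ T, s i)) ^ 2 ≤
      𝒯.card * Fintype.card (Fin t → V) := by
    calc ∑ s : Fin t → V, (∑ T ∈ 𝒯, ψ (∑ i ∈ T, s i)) ^ 2
        = ∑ T ∈ 𝒯, ∑ T' ∈ 𝒯, ∑ s : Fin t → V, ψ (∑ i ∈ T, s i) * ψ (∑ i ∈ T', s i) := by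
          simp_rw [sq, Finset.sum_mul_sum]
          rw [Finset.sum_comm]
          exact Finset.sum_congr rfl fun T _ => Finset.sum_comm
      _ ≤ ∑ T ∈ 𝒯, (Fintype.card (Fin t → V) : ℝ) := by
          refine Finset.sum_le_sum fun T hT => ?_
          rw [Finset.sum_eq_single T (fun T' hT' hne => hcross T hT T' hT' hne.symm)
            (fun h => absurd hT h)]
          exact hdiag T hT
      _ = _ := by simp
  set bad := Finset.univ.filter fun s : Fin t → V => ∑ T ∈ 𝒯, φ (∑ i ∈ T, s i) ≤ 0
  -- On a bad sample the centred sum is at most `-|𝒯| μ`, so its square is at least `(|𝒯| μ)²`.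
  have hbad : (bad.card : ℝ) * (𝒯.card * μ) ^ 2 ≤
      ∑ s : Fin t → V, (∑ T ∈ 𝒯, ψ (∑ i ∈ T, s i)) ^ 2 := by
    calc (bad.card : ℝ) * (𝒯.card * μ) ^ 2 = ∑ s ∈ bad, ((𝒯.card : ℝ) * μ) ^ 2 := by simp
      _ ≤ ∑ s ∈ bad, (∑ T ∈ 𝒯, ψ (∑ i ∈ T, s i)) ^ 2 := by
          refine Finset.sum_le_sum fun s hs => ?_
          have h₁ : ∑ T ∈ 𝒯, φ (∑ i ∈ T, s i) ≤ 0 := (Finset.mem_filter.1 hs).2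
          have h₂ : ∑ T ∈ 𝒯, ψ (∑ i ∈ T, s i) = ∑ T ∈ 𝒯, φ (∑ i ∈ T, s i) - 𝒯.card * μ := by
            simp [hψ, Finset.sum_sub_distrib]
          have h₃ : 0 ≤ (𝒯.card : ℝ) * μ := by positivity
          rw [h₂]
          nlinarith
      _ ≤ _ := Finset.sum_le_sum_of_subset_of_nonneg (Finset.subset_univ _)
          fun _ _ _ => sq_nonneg _
  rcases 𝒯.eq_empty_or_nonempty with rfl | hne
  · simp
  · have hc : (0 : ℝ) < 𝒯.card := by exact_mod_cast hne.card_pos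
    have := hbad.trans hvar
    refine le_of_mul_le_mul_left ?_ hc
    calc (𝒯.card : ℝ) * (bad.card * (𝒯.card * μ ^ 2)) = bad.card * (𝒯.card * μ) ^ 2 := by ring
      _ ≤ _ := this

end PairwiseIndependence

/-- The non-empty subsets of `Fin t`. -/
def nonemptySets (t : ℕ) : Finset (Finset (Fin t)) := Finset.univ.erase ∅

theorem card_nonemptySets (t : ℕ) : (nonemptySets t).card = 2 ^ t - 1 := by
  rw [nonemptySets, Finset.card_erase_of_mem (Finset.mem_univ _)]; simp

open Classical in
/-- Goldreich–Levin decoding of a noisy linear form `B`, from guesses `b` for its values at the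
points `s`. -/
def linearDecode {q t : ℕ} (B : (Fin q → ZMod 2) → ZMod 2) (s : Fin t → Fin q → ZMod 2)
    (b : Fin t → ZMod 2) (i : Fin q) : ZMod 2 :=
  if (nonemptySets t).card < 2 * ((nonemptySets t).filter fun T =>
    B (Pi.single i 1 + ∑ j ∈ T, s j) + ∑ j ∈ T, b j = 1).card then 1 else 0

/-- `1` if `B` is right at `r` and `-1` otherwise. -/
def agreement {q : ℕ} (B : (Fin q → ZMod 2) → ZMod 2) (v r : Fin q → ZMod 2) : ℝ :=
  if B r = v ⬝ᵥ r then 1 else -1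

/-- When the guesses are the true values of the form, the vote of `T` equals `v i` exactly if `B` is
right at the point queried for `T`. A positive sum of agreements means that more than half of the
votes are right. -/
theorem linearDecode_apply_eq {q t : ℕ} {B : (Fin q → ZMod 2) → ZMod 2}
    {s : Fin t → Fin q → ZMod 2} {v : Fin q → ZMod 2} {i : Fin q}
    (h : 0 < ∑ T ∈ nonemptySets t, agreement B v (Pi.single i 1 + ∑ j ∈ T, s j)) :
    linearDecode B s (fun j => v ⬝ᵥ s j) i = v i := by
  classical
  set R := (nonemptySets t).filter fun T =>
    B (Pi.single i 1 + ∑ j ∈ T, s j) = v ⬝ᵥ (Pi.single i 1 + ∑ j ∈ T, s j) with hR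
  have hsum : ∑ T ∈ nonemptySets t, agreement B v (Pi.single i 1 + ∑ j ∈ T, s j) =
      2 * R.card - (nonemptySets t).card := by
    have : ∀ T ∈ nonemptySets t, agreement B v (Pi.single i 1 + ∑ j ∈ T, s j) =
        2 * (if B (Pi.single i 1 + ∑ j ∈ T, s j) = v ⬝ᵥ (Pi.single i 1 + ∑ j ∈ T, s j)
          then 1 else 0) - 1 := by
      intro T _
      unfold agreement
      split_ifs <;> norm_num
    rw [Finset.sum_congr rfl this, Finset.sum_sub_distrib, ← Finset.mul_sum, Finset.sum_boole]
    simp [hR]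
  have hmaj : (nonemptySets t).card < 2 * R.card := by
    rw [hsum] at h
    have : ((nonemptySets t).card : ℝ) < 2 * R.card := by linarith
    exact_mod_cast this
  have hdot : ∀ T : Finset (Fin t), v ⬝ᵥ (Pi.single i 1 + ∑ j ∈ T, s j) =
      v i + ∑ j ∈ T, v ⬝ᵥ s j := by
    intro T
    rw [dotProduct_add, dotProduct_sum]; simp
  have hz : ∀ x y c : ZMod 2, x = y + c ↔ x + c = y := by decide
  have hR' : R = (nonemptySets t).filter fun T =>
      B (Pi.single i 1 + ∑ j ∈ T, s j) + ∑ j ∈ T, v ⬝ᵥ s j = v i := by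
    rw [hR]
    refine Finset.filter_congr fun T _ => ?_
    rw [hdot, hz]
  have hcases : ∀ x : ZMod 2, x = 1 ∨ x = 0 := by decide
  unfold linearDecode
  rcases hcases (v i) with hv | hv
  · rw [hv] at hR'
    rw [if_pos (by convert hmaj using 3; exact hR'.symm), hv]
  · rw [hv] at hR' ⊢
    refine if_neg ?_
    have hdisj := Finset.card_filter_add_card_filter_not (s := nonemptySets t) fun T =>
      B (Pi.single i 1 + ∑ j ∈ T, s j) + ∑ j ∈ T, v ⬝ᵥ s j = 0
    have hone : (nonemptySets t).filter (fun T =>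
        B (Pi.single i 1 + ∑ j ∈ T, s j) + ∑ j ∈ T, v ⬝ᵥ s j = 1) =
        (nonemptySets t).filter (fun T =>
        ¬ B (Pi.single i 1 + ∑ j ∈ T, s j) + ∑ j ∈ T, v ⬝ᵥ s j = 0) := by
      refine Finset.filter_congr fun T _ => ?_
      have : ∀ x : ZMod 2, x = 1 ↔ ¬ x = 0 := by decide
      exact this _
    rw [← hR', ← hone] at hdisj
    have hc : ((nonemptySets t).filter (fun T =>
        B (Pi.single i 1 + ∑ j ∈ T, s j) + ∑ j ∈ T, v ⬝ᵥ s j = 1)).card + R.card =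
        (nonemptySets t).card := by rw [← hdisj]; ring
    dsimp only
    convert Nat.not_lt.2 (show 2 * ((nonemptySets t).filter (fun T =>
        B (Pi.single i 1 + ∑ j ∈ T, s j) + ∑ j ∈ T, v ⬝ᵥ s j = 1)).card ≤
          (nonemptySets t).card by omega)

open Classical in
/-- If `B` is noticeably correlated with `v`, then at least half of the samples `s` allow the
decoding of `v`. -/
theorem card_linearDecode_eq_ge {q t S : ℕ} (hS : 1 ≤ S) (ht : 8 * q * S ^ 2 < 2 ^ t)
    {B : (Fin q → ZMod 2) → ZMod 2} {v : Fin q → ZMod 2}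
    (hv : (2 : ℝ) ^ q ≤ 2 * S * ∑ r, agreement B v r) :
    ((2 : ℝ) ^ q) ^ t ≤ 2 * (Finset.univ.filter fun s : Fin t → Fin q → ZMod 2 =>
      linearDecode B s (fun j => v ⬝ᵥ s j) = v).card := by
  set μ : ℝ := (∑ r, agreement B v r) / 2 ^ q with hμ
  have hN : (0 : ℝ) < 2 ^ q := by positivity
  have hS' : (1 : ℝ) ≤ S := by exact_mod_cast hS
  have hμ1 : 1 ≤ 2 * S * μ := by
    rw [hμ, ← mul_div_assoc, le_div_iff₀ hN]; linarith
  have hμ0 : 0 ≤ μ := by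
    by_contra h
    nlinarith
  have hcard : (Fintype.card (Fin q → ZMod 2) : ℝ) = 2 ^ q := by simp [ZMod.card]
  have hcard' : (Fintype.card (Fin t → Fin q → ZMod 2) : ℝ) = (2 ^ q) ^ t := by simp [ZMod.card]
  set bad : Fin q → Finset (Fin t → Fin q → ZMod 2) := fun i => Finset.univ.filter fun s =>
    ∑ T ∈ nonemptySets t, agreement B v (Pi.single i 1 + ∑ j ∈ T, s j) ≤ 0 with hbad
  have hM : (8 * q * S ^ 2 : ℝ) ≤ (nonemptySets t).card := by
    rw [card_nonemptySets]
    have : 8 * q * S ^ 2 ≤ 2 ^ t - 1 := by omega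
    exact_mod_cast this
  -- With bias `μ ≥ 1 / (2 S)` and at least `8 q S²` votes, a given coordinate fails on at most a
  -- fraction `1 / (2 q)` of the samples. The union bound over the coordinates then loses at most
  -- half of them.
  have hbadi : ∀ i, ((bad i).card : ℝ) * (2 * q) ≤ (2 ^ q) ^ t := by
    intro i
    have h := card_sum_nonpos_mul_le (V := Fin q → ZMod 2) (t := t) (φ := fun r => agreement B v (Pi.single i 1 + r))
      (fun r => by unfold agreement; split_ifs <;> norm_num) hμ0
      (by
        have := Equiv.sum_comp (Equiv.addLeft (Pi.single i 1 : Fin q → ZMod 2)) (agreement B v)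
        simp only [Equiv.coe_addLeft] at this
        rw [this, hcard, hμ]
        field_simp) (nonemptySets t) (by simp [nonemptySets])
    rw [hcard'] at h
    refine le_trans (mul_le_mul_of_nonneg_left ?_ (Nat.cast_nonneg _)) h
    calc (2 * q : ℝ) ≤ 2 * q * (2 * S * μ) ^ 2 := by
          have : (1 : ℝ) ≤ (2 * S * μ) ^ 2 := by nlinarith
          have hq : (0 : ℝ) ≤ 2 * q := by positivity
          nlinarith
      _ = (8 * q * S ^ 2) * μ ^ 2 := by ring
      _ ≤ _ := by gcongr
  have hcover : (Finset.univ : Finset (Fin t → Fin q → ZMod 2)) ⊆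
      (Finset.univ.filter fun s => linearDecode B s (fun j => v ⬝ᵥ s j) = v) ∪
        Finset.univ.biUnion bad := by
    intro s _
    by_cases hs : ∃ i, s ∈ bad i
    · obtain ⟨i, hi⟩ := hs
      exact Finset.mem_union_right _ (Finset.mem_biUnion.2 ⟨i, Finset.mem_univ _, hi⟩)
    · refine Finset.mem_union_left _ (Finset.mem_filter.2 ⟨Finset.mem_univ _, ?_⟩)
      funext i
      refine linearDecode_apply_eq ?_
      by_contra h
      exact hs ⟨i, Finset.mem_filter.2 ⟨Finset.mem_univ _, not_lt.1 h⟩⟩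
  have h₁ := (Finset.card_le_card hcover).trans ((Finset.card_union_le _ _).trans
    (Nat.add_le_add_left Finset.card_biUnion_le _))
  have h₂ : ((2 : ℝ) ^ q) ^ t ≤ (Finset.univ.filter fun s : Fin t → Fin q → ZMod 2 =>
      linearDecode B s (fun j => v ⬝ᵥ s j) = v).card + ∑ i, ((bad i).card : ℝ) := by
    rw [← hcard', ← Finset.card_univ]
    exact_mod_cast h₁
  have h₃ : 2 * ∑ i, ((bad i).card : ℝ) ≤ (2 ^ q) ^ t := by
    rcases Nat.eq_zero_or_pos q with rfl | hq
    · simp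
    · have hq' : (0 : ℝ) < q := by exact_mod_cast hq
      have : ∑ i, ((bad i).card : ℝ) * (2 * q) ≤ ∑ _i : Fin q, ((2 : ℝ) ^ q) ^ t :=
        Finset.sum_le_sum fun i _ => hbadi i
      rw [← Finset.sum_mul, Finset.sum_const, Finset.card_univ, Fintype.card_fin,
        nsmul_eq_mul] at this
      nlinarith
  linarith

open Classical in
/-- The Goldreich–Levin theorem, with the sample and the guesses fixed. -/
theorem exists_linearDecode {q t S : ℕ} (hS : 1 ≤ S) (ht : 8 * q * S ^ 2 < 2 ^ t)
    (B : (Fin q → ZMod 2) → (Fin q → ZMod 2) → ZMod 2)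
    (hB : (2 : ℝ) ^ q * 2 ^ q ≤ S * ∑ v, ∑ r, agreement (B v) v r) :
    ∃ (s : Fin t → Fin q → ZMod 2) (b : Fin t → ZMod 2),
      (2 : ℝ) ^ q ≤ 4 * S * 2 ^ t * (Finset.univ.filter fun v => linearDecode (B v) s b = v).card := by
  have hS' : (1 : ℝ) ≤ S := by exact_mod_cast hS
  have hN : (0 : ℝ) < 2 ^ q := by positivity
  have hcard : (Fintype.card (Fin q → ZMod 2) : ℝ) = 2 ^ q := by simp [ZMod.card]
  -- Markov's argument: the mean correlation is at least `1 / S`, so a fraction of at least `1 / (2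
  -- S)` of all `v` have correlation at least `1 / (2 S)`.
  set good := Finset.univ.filter fun v => (2 : ℝ) ^ q ≤ 2 * S * ∑ r, agreement (B v) v r with hgood
  have hgood_card : (2 : ℝ) ^ q ≤ 2 * S * good.card := by
    have hle : ∀ v, 2 * S * ∑ r, agreement (B v) v r ≤
        2 ^ q + (if v ∈ good then 2 * S * 2 ^ q else 0 : ℝ) := by
      intro v
      split_ifs with h
      · have : ∑ r, agreement (B v) v r ≤ ∑ _r : Fin q → ZMod 2, (1 : ℝ) :=
          Finset.sum_le_sum fun r _ => by unfold agreement; split_ifs <;> norm_num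
        rw [Finset.sum_const, Finset.card_univ, nsmul_eq_mul, hcard, mul_one] at this
        have : 2 * (S : ℝ) * ∑ r, agreement (B v) v r ≤ 2 * S * 2 ^ q := by gcongr
        linarith
      · have : ¬ (2 : ℝ) ^ q ≤ 2 * S * ∑ r, agreement (B v) v r := fun h' =>
          h (Finset.mem_filter.2 ⟨Finset.mem_univ _, h'⟩)
        linarith
    have hsum := Finset.sum_le_sum fun v (_ : v ∈ Finset.univ) => hle v
    rw [← Finset.mul_sum, Finset.sum_add_distrib, Finset.sum_const, Finset.card_univ, nsmul_eq_mul,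
      hcard, Finset.sum_ite_mem, Finset.univ_inter, Finset.sum_const, nsmul_eq_mul] at hsum
    have : (2 : ℝ) ^ q * 2 ^ q ≤ good.card * (2 * S * 2 ^ q) := by linarith
    refine le_of_mul_le_mul_right ?_ hN
    linarith
  by_contra hcon
  push Not at hcon
  set W : (Fin t → Fin q → ZMod 2) → (Fin t → ZMod 2) → Finset (Fin q → ZMod 2) := fun s b =>
    Finset.univ.filter fun v => linearDecode (B v) s b = v with hW
  -- For a good `v`, half of the samples decode `v` with the right guesses, one choice out of `2 ^
  -- t`. The mean fraction decoded, over samples and guesses, is thus at least `1 / (4 S 2 ^ t)`,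
  -- and some pair attains the mean.
  have hlow : (2 : ℝ) ^ q * (2 ^ q) ^ t ≤ 4 * S * ∑ s, ∑ b, ((W s b).card : ℝ) := by
    have h₁ : ∀ v, (if v ∈ good then ((2 : ℝ) ^ q) ^ t else 0) ≤
        2 * ∑ s : Fin t → Fin q → ZMod 2, ∑ b : Fin t → ZMod 2,
          (if linearDecode (B v) s b = v then 1 else 0 : ℝ) := by
      intro v
      have hpos : ∀ s : Fin t → Fin q → ZMod 2,
          (if linearDecode (B v) s (fun j => v ⬝ᵥ s j) = v then 1 else 0 : ℝ) ≤
          ∑ b : Fin t → ZMod 2, (if linearDecode (B v) s b = v then 1 else 0 : ℝ) := fun s =>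
        Finset.single_le_sum (f := fun b => (if linearDecode (B v) s b = v then 1 else 0 : ℝ))
          (fun _ _ => by positivity) (Finset.mem_univ _)
      split_ifs with h
      · refine (card_linearDecode_eq_ge hS ht (Finset.mem_filter.1 h).2).trans ?_
        have := Finset.sum_le_sum fun s (_ : s ∈ Finset.univ) => hpos s
        rw [Finset.sum_boole] at this
        linarith
      · positivity
    have h₂ := Finset.sum_le_sum fun v (_ : v ∈ Finset.univ) => h₁ v
    rw [Finset.sum_ite_mem, Finset.univ_inter, Finset.sum_const, nsmul_eq_mul, ← Finset.mul_sum,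
      Finset.sum_comm] at h₂
    have h₃ : ∀ s : Fin t → Fin q → ZMod 2, ∑ v, ∑ b : Fin t → ZMod 2,
        (if linearDecode (B v) s b = v then 1 else 0 : ℝ) = ∑ b, ((W s b).card : ℝ) := by
      intro s
      rw [Finset.sum_comm]
      exact Finset.sum_congr rfl fun b _ => by rw [Finset.sum_boole]
    rw [Finset.sum_congr rfl fun s _ => h₃ s] at h₂
    have hpow : (0 : ℝ) < (2 ^ q) ^ t := by positivity
    calc (2 : ℝ) ^ q * (2 ^ q) ^ t ≤ (2 * S * good.card) * (2 ^ q) ^ t := by gcongr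
      _ = 2 * S * (good.card * (2 ^ q) ^ t) := by ring
      _ ≤ 2 * S * (2 * ∑ s, ∑ b, ((W s b).card : ℝ)) := by gcongr
      _ = _ := by ring
  have hup : 4 * S * 2 ^ t * ∑ s, ∑ b, ((W s b).card : ℝ) <
      2 ^ t * ((2 : ℝ) ^ q * (2 ^ q) ^ t) := by
    have hc : ∑ _s : Fin t → Fin q → ZMod 2, ∑ _b : Fin t → ZMod 2, (2 : ℝ) ^ q =
        2 ^ t * ((2 : ℝ) ^ q * (2 ^ q) ^ t) := by
      simp [ZMod.card]; ring
    rw [← hc, Finset.mul_sum]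
    refine Finset.sum_lt_sum_of_nonempty Finset.univ_nonempty fun s _ => ?_
    rw [Finset.mul_sum]
    exact Finset.sum_lt_sum_of_nonempty Finset.univ_nonempty fun b _ => hcon s b
  have h2 : (0 : ℝ) < 2 ^ t := by positivity
  nlinarith

/-! ### Hard-core bits -/

/-- The element of `ZMod 2` given by a bit. -/
def bitVal (b : Bool) : ZMod 2 := if b then 1 else 0

theorem bitVal_decide (z : ZMod 2) : bitVal (decide (z = 1)) = z := by revert z; decide

theorem decide_bitVal (b : Bool) : decide (bitVal b = 1) = b := by revert b; decide

/-- The bits of a vector over the two-element field. -/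
def bitEquiv (q : ℕ) : (Fin q → ZMod 2) ≃ (Fin q → Bool) where
  toFun v i := decide (v i = 1)
  invFun x i := bitVal (x i)
  left_inv v := funext fun i => bitVal_decide (v i)
  right_inv x := funext fun i => decide_bitVal (x i)

/-- The word of a vector over the two-element field. -/
def vecWord {q : ℕ} (v : Fin q → ZMod 2) : List Bool := List.ofFn (bitEquiv q v)

@[simp] theorem length_vecWord {q : ℕ} (v : Fin q → ZMod 2) : (vecWord v).length = q := by
  simp [vecWord]

theorem vecWord_injective {q : ℕ} : Function.Injective (vecWord (q := q)) :=
  List.ofFn_injective.comp (bitEquiv q).injective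

theorem exists_vecWord_eq {q : ℕ} {w : List Bool} (hw : w.length = q) :
    ∃ v : Fin q → ZMod 2, vecWord v = w := by
  subst hw
  exact ⟨(bitEquiv _).symm w.get, by simp [vecWord]⟩

theorem innerBit_vecWord {q : ℕ} (v r : Fin q → ZMod 2) (e : List Bool) :
    innerBit (vecWord v) (vecWord r ++ e) = decide (v ⬝ᵥ r = 1) := by
  induction q with
  | zero => simp [vecWord, innerBit]
  | succ q ih =>
    have h := ih (fun i => v i.succ) (fun i => r i.succ)
    have hb : ∀ a b c : ZMod 2, ((decide (a = 1) && decide (b = 1)) ^^ decide (c = 1)) =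
        decide (a * b + c = 1) := by decide
    have hd : v ⬝ᵥ r = v 0 * r 0 + (fun i : Fin q => v i.succ) ⬝ᵥ (fun i => r i.succ) := by
      simp [dotProduct, Fin.sum_univ_succ]
    rw [hd, ← hb, ← h]
    simp [vecWord, innerBit, bitEquiv, List.ofFn_succ]

-- Averaging over the last `p` letters; the others are read as two vectors of length `q`.
open Classical in
theorem exists_suffix_card_ge {q p : ℕ} {E : List Bool → Prop} {c : ℝ}
    (h : c ≤ wordProb (q + q + p) E) : ∃ e : List Bool, e.length = p ∧
      c * (2 ^ q * 2 ^ q) ≤ ∑ y : Fin q → ZMod 2, ∑ r : Fin q → ZMod 2,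
        if E (vecWord y ++ vecWord r ++ e) then 1 else 0 := by
  by_contra hcon
  push Not at hcon
  have hsum : ((Finset.univ.filter fun v : Fin (q + q + p) → Bool => E (List.ofFn v)).card : ℝ) =
      ∑ e : Fin p → Bool, ∑ y : Fin q → ZMod 2, ∑ r : Fin q → ZMod 2,
        if E (vecWord y ++ vecWord r ++ List.ofFn e) then 1 else 0 := by
    rw [← Finset.sum_boole, ← Equiv.sum_comp (Fin.appendEquiv (α := Bool) (q + q) p),
      Fintype.sum_prod_type_right]
    refine Finset.sum_congr rfl fun e _ => ?_
    rw [← Equiv.sum_comp (Fin.appendEquiv (α := Bool) q q), Fintype.sum_prod_type,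
      ← Equiv.sum_comp (bitEquiv q)]
    refine Finset.sum_congr rfl fun y _ => ?_
    rw [← Equiv.sum_comp (bitEquiv q)]
    refine Finset.sum_congr rfl fun r _ => ?_
    simp [vecWord, Fin.appendEquiv, List.ofFn_fin_append]
  have hlt : ∑ e : Fin p → Bool, (∑ y : Fin q → ZMod 2, ∑ r : Fin q → ZMod 2,
        if E (vecWord y ++ vecWord r ++ List.ofFn e) then 1 else 0 : ℝ) <
      ∑ _e : Fin p → Bool, c * (2 ^ q * 2 ^ q) :=
    Finset.sum_lt_sum_of_nonempty Finset.univ_nonempty fun e _ => hcon _ (by simp)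
  rw [← hsum] at hlt
  simp only [Finset.sum_const, Finset.card_univ, nsmul_eq_mul, Fintype.card_pi,
    Fintype.card_bool, Finset.prod_const, Fintype.card_fin, Nat.cast_pow, Nat.cast_ofNat] at hlt
  rw [wordProb, le_div_iff₀ (by positivity)] at h
  have : (2 : ℝ) ^ (q + q + p) = 2 ^ p * (2 ^ q * 2 ^ q) := by ring
  rw [this] at h
  linarith

theorem countP_toList {ι : Type*} (I : Finset ι) (p : ι → Prop) [DecidablePred p] :
    I.toList.countP (fun i => decide (p i)) = (I.filter p).card := by
  have h : ((I.toList : Multiset ι).countP p) = (I.filter p).card := by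
    rw [Finset.coe_toList, Multiset.countP_eq_card_filter, ← Finset.filter_val, Finset.card_val]
  rw [← h, Multiset.coe_countP]

/-- The decoder of the Goldreich–Levin theorem as a circuit. -/
theorem exists_circuit_linearDecode {q t : ℕ} (C : BoolCircuit) (e : List Bool)
    (s : Fin t → Fin q → ZMod 2) (b : Fin t → ZMod 2) :
    ∃ D : BoolCircuit, D.size ≤ 2 + q * (2 ^ t * (C.size + 2 * 2 ^ t + 3)) ∧
      ∀ y : Fin q → ZMod 2, D.eval (vecWord y) = vecWord (linearDecode
        (fun r => bitVal ((C.eval (vecWord y ++ vecWord r ++ e)).getD 0 false)) s b) := by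
  classical
  set inputs : Set (List Bool → Bool) := {g | ∃ i < q, g = fun x => x.getD i false} with hinputs
  set P : Set (List Bool → Bool) := (inputs ∪ {fun _ => false}) ∪ {fun _ => true} with hP
  have hconst : Derives q 2 inputs P := by
    have h := ((Derives.const (ℓ := q) (P := inputs) false).union_left.trans
      (Derives.const true).union_left)
    exact h.mono le_rfl subset_rfl (by rw [hP]; intro f; simp)
  have hP₀ : (fun _ => false) ∈ P := by simp [hP]
  have hP₁ : (fun _ => true) ∈ P := by simp [hP]
  have hPc : ∀ c : Bool, (fun _ => c) ∈ P := by rintro (_ | _) <;> assumption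
  -- The circuit `C` with the second half `r` and the suffix `e` hard-wired, so that only the first
  -- half remains as input.
  set run : (Fin q → ZMod 2) → List Bool → Bool := fun r x =>
    (C.eval ((List.ofFn fun i : Fin q => x.getD i false) ++ vecWord r ++ e)).getD 0 false with hrun
  have hcopy : ∀ r, Derives q C.size P {run r} := by
    intro r
    have h := Derives.subst (ℓ := q) (P := P) C.gates
      ((List.ofFn fun i : Fin q => fun x : List Bool => x.getD i false) ++
        (vecWord r ++ e).map fun c _ => c) (by
        intro f hf
        rw [List.mem_append] at hf
        rcases hf with hf | hf
        · rw [List.mem_ofFn] at hf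
          obtain ⟨i, rfl⟩ := hf
          exact Or.inl (Or.inl ⟨i, i.2, rfl⟩)
        · obtain ⟨c, -, rfl⟩ := List.mem_map.1 hf
          exact hPc c) hP₀
    rcases hC : C.outputs with _ | ⟨o, os⟩
    · have : run r = fun _ => false := by funext x; simp [hrun, BoolCircuit.eval, hC]
      rw [this]
      exact (Derives.of_subset (by simpa using hP₀)).mono (Nat.zero_le _) subset_rfl subset_rfl
    · refine h.mono le_rfl subset_rfl ?_
      rintro _ rfl
      refine ⟨o, ?_⟩
      funext x
      simp only [hrun, BoolCircuit.eval, hC, List.map_cons, List.getD_cons_zero, List.map_append,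
        List.map_ofFn, List.map_map, List.append_assoc]
      congr 1
      simp only [BoolCircuit.wires, circuitWires, Function.comp_def, List.map_id_fun', id]
  -- For each coordinate and each index set there is one copy of `C` and one gate that adds the
  -- constant `∑ b j`; a majority for each coordinate follows.
  set vote : Fin q × Finset (Fin t) → List Bool → Bool := fun p x =>
    decide (bitVal (run (Pi.single p.1 1 + ∑ j ∈ p.2, s j) x) + ∑ j ∈ p.2, b j = 1) with hvote
  have hvotes : Derives q (((Finset.univ : Finset (Fin q)) ×ˢ nonemptySets t).card * (C.size + 1)) P
      (⋃ p ∈ Finset.univ ×ˢ nonemptySets t, {vote p}) := by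
    refine Derives.biUnion _ fun p _ => ?_
    exact (hcopy (Pi.single p.1 1 + ∑ j ∈ p.2, s j)).trans
      (Derives.gate (fun c _ => decide (bitVal c + ∑ j ∈ p.2, b j = 1)) (Or.inr rfl) (Or.inr rfl))
  set out : Fin q → List Bool → Bool := fun i x =>
    decide ((nonemptySets t).card < 2 * (((nonemptySets t).toList.map fun T => vote (i, T)).countP
      fun f => f x)) with hout
  have hmaj : Derives q ((Finset.univ : Finset (Fin q)).card *
      ((nonemptySets t).card * ((nonemptySets t).card * 2 + 2)))
      (P ∪ ⋃ p ∈ Finset.univ ×ˢ nonemptySets t, {vote p})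
      (⋃ i ∈ (Finset.univ : Finset (Fin q)), {out i}) := by
    refine Derives.biUnion _ fun i _ => ?_
    have h := Derives.majority (ℓ := q)
      (P := P ∪ ⋃ p ∈ Finset.univ ×ˢ nonemptySets t, {vote p})
      ((nonemptySets t).toList.map fun T => vote (i, T)) (by
        intro f hf
        obtain ⟨T, hT, rfl⟩ := List.mem_map.1 hf
        right
        simp only [Set.mem_iUnion]
        exact ⟨(i, T), Finset.mem_product.2 ⟨Finset.mem_univ _, Finset.mem_toList.1 hT⟩, rfl⟩)
      (Or.inl hP₀) (Or.inl hP₁)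
    rw [List.length_map, Finset.length_toList] at h
    exact h
  have htot := hconst.trans
    (((hvotes.trans hmaj).mono le_rfl (Set.subset_union_right (s := inputs)) subset_rfl))
  obtain ⟨D, hD, hDe⟩ := Derives.exists_circuit (List.ofFn out) (htot.mono le_rfl subset_rfl (by
    intro f hf
    obtain ⟨i, rfl⟩ := (List.mem_ofFn' _ _).1 hf
    simp only [Set.mem_iUnion]
    exact ⟨i, Finset.mem_univ _, rfl⟩))
  refine ⟨D, hD.trans ?_, fun y => ?_⟩
  · have hc : (nonemptySets t).card ≤ 2 ^ t := by rw [card_nonemptySets]; exact Nat.sub_le _ _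
    rw [Finset.card_product, Finset.card_univ, Fintype.card_fin]
    calc 2 + (q * (nonemptySets t).card * (C.size + 1) +
          q * ((nonemptySets t).card * ((nonemptySets t).card * 2 + 2)))
        = 2 + q * ((nonemptySets t).card * (C.size + 2 * (nonemptySets t).card + 3)) := by ring
      _ ≤ _ := by gcongr
  · have hy : (List.ofFn fun i : Fin q => (vecWord y).getD i false) = vecWord y := by
      refine List.ext_getElem (by simp) fun i h₁ h₂ => by simp [vecWord]
    rw [hDe _ (length_vecWord y), List.map_ofFn]
    refine congrArg List.ofFn (funext fun i => ?_)
    simp only [Function.comp_apply, hout, List.countP_map, bitEquiv, Equiv.coe_fn_mk, linearDecode,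
      hvote, hrun, hy, countP_toList, Function.comp_def]
    rw [decide_eq_decide]
    split_ifs with h
    · exact iff_of_true h rfl
    · exact iff_of_false h (by decide)

open Classical in
/-- A circuit that predicts the hard-core bit of `h` yields one that inverts `h`. -/
theorem exists_inverter {h : List Bool → List Bool} (hb : Function.Bijective h)
    (hl : ∀ v, (h v).length = v.length) {q p t S : ℕ} (hp : p ≤ 1) (hS : 1 ≤ S)
    (ht : 8 * q * S ^ 2 < 2 ^ t) {C : BoolCircuit}
    (hC : 1 / 2 + (1 / (S : ℝ)) / 2 ≤ wordProb (q + q + p) fun u => C.eval u = [hardCore h u]) :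
    ∃ D : BoolCircuit, D.size ≤ 2 + q * (2 ^ t * (C.size + 2 * 2 ^ t + 3)) ∧
      1 ≤ 4 * S * 2 ^ t * wordProb q fun v => D.eval (h v) = v := by
  obtain ⟨e, he, hcount⟩ := exists_suffix_card_ge hC
  have hS' : (0 : ℝ) < S := by exact_mod_cast hS
  -- On words of a fixed length `h` induces a permutation `π` of the vectors, so a sum over
  -- challenges can be reindexed by their preimages.
  have hπ : ∀ v : Fin q → ZMod 2, ∃ w : Fin q → ZMod 2, vecWord w = h (vecWord v) := fun v =>
    exists_vecWord_eq (by rw [hl, length_vecWord])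
  choose π hπ using hπ
  have hπb : Function.Bijective π := by
    refine Finite.injective_iff_bijective.1 fun v w hvw => vecWord_injective (hb.1 ?_)
    rw [← hπ, ← hπ, hvw]
  have hcore : ∀ v r, hardCore h (vecWord (π v) ++ vecWord r ++ e) = decide (v ⬝ᵥ r = 1) := by
    intro v r
    have hlen : (vecWord (π v) ++ vecWord r ++ e).length / 2 = q := by simp [he]; omega
    rw [hardCore, hlen, List.append_assoc, List.take_left' (length_vecWord _),
      List.drop_left' (length_vecWord _), hπ, Function.leftInverse_invFun hb.1, innerBit_vecWord]
  set B : (Fin q → ZMod 2) → (Fin q → ZMod 2) → ZMod 2 := fun v r =>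
    bitVal ((C.eval (vecWord (π v) ++ vecWord r ++ e)).getD 0 false) with hB
  have hagree : (2 : ℝ) ^ q * 2 ^ q ≤ S * ∑ v, ∑ r, agreement (B v) v r := by
    rw [← (Equiv.ofBijective π hπb).sum_comp] at hcount
    simp only [Equiv.ofBijective_apply] at hcount
    -- Only an inequality: a circuit without exactly one output counts as wrong, although the bit
    -- used for `B` may be right.
    have hle : ∀ v r, 2 * (if C.eval (vecWord (π v) ++ vecWord r ++ e) =
        [hardCore h (vecWord (π v) ++ vecWord r ++ e)] then 1 else 0 : ℝ) - 1 ≤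
        agreement (B v) v r := by
      intro v r
      unfold agreement
      split_ifs with h₁ h₂ <;> norm_num
      apply h₂
      rw [hB]
      dsimp only
      rw [h₁, hcore, List.getD_cons_zero, bitVal_decide]
    have hsum := Finset.sum_le_sum fun v (_ : v ∈ Finset.univ) =>
      Finset.sum_le_sum fun r (_ : r ∈ Finset.univ) => hle v r
    simp only [Finset.sum_sub_distrib, ← Finset.mul_sum, Finset.sum_const, Finset.card_univ,
      nsmul_eq_mul, mul_one] at hsum
    have hcard : (Fintype.card (Fin q → ZMod 2) : ℝ) = 2 ^ q := by simp [ZMod.card]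
    rw [hcard] at hsum
    have h₃ : (2 : ℝ) ^ q * 2 ^ q / S ≤ ∑ v, ∑ r, agreement (B v) v r := by
      refine le_trans ?_ hsum
      have : (1 / 2 + 1 / (S : ℝ) / 2) * (2 ^ q * 2 ^ q) =
        (2 ^ q * 2 ^ q) / 2 + (2 ^ q * 2 ^ q / S) / 2 := by ring
      rw [this] at hcount
      linarith
    rwa [div_le_iff₀' hS'] at h₃
  obtain ⟨s, b, hsb⟩ := exists_linearDecode hS ht B hagree
  obtain ⟨D, hD, hDe⟩ := exists_circuit_linearDecode C e s b
  refine ⟨D, hD, ?_⟩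
  have hset : (Finset.univ.filter fun v => linearDecode (B v) s b = v).card ≤
      (Finset.univ.filter fun v : Fin q → Bool =>
        D.eval (h (List.ofFn v)) = List.ofFn v).card := by
    refine Finset.card_le_card_of_injOn (bitEquiv q) ?_ (bitEquiv q).injective.injOn
    intro v hv
    have hv' := (Finset.mem_filter.1 hv).2
    simp only [Finset.coe_filter, Finset.mem_univ, true_and, Set.mem_ofPred_eq]
    change D.eval (h (vecWord v)) = vecWord v
    rw [← hπ, hDe]
    exact congrArg vecWord hv'
  rw [wordProb, ← mul_div_assoc, le_div_iff₀ (by positivity), one_mul]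
  refine hsb.trans ?_
  gcongr
  refine (le_of_eq ?_).trans (hset.trans (le_of_eq ?_)) <;> congr

/-- The left side is the base-two logarithm of `2 ^ 10 q ^ 3 S ^ 4` at `S = 2 ^ (1 + 3 q ^ (c /
2))`, which bounds both the size of the inverter and its loss in probability. -/
theorem eventually_lt_two_rpow {c : ℝ} (hc : 0 < c) : ∀ᶠ q : ℕ in atTop,
    (14 : ℝ) + 3 * Real.logb 2 q + 12 * (q : ℝ) ^ (c / 2) < (q : ℝ) ^ c := by
  have h₁ : (fun _ : ℝ => (14 : ℝ)) =o[atTop] fun x : ℝ => x ^ c :=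
    Asymptotics.isLittleO_const_left.2 (Or.inr (tendsto_norm_atTop_atTop.comp (tendsto_rpow_atTop hc)))
  have h₂ : (fun x : ℝ => 3 * Real.logb 2 x) =o[atTop] fun x : ℝ => x ^ c := by
    have : (fun x : ℝ => 3 * Real.logb 2 x) = fun x => (3 / Real.log 2) * Real.log x := by
      funext x; rw [Real.logb]; ring
    rw [this]
    exact (isLittleO_log_rpow_atTop hc).const_mul_left _
  have h₃ : (fun x : ℝ => 12 * x ^ (c / 2)) =o[atTop] fun x : ℝ => x ^ c := by
    have h := (Asymptotics.isLittleO_pow_pow_atTop_of_lt (𝕜 := ℝ) (p := 1) (q := 2)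
      (by norm_num)).comp_tendsto (tendsto_rpow_atTop (half_pos hc))
    refine (h.const_mul_left 12).congr' (Eventually.of_forall fun x => by simp) ?_
    filter_upwards [eventually_ge_atTop 0] with x hx
    rw [Function.comp_apply, ← Real.rpow_mul_natCast hx]
    congr 1
    push_cast
    ring
  have h := ((h₁.add h₂).add h₃).def (by norm_num : (0 : ℝ) < 1 / 2)
  refine ((tendsto_natCast_atTop_atTop (R := ℝ)).eventually (h.and (eventually_gt_atTop 0))).mono ?_
  rintro q ⟨hq, hq0⟩
  have hp := Real.rpow_pos_of_pos hq0 c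
  rw [Real.norm_eq_abs, Real.norm_eq_abs, abs_of_pos hp] at hq
  have := le_abs_self ((14 : ℝ) + 3 * Real.logb 2 q + 12 * (q : ℝ) ^ (c / 2))
  linarith

/-- It is used with `q = ℓ / 2`, where `ℓ ≤ 2 q + 1 ≤ 3 q`. Rounding up costs at most a factor of
two, since the power of two is at least one. -/
theorem poly_mul_pow_lt_two_rpow {c : ℝ} (hc : 0 < c) (hc1 : c ≤ 1) {ℓ q : ℕ} (hq : 1 ≤ q)
    (hℓ : ℓ ≤ 3 * q)
    (h : (14 : ℝ) + 3 * Real.logb 2 q + 12 * (q : ℝ) ^ (c / 2) < (q : ℝ) ^ c) :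
    2 ^ 10 * (q : ℝ) ^ 3 * (⌈(2 : ℝ) ^ ((ℓ : ℝ) ^ (c / 2))⌉₊ : ℝ) ^ 4 < 2 ^ ((q : ℝ) ^ c) := by
  have hq0 : (0 : ℝ) < q := by exact_mod_cast hq
  have hexp : (ℓ : ℝ) ^ (c / 2) ≤ 3 * (q : ℝ) ^ (c / 2) := by
    calc (ℓ : ℝ) ^ (c / 2) ≤ (3 * q : ℝ) ^ (c / 2) := by
          refine Real.rpow_le_rpow (Nat.cast_nonneg _) (by exact_mod_cast hℓ) (by linarith)
      _ = 3 ^ (c / 2) * (q : ℝ) ^ (c / 2) := Real.mul_rpow (by norm_num) hq0.le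
      _ ≤ 3 ^ (1 : ℝ) * (q : ℝ) ^ (c / 2) := by
          gcongr
          · norm_num
          · linarith
      _ = _ := by rw [Real.rpow_one]
  have hS : (⌈(2 : ℝ) ^ ((ℓ : ℝ) ^ (c / 2))⌉₊ : ℝ) ≤ 2 ^ (1 + 3 * (q : ℝ) ^ (c / 2)) := by
    have h1 : (1 : ℝ) ≤ 2 ^ ((ℓ : ℝ) ^ (c / 2)) :=
      Real.one_le_rpow (by norm_num) (by positivity)
    calc (⌈(2 : ℝ) ^ ((ℓ : ℝ) ^ (c / 2))⌉₊ : ℝ) ≤ 2 ^ ((ℓ : ℝ) ^ (c / 2)) + 1 :=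
          (Nat.ceil_lt_add_one (by positivity)).le
      _ ≤ 2 * 2 ^ ((ℓ : ℝ) ^ (c / 2)) := by linarith
      _ = 2 ^ (1 + (ℓ : ℝ) ^ (c / 2)) := by rw [Real.rpow_add (by norm_num), Real.rpow_one]
      _ ≤ _ := by
          refine Real.rpow_le_rpow_of_exponent_le (by norm_num) (by linarith)
  have hqlog : (q : ℝ) = 2 ^ Real.logb 2 q :=
    (Real.rpow_logb (by norm_num) (by norm_num) hq0).symm
  calc 2 ^ 10 * (q : ℝ) ^ 3 * (⌈(2 : ℝ) ^ ((ℓ : ℝ) ^ (c / 2))⌉₊ : ℝ) ^ 4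
      ≤ 2 ^ 10 * (q : ℝ) ^ 3 * (2 ^ (1 + 3 * (q : ℝ) ^ (c / 2))) ^ 4 := by gcongr
    _ = 2 ^ ((10 : ℕ) : ℝ) * (2 ^ (Real.logb 2 q * (3 : ℕ))) *
          2 ^ ((1 + 3 * (q : ℝ) ^ (c / 2)) * (4 : ℕ)) := by
        rw [Real.rpow_natCast, Real.rpow_mul_natCast (by norm_num),
          Real.rpow_mul_natCast (by norm_num), ← hqlog]
    _ = 2 ^ ((14 : ℝ) + 3 * Real.logb 2 q + 12 * (q : ℝ) ^ (c / 2)) := by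
        rw [← Real.rpow_add (by norm_num), ← Real.rpow_add (by norm_num)]
        congr 1
        push_cast
        ring
    _ < _ := Real.rpow_lt_rpow_of_exponent_lt (by norm_num) h

/-- Inner products with the preimage under an exponentially hard one-way permutation are
exponentially hard to predict. -/
theorem hasExpNWHardness_hardCore {h : List Bool → List Bool}
    (hh : IsExpHardOneWayPermutation h) : HasExpNWHardness (hardCore h) := by
  obtain ⟨-, hb, hl, a, b, ha, hb', hone⟩ := hh
  -- One exponent below both `a` and `b`; the cap at one makes `3 ^ (c / 2) ≤ 3`. Hardness is
  -- claimed with exponent `c / 2`, which leaves room for the polynomial losses in `q` and `S`.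
  set c := min (min a b) 1 with hc
  have hc0 : 0 < c := by simp [hc, ha, hb']
  have hhalf : Tendsto (fun ℓ : ℕ => ℓ / 2) atTop atTop :=
    tendsto_atTop_atTop.2 fun b => ⟨2 * b, fun a h => by omega⟩
  refine ⟨c / 2, by linarith, ?_⟩
  filter_upwards [hhalf.eventually hone, hhalf.eventually (eventually_lt_two_rpow hc0),
    hhalf.eventually (eventually_ge_atTop 1)] with ℓ hℓ hlt hq
  set q := ℓ / 2 with hqdef
  set S := ⌈(2 : ℝ) ^ ((ℓ : ℝ) ^ (c / 2))⌉₊ with hSdef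
  have hS : 1 ≤ S := Nat.ceil_pos.2 (by positivity)
  have hq1 : (1 : ℝ) ≤ q := by exact_mod_cast hq
  have hbound : 2 ^ 10 * (q : ℝ) ^ 3 * (S : ℝ) ^ 4 < 2 ^ ((q : ℝ) ^ c) :=
    poly_mul_pow_lt_two_rpow hc0 (min_le_right _ _) hq (by omega) hlt
  refine le_iSup₂_of_le S ⟨hS, fun C hC => ?_⟩ le_rfl
  by_contra hcon
  rw [not_lt] at hcon
  -- `2 ^ t` must exceed `8 q S²` for the decoding and may exceed it by a factor of two only, so
  -- that the inverter stays polynomial in `q` and `S`.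
  obtain ⟨t, ht, ht'⟩ : ∃ t, 8 * q * S ^ 2 < 2 ^ t ∧ 2 ^ t ≤ 16 * q * S ^ 2 := by
    refine ⟨Nat.log 2 (8 * q * S ^ 2) + 1, Nat.lt_pow_succ_log_self (by norm_num) _, ?_⟩
    rw [pow_succ]
    have := Nat.pow_log_le_self 2 (x := 8 * q * S ^ 2) (by positivity)
    linarith
  -- The additional letter of an odd length goes into the suffix that is fixed by averaging.
  have hℓq : ℓ = q + q + ℓ % 2 := by omega
  rw [hℓq] at hcon
  obtain ⟨D, hD, hprob⟩ := exists_inverter hb hl (by omega) hS ht hcon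
  have hsize : (D.size : ℝ) ≤ 2 ^ 10 * (q : ℝ) ^ 3 * (S : ℝ) ^ 4 := by
    have : D.size ≤ 2 ^ 10 * q ^ 3 * S ^ 4 := by
      have e₁ : C.size + 2 * 2 ^ t + 3 ≤ 36 * q * S ^ 2 := by
        have : 1 ≤ q * S ^ 2 := Nat.mul_pos hq (by positivity)
        have : S ≤ q * S ^ 2 := by nlinarith
        nlinarith
      have e₂ : 1 ≤ q ^ 3 * S ^ 4 := Nat.mul_pos (by positivity) (by positivity)
      calc D.size ≤ 2 + q * (2 ^ t * (C.size + 2 * 2 ^ t + 3)) := hD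
        _ ≤ 2 + q * ((16 * q * S ^ 2) * (36 * q * S ^ 2)) := by gcongr
        _ = 2 + 576 * (q ^ 3 * S ^ 4) := by ring
        _ ≤ 2 ^ 10 * q ^ 3 * S ^ 4 := by nlinarith
    exact_mod_cast this
  have hexp : ∀ d : ℝ, c ≤ d → (2 : ℝ) ^ ((q : ℝ) ^ c) ≤ 2 ^ ((q : ℝ) ^ d) := fun d hd =>
    Real.rpow_le_rpow_of_exponent_le (by norm_num) (Real.rpow_le_rpow_of_exponent_le hq1 hd)
  have hinv := hℓ D (hsize.trans (hbound.le.trans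
    (hexp b ((min_le_left _ _).trans (min_le_right _ _)))))
  rw [Real.rpow_neg (by norm_num)] at hinv
  have hS1 : (1 : ℝ) ≤ S := by exact_mod_cast hS
  have hK : 4 * (S : ℝ) * 2 ^ t < 2 ^ ((q : ℝ) ^ a) := by
    refine lt_of_le_of_lt ?_ (hbound.trans_le (hexp a ((min_le_left _ _).trans (min_le_left _ _))))
    have h₁ : (2 : ℝ) ^ t ≤ 16 * q * S ^ 2 := by exact_mod_cast ht'
    calc 4 * (S : ℝ) * 2 ^ t ≤ 4 * (S : ℝ) * (16 * q * S ^ 2) := by gcongr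
      _ = 64 * (q ^ 1 * S ^ 3) := by ring
      _ ≤ 2 ^ 10 * ((q : ℝ) ^ 3 * (S : ℝ) ^ 4) := by
          gcongr <;> norm_num
      _ = _ := by ring
  have hpos : (0 : ℝ) < 2 ^ ((q : ℝ) ^ a) := by positivity
  have : 4 * (S : ℝ) * 2 ^ t * (wordProb q fun v => D.eval (h v) = v) < 1 := by
    calc 4 * (S : ℝ) * 2 ^ t * (wordProb q fun v => D.eval (h v) = v)
        ≤ 4 * (S : ℝ) * 2 ^ t * (2 ^ ((q : ℝ) ^ a))⁻¹ := by gcongr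
      _ < 2 ^ ((q : ℝ) ^ a) * (2 ^ ((q : ℝ) ^ a))⁻¹ := by gcongr
      _ = 1 := mul_inv_cancel₀ hpos.ne'
  linarith

/-! ### Evaluation of propositional formulas -/

/-- Symbols of formulas: constants, variables, binary connectives (`false` is the conjunction) and
the negation. -/
abbrev FormTok : Type := Bool ⊕ List Bool ⊕ Bool ⊕ Unit

/-- The states of the lexical analysis, named by the bits read since the last symbol. -/
inductive LexMode : Type
  | start | zero | one | zeroZero | oneOne | name | nameBit

/-- Bits naming the states. -/
def LexMode.bits : LexMode → Bool × Bool × Bool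
  | .start => (false, false, false)
  | .zero => (false, false, true)
  | .one => (false, true, false)
  | .zeroZero => (false, true, true)
  | .oneOne => (true, false, false)
  | .name => (true, false, true)
  | .nameBit => (true, true, false)

theorem LexMode.bits_injective : Function.Injective LexMode.bits := by
  intro a b h
  cases a <;> cases b <;> simp_all [LexMode.bits]

instance : Finite LexMode := Finite.of_injective _ LexMode.bits_injective

instance : PEnc LexMode := ⟨fun m => enc m.bits, fun _ _ h => LexMode.bits_injective (enc_injective h)⟩

/-- The next state. -/
def LexMode.next : LexMode → Bool → LexMode
  | .start, false => .zero
  | .start, true => .one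
  | .zero, false => .zeroZero
  | .zero, true => .name
  | .one, false => .start
  | .one, true => .oneOne
  | .zeroZero, _ => .start
  | .oneOne, _ => .start
  | .name, false => .start
  | .name, true => .nameBit
  | .nameBit, _ => .name

/-- The symbol, other than a variable, completed by reading a bit. -/
def LexMode.emit : LexMode → Bool → List FormTok
  | .zeroZero, b => [.inl b]
  | .one, false => [.inr (.inr (.inl false))]
  | .oneOne, false => [.inr (.inr (.inl true))]
  | .oneOne, true => [.inr (.inr (.inr ()))]
  | _, _ => []

/-- Is the name of a variable being read? -/
def LexMode.isName : LexMode → Bool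
  | .name => true
  | _ => false

/-- Is the next bit a bit of the name of a variable? -/
def LexMode.isNameBit : LexMode → Bool
  | .nameBit => true
  | _ => false

/-- Is the word read so far a sequence of complete symbols? -/
def LexMode.isStart : LexMode → Bool
  | .start => true
  | _ => false

/-- One step of the lexical analysis; the symbols are collected in reverse order. -/
def lexStep (s : LexMode × List Bool × List FormTok) (b : Bool) :
    LexMode × List Bool × List FormTok :=
  (s.1.next b, bif s.1.isNameBit then s.2.1 ++ [b] else bif s.1.isName && b then s.2.1 else [],
    bif s.1.isName && !b then .inr (.inl s.2.1) :: s.2.2 else s.1.emit b ++ s.2.2)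

/-- The lexical analysis of a word. -/
def lex (s : List Bool) : LexMode × List Bool × List FormTok :=
  s.foldl lexStep (.start, [], [])

/-- The code of a symbol. -/
def FormTok.code : FormTok → List Bool
  | .inl b => [false, false, b]
  | .inr (.inl w) => [false, true] ++ w.flatMap (fun b => [true, b]) ++ [false]
  | .inr (.inr (.inl false)) => [true, false]
  | .inr (.inr (.inl true)) => [true, true, false]
  | .inr (.inr (.inr ())) => [true, true, true]

/-- The word read since the last complete symbol. -/
def LexMode.pending : LexMode → List Bool → List Bool
  | .start, _ => []
  | .zero, _ => [false]
  | .one, _ => [true]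
  | .zeroZero, _ => [false, false]
  | .oneOne, _ => [true, true]
  | .name, w => [false, true] ++ w.flatMap (fun b => [true, b])
  | .nameBit, w => [false, true] ++ w.flatMap (fun b => [true, b]) ++ [true]

/-- The state keeps enough to reconstruct the input. Hence a word on which the analysis ends in
`start` is a concatenation of codes of symbols, and the names found in a word cannot be longer than
the word. -/
theorem eq_flatMap_lex (s : List Bool) :
    s = (lex s).2.2.reverse.flatMap FormTok.code ++ (lex s).1.pending (lex s).2.1 := by
  induction s using List.reverseRecOn with
  | nil => rfl
  | append_singleton s b ih =>
    have hstep : lex (s ++ [b]) = lexStep (lex s) b := by simp [lex]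
    rw [hstep]
    conv_lhs => rw [ih]
    rcases lex s with ⟨m, w, acc⟩
    cases m <;> cases b <;>
      simp [lexStep, LexMode.next, LexMode.emit, LexMode.isName, LexMode.isNameBit,
        LexMode.pending, FormTok.code]

theorem foldl_lexStep_code (t : FormTok) (acc : List FormTok) :
    t.code.foldl lexStep (.start, [], acc) = (.start, [], t :: acc) := by
  have hname : ∀ (w u : List Bool), (w.flatMap fun b => [true, b]).foldl lexStep (.name, u, acc) =
      (.name, u ++ w, acc) := by
    intro w
    induction w with
    | nil => intro u; simp
    | cons b w ih =>
      intro u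
      have : lexStep (lexStep (.name, u, acc) true) b = (.name, u ++ [b], acc) := by
        simp [lexStep, LexMode.next, LexMode.emit, LexMode.isName, LexMode.isNameBit]
      simp only [List.flatMap_cons, List.foldl_append, List.foldl_cons, List.foldl_nil, this, ih]
      simp
  rcases t with b | w | (_ | _) | ⟨⟩
  · simp [FormTok.code, lexStep, LexMode.next, LexMode.emit, LexMode.isName, LexMode.isNameBit]
  · have h₁ : [false, true].foldl lexStep (.start, [], acc) = (.name, [], acc) := by
      simp [lexStep, LexMode.next, LexMode.emit, LexMode.isName, LexMode.isNameBit]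
    rw [FormTok.code, List.foldl_append, List.foldl_append, h₁, hname]
    simp [lexStep, LexMode.next, LexMode.isName, LexMode.isNameBit]
  all_goals
    simp [FormTok.code, lexStep, LexMode.next, LexMode.emit, LexMode.isName, LexMode.isNameBit]

theorem lex_flatMap_code (ts : List FormTok) :
    lex (ts.flatMap FormTok.code) = (.start, [], ts.reverse) := by
  have : ∀ acc, (ts.flatMap FormTok.code).foldl lexStep (.start, [], acc) =
      (.start, [], ts.reverse ++ acc) := by
    induction ts with
    | nil => intro acc; rfl
    | cons t ts ih =>
      intro acc
      rw [List.flatMap_cons, List.foldl_append, foldl_lexStep_code, ih]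
      simp
  rw [lex, this, List.append_nil]

/-- The symbols of a formula, in prefix notation. -/
def PropForm.toks : PropForm → List FormTok
  | .const b => [.inl b]
  | .var w => [.inr (.inl w)]
  | .neg φ => .inr (.inr (.inr ())) :: φ.toks
  | .and φ ψ => .inr (.inr (.inl false)) :: (φ.toks ++ ψ.toks)
  | .or φ ψ => .inr (.inr (.inl true)) :: (φ.toks ++ ψ.toks)

theorem PropForm.flatMap_toks (φ : PropForm) : φ.toks.flatMap FormTok.code = φ.code := by
  induction φ <;> simp_all [PropForm.toks, PropForm.code, FormTok.code, List.flatMap_append]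

/-- A binary connective acting on a stack of truth values; the first component records whether the
stack has never been too short. -/
def stackBin (o : Bool) (st : Bool × List Bool) : Bool × List Bool :=
  st.2.elimCons (false, []) fun a t => t.elimCons (false, []) fun b u =>
    (st.1, (bif o then a || b else a && b) :: u)

/-- The negation acting on a stack of truth values. -/
def stackNeg (st : Bool × List Bool) : Bool × List Bool :=
  st.2.elimCons (false, []) fun a t => (st.1, (!a) :: t)

/-- One step of the evaluation of a formula in prefix notation, read from right to left. -/
def evalStep (v : List Bool → Bool) (st : Bool × List Bool) (t : FormTok) : Bool × List Bool :=
  Sum.elim (fun b => (st.1, b :: st.2)) (Sum.elim (fun w => (st.1, v w :: st.2))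
    (Sum.elim (fun o => stackBin o st) fun _ => stackNeg st)) t

theorem foldl_evalStep_toks (v : List Bool → Bool) (φ : PropForm) (st : Bool × List Bool) :
    φ.toks.reverse.foldl (evalStep v) st = (st.1, φ.eval v :: st.2) := by
  induction φ generalizing st with
  | const b => rfl
  | var w => rfl
  | neg φ ih =>
    rw [PropForm.toks, List.reverse_cons, List.foldl_append, ih]
    simp [evalStep, stackNeg, PropForm.eval]
  | and φ ψ ihφ ihψ =>
    rw [PropForm.toks, List.reverse_cons, List.reverse_append, List.foldl_append,
      List.foldl_append, ihψ, ihφ]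
    simp [evalStep, stackBin, PropForm.eval]
  | or φ ψ ihφ ihψ =>
    rw [PropForm.toks, List.reverse_cons, List.reverse_append, List.foldl_append,
      List.foldl_append, ihψ, ihφ]
    simp [evalStep, stackBin, PropForm.eval]

/-- Invariant: the entries of the stack correspond to complete formulas whose symbols, concatenated,
are the part already read from right to left. An underflow clears the flag for good, so a flag that
is true at the end was true all along. -/
theorem exists_forms_of_foldl_evalStep {v : List Bool → Bool} (acc : List FormTok)
    (h : (acc.foldl (evalStep v) (true, [])).1 = true) : ∃ φs : List PropForm,
      acc.reverse = φs.flatMap PropForm.toks ∧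
      (acc.foldl (evalStep v) (true, [])).2.length = φs.length := by
  induction acc using List.reverseRecOn with
  | nil => exact ⟨[], rfl, rfl⟩
  | append_singleton acc t ih =>
    rw [List.foldl_append, List.foldl_cons, List.foldl_nil] at h ⊢
    generalize acc.foldl (evalStep v) (true, []) = r at h ih ⊢
    rcases r with ⟨ok, st⟩
    rcases t with b | w | o | ⟨⟩
    · obtain ⟨φs, h₁, h₂⟩ := ih h
      exact ⟨.const b :: φs, by simp [h₁, PropForm.toks], by simpa [evalStep] using h₂⟩
    · obtain ⟨φs, h₁, h₂⟩ := ih h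
      exact ⟨.var w :: φs, by simp [h₁, PropForm.toks], by simpa [evalStep] using h₂⟩
    · rcases st with _ | ⟨a, _ | ⟨b, st⟩⟩ <;>
        simp only [evalStep, Sum.elim_inr, Sum.elim_inl, stackBin, List.elimCons_nil,
          List.elimCons_cons, Bool.false_eq_true] at h ⊢
      obtain ⟨φs, h₁, h₂⟩ := ih h
      rcases φs with _ | ⟨φ, _ | ⟨ψ, φs⟩⟩ <;> simp at h₂
      cases o
      · exact ⟨.and φ ψ :: φs, by simp [h₁, PropForm.toks], by simpa using h₂⟩
      · exact ⟨.or φ ψ :: φs, by simp [h₁, PropForm.toks], by simpa using h₂⟩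
    · rcases st with _ | ⟨a, st⟩ <;>
        simp only [evalStep, Sum.elim_inr, stackNeg, List.elimCons_nil,
          List.elimCons_cons, Bool.false_eq_true] at h ⊢
      obtain ⟨φs, h₁, h₂⟩ := ih h
      rcases φs with _ | ⟨φ, φs⟩ <;> simp at h₂
      exact ⟨.neg φ :: φs, by simp [h₁, PropForm.toks], by simpa using h₂⟩

/-- Is the word the code of a formula that is true under the assignment? -/
def isTrueCode (v : List Bool → Bool) (s : List Bool) : Bool :=
  let e := (lex s).2.2.foldl (evalStep v) (true, [])
  (lex s).1.isStart && (e.1 && decide (e.2 = [true]))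

theorem isTrueCode_code (v : List Bool → Bool) (φ : PropForm) :
    isTrueCode v φ.code = φ.eval v := by
  rw [← φ.flatMap_toks, isTrueCode, lex_flatMap_code, foldl_evalStep_toks]
  simp [LexMode.isStart]

theorem exists_code_eq_of_isTrueCode {v : List Bool → Bool} {s : List Bool}
    (h : isTrueCode v s = true) : ∃ φ : PropForm, φ.code = s := by
  simp only [isTrueCode, Bool.and_eq_true, decide_eq_true_eq] at h
  obtain ⟨h₁, h₂, h₃⟩ := h
  obtain ⟨φs, h₄, h₅⟩ := exists_forms_of_foldl_evalStep _ h₂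
  rw [h₃] at h₅
  obtain ⟨φ, rfl⟩ := List.length_eq_one_iff.1 h₅.symm
  refine ⟨φ, ?_⟩
  have hs := eq_flatMap_lex s
  have hm : (lex s).1 = .start := by
    revert h₁
    cases (lex s).1 <;> simp [LexMode.isStart]
  rw [hm, h₄] at hs
  rw [hs]
  simp [LexMode.pending, φ.flatMap_toks]

/-- Words that are not codes need no separate treatment, because `isTrueCode` rejects them under
every assignment. -/
theorem mem_TAUT_iff {s : List Bool} : s ∈ TAUT ↔ ∀ v, isTrueCode v s = true := by
  constructor
  · rintro ⟨φ, rfl, hφ⟩ v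
    rw [isTrueCode_code, hφ]
  · intro h
    obtain ⟨φ, rfl⟩ := exists_code_eq_of_isTrueCode (h fun _ => true)
    exact ⟨φ, rfl, fun v => by rw [← isTrueCode_code, h]⟩

/-- The name in a symbol, if there is one. -/
def FormTok.names (t : FormTok) : List (List Bool) :=
  Sum.elim (fun _ => []) (Sum.elim (fun w => [w]) fun _ => []) t

/-- The names of the variables in the code of a formula. -/
def codeNames (s : List Bool) : List (List Bool) :=
  (lex s).2.2.flatMap FormTok.names

theorem isTrueCode_congr {v v' : List Bool → Bool} {s : List Bool}
    (h : ∀ w ∈ codeNames s, v w = v' w) : isTrueCode v s = isTrueCode v' s := by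
  have : ∀ (acc : List FormTok) (st : Bool × List Bool), (∀ w ∈ acc.flatMap FormTok.names, v w = v' w) →
      acc.foldl (evalStep v) st = acc.foldl (evalStep v') st := by
    intro acc
    induction acc with
    | nil => intro st _; rfl
    | cons t acc ih =>
      intro st h
      have ht : evalStep v st t = evalStep v' st t := by
        rcases t with b | w | o | u <;> try rfl
        simp [evalStep, h w (by simp [FormTok.names])]
      rw [List.foldl_cons, List.foldl_cons, ht]
      exact ih _ fun w hw => h w (by simp only [List.flatMap_cons, List.mem_append]; exact Or.inr hw)
  simp only [isTrueCode]
  rw [this _ _ h]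

/-- A variable `w` takes `2 |w| + 3` bits in a formula and `2 |w| + 1` in a list of blocks. This
controls both the length of a guessed assignment and the number of variables. -/
theorem length_encodeBlocks_codeNames (s : List Bool) :
    (encodeBlocks (codeNames s)).length ≤ s.length := by
  have h : ∀ acc : List FormTok, (encodeBlocks (acc.flatMap FormTok.names)).length ≤
      (acc.reverse.flatMap FormTok.code).length := by
    intro acc
    induction acc with
    | nil => simp [encodeBlocks]
    | cons t acc ih =>
      have ht : (encodeBlocks t.names).length ≤ t.code.length := by
        rcases t with b | w | (_ | _) | ⟨⟩ <;> simp [FormTok.names, FormTok.code, encodeBlocks]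
      have happ : encodeBlocks ((t :: acc).flatMap FormTok.names) =
          encodeBlocks t.names ++ encodeBlocks (acc.flatMap FormTok.names) := by
        simp [encodeBlocks]
      rw [happ, List.reverse_cons, List.flatMap_append, List.length_append, List.length_append]
      simp only [List.flatMap_cons, List.flatMap_nil, List.append_nil]
      omega
  have hs := congrArg List.length (eq_flatMap_lex s)
  rw [List.length_append] at hs
  exact (h _).trans (by omega)

/-! ### Polynomial-time evaluation -/

theorem FPoly.lex : FPoly _root_.lex := by
  have hn : FPoly fun p : LexMode × Bool => p.1.next p.2 := FPoly.of_finite _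
  have he : FPoly fun p : LexMode × Bool => p.1.emit p.2 := FPoly.of_finite _
  have h₁ : FPoly LexMode.isName := FPoly.of_finite _
  have h₂ : FPoly LexMode.isNameBit := FPoly.of_finite _
  refine FPoly.foldl (f := fun _ => lexStep) FPoly.id (FPoly.const _) ?_ ⟨fun _ => 40, .const 40, ?_⟩
  · unfold lexStep
    fun_prop
  · rintro x ⟨m, w, acc⟩ b -
    have hm : ∀ m : LexMode, size m = size m.bits := fun _ => rfl
    cases m <;> cases b <;>
      simp only [lexStep, LexMode.next, LexMode.emit, LexMode.isName, LexMode.isNameBit, hm,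
        LexMode.bits, size_prod, size_bool, size_word, size_append, size_cons, size_inl, size_inr,
        size_nil, size_unit, cond_true, cond_false, Bool.not_true, Bool.not_false, Bool.and_true,
        Bool.and_false] <;> omega

/-- An assignment is presented by the list `T` of the names that are true under it. -/
theorem FPoly.isTrueCode {γ : Type} [PEnc γ] {T : γ → List (List Bool)} {s : γ → List Bool}
    (hT : FPoly T) (hs : FPoly s) :
    FPoly fun x => isTrueCode (fun w => (T x).any fun u => decide (u = w)) (s x) := by
  have hl : FPoly fun x => _root_.lex (s x) := FPoly.lex.comp hs
  have hbin : FPoly fun p : Bool × Bool × List Bool => stackBin p.1 p.2 := by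
    unfold stackBin
    refine FPoly.elimCons (by fun_prop) (by fun_prop) ?_
    refine FPoly.elimCons (by fun_prop) (by fun_prop) (by fun_prop)
  have hneg : FPoly stackNeg := by
    unfold stackNeg
    exact FPoly.elimCons (by fun_prop) (by fun_prop) (by fun_prop)
  have hany : FPoly fun p : γ × List Bool => (T p.1).any fun u => decide (u = p.2) :=
    FPoly.any (f := fun (p : γ × List Bool) u => decide (u = p.2)) (by fun_prop) (by fun_prop)
  have hev : FPoly fun x => (_root_.lex (s x)).2.2.foldl
      (evalStep fun w => (T x).any fun u => decide (u = w)) (true, []) := by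
    refine FPoly.foldl (f := fun x => evalStep fun w => (T x).any fun u => decide (u = w))
      (by fun_prop) (FPoly.const _) ?_ ⟨fun _ => 10, .const 10, ?_⟩
    · unfold evalStep
      refine FPoly.sumCases (by fun_prop) (by fun_prop) ?_
      refine FPoly.sumCases (by fun_prop) ?_ ?_
      · have : FPoly fun p : List Bool × (List Bool ⊕ Bool ⊕ Unit) × γ × (Bool × List Bool) × FormTok =>
            (T p.2.2.1).any fun u => decide (u = p.1) :=
          hany.comp (g := fun p : List Bool × (List Bool ⊕ Bool ⊕ Unit) × γ × (Bool × List Bool) ×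
            FormTok => (p.2.2.1, p.1)) (by fun_prop)
        fun_prop
      · refine FPoly.sumCases (by fun_prop) ?_ (by fun_prop)
        exact hbin.comp (g := fun p : Bool × (Bool ⊕ Unit) × (List Bool ⊕ Bool ⊕ Unit) × γ ×
          (Bool × List Bool) × FormTok => (p.1, p.2.2.2.2.1)) (by fun_prop)
    · rintro x ⟨ok, st⟩ t -
      rcases t with b | w | o | u <;>
        simp only [evalStep, Sum.elim_inl, Sum.elim_inr, size_prod, size_bool, size_word,
          List.length_cons]
      · omega
      · omega
      · rcases st with _ | ⟨a, _ | ⟨b, st⟩⟩ <;>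
          simp only [stackBin, List.elimCons_nil, List.elimCons_cons, size_prod, size_bool, size_word,
            List.length_cons, List.length_nil] <;> omega
      · rcases st with _ | ⟨a, st⟩ <;>
          simp only [stackNeg, List.elimCons_nil, List.elimCons_cons, size_prod, size_bool, size_word,
            List.length_cons, List.length_nil] <;> omega
  have hst : FPoly LexMode.isStart := FPoly.of_finite _
  unfold _root_.isTrueCode
  dsimp only
  fun_prop

/-! ### Tautologies in exponential time -/

theorem FormTok.reverse_names (t : FormTok) : t.names.reverse = t.names := by
  rcases t with b | w | o <;> rfl

theorem FPoly.codeNames : FPoly _root_.codeNames := by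
  have hl : FPoly _root_.lex := FPoly.lex
  have h : FPoly fun s => (_root_.lex s).2.2.foldl (fun l t => FormTok.names t ++ l) [] := by
    refine FPoly.foldl (f := fun _ l t => FormTok.names t ++ l) (by fun_prop) (FPoly.const []) ?_
      ⟨fun s => 2 * size (_root_.lex s).2.2 + 10, ?_, ?_⟩
    · have : FPoly FormTok.names := by
        unfold FormTok.names
        refine FPoly.sumCases FPoly.id (by fun_prop) ?_
        exact FPoly.sumCases (by fun_prop) (by fun_prop) (by fun_prop)
      fun_prop
    · exact ((PolyBdd.const 2).mul (FPoly.size_bdd (by fun_prop))).add (.const 10)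
    · intro s l t ht
      have h₁ := size_le_of_mem ht
      have h₂ : size (FormTok.names t) ≤ 2 * size t + 10 := by
        rcases t with b | w | o <;>
          simp only [FormTok.names, Sum.elim_inl, Sum.elim_inr, size_nil, size_cons, size_inl,
            size_inr] <;> omega
      rw [size_append]
      dsimp only
      omega
  refine cast (congrArg _ ?_) h.reverse
  funext s
  have key : ∀ (acc : List FormTok) (l : List (List Bool)),
      acc.foldl (fun l t => FormTok.names t ++ l) l = (acc.flatMap FormTok.names).reverse ++ l := by
    intro acc
    induction acc with
    | nil => intro l; rfl
    | cons t acc ih => intro l; simp [ih, FormTok.reverse_names]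
  rw [key, List.append_nil, List.reverse_reverse]
  rfl

theorem isTrueCode_decodeBlocks (v : List Bool → Bool) {s : List Bool} {T : List (List Bool)}
    (hT : ∀ w ∈ codeNames s, w ∈ T ↔ v w = true) :
    isTrueCode (fun w => T.any fun u => decide (u = w)) s = isTrueCode v s := by
  refine isTrueCode_congr fun w hw => ?_
  rw [Bool.eq_iff_iff, ← hT w hw]
  simp

/-- The witness lists the variables of `s` that a falsifying assignment makes true; it is no longer
than `s`, far below the exponential bound. -/
theorem compl_TAUT_mem_NE : TAUTᶜ ∈ ClassNE := by
  refine ⟨fun s y => !isTrueCode (fun w => (decodeBlocks y).any fun u => decide (u = w)) s, 1,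
    FPoly.polyTimeRel2 ?_, fun s => ?_⟩
  · exact (FPoly.isTrueCode (T := fun p : List Bool × List Bool => decodeBlocks p.2)
      (s := fun p => p.1) (by fun_prop) (by fun_prop)).not
  · rw [Set.mem_compl_iff, mem_TAUT_iff]
    constructor
    · intro h
      push Not at h
      obtain ⟨v, hv⟩ := h
      refine ⟨encodeBlocks ((codeNames s).filter v), ?_, ?_⟩
      · have h₁ : (encodeBlocks ((codeNames s).filter v)).length ≤
            (encodeBlocks (codeNames s)).length := by
          rw [length_encodeBlocks, length_encodeBlocks]
          exact ((List.filter_sublist (l := codeNames s) (p := v)).map _).sum_le_sum (by simp)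
        have h₂ := length_encodeBlocks_codeNames s
        rw [one_mul]
        exact (h₁.trans h₂).trans Nat.lt_two_pow_self.le
      · dsimp only
        rw [decodeBlocks_encodeBlocks, isTrueCode_decodeBlocks v]
        · simpa using hv
        · intro w hw
          simp [hw]
    · rintro ⟨y, -, hy⟩ h
      dsimp only at hy
      rw [h] at hy
      simp at hy

/-- The entries of a list selected by a word. -/
def select {α : Type} (l : List α) (c : List Bool) : List α :=
  ((c.zip l).filter Prod.fst).map Prod.snd

@[fun_prop]
theorem FPoly.select {α γ : Type} [PEnc α] [PEnc γ] {l : γ → List α} {c : γ → List Bool}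
    (hl : FPoly l) (hc : FPoly c) : FPoly fun x => select (l x) (c x) := by
  unfold _root_.select
  exact FPoly.map (f := fun _ (p : Bool × α) => p.2)
    (FPoly.filter (f := fun _ (p : Bool × α) => p.1) (by fun_prop)
    (by fun_prop)) (by fun_prop)

theorem select_map {ι α : Type} (l : List ι) (f : ι → α) (v : ι → Bool) :
    select (l.map f) (l.map v) = (l.filter v).map f := by
  induction l with
  | nil => rfl
  | cons a l ih =>
    have : select ((a :: l).map f) ((a :: l).map v) =
        (if v a then [f a] else []) ++ select (l.map f) (l.map v) := by
      simp only [select, List.map_cons, List.zip_cons_cons, List.filter_cons]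
      split_ifs <;> simp
    rw [this, ih, List.filter_cons]
    split_ifs <;> simp

theorem select_map_eq_filter {α : Type} (l : List α) (v : α → Bool) :
    select l (l.map v) = l.filter v := by
  simpa using select_map l id v

/-- One step of the search through all assignments to `names`. -/
def searchStep (s : List Bool) (names : List (List Bool)) (st : Bool × List Bool) :
    Bool × List Bool :=
  (st.1 && isTrueCode (fun w => (select names st.2).any fun u => decide (u = w)) s, wordSucc st.2)

/-- The search through all assignments, with the length of `y` as the number of steps. -/
def tautVerifier (s y : List Bool) : Bool :=
  let st := y.foldl (fun st _ => searchStep s (codeNames s) st)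
    (true, (codeNames s).map fun _ => false)
  st.1 && !decide (st.2.length ≤ (codeNames s).length)

theorem foldl_searchStep (s : List Bool) (names : List (List Bool)) (y c : List Bool) :
    (y.foldl (fun st _ => searchStep s names st) (true, c)).2 = wordSucc^[y.length] c ∧
    ((y.foldl (fun st _ => searchStep s names st) (true, c)).1 = true ↔ ∀ i < y.length,
      isTrueCode (fun w => (select names (wordSucc^[i] c)).any fun u => decide (u = w)) s = true) := by
  induction y using List.reverseRecOn with
  | nil => simp
  | append_singleton y b ih =>
    rw [List.foldl_append, List.foldl_cons, List.foldl_nil, List.length_append, List.length_singleton]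
    refine ⟨?_, ?_⟩
    · rw [searchStep, ih.1, Function.iterate_succ_apply']
    · rw [searchStep, Bool.and_eq_true, ih.2, ih.1]
      constructor
      · rintro ⟨h₁, h₂⟩ i hi
        rcases Nat.lt_succ_iff_lt_or_eq.1 hi with hi | rfl
        · exact h₁ i hi
        · exact h₂
      · exact fun h => ⟨fun i hi => h i (by omega), h _ (by omega)⟩

/-- The witness carries no information and only supplies a clock for an exhaustive search: its
length is the number of rounds, and the search is complete once the counter of assignments has
overflowed. At most `|s|` variables occur, so `2 ^ |s|` rounds suffice. -/
theorem TAUT_mem_NE : TAUT ∈ ClassNE := by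
  refine ⟨tautVerifier, 1, FPoly.polyTimeRel2 ?_, fun s => ?_⟩
  · have hn : FPoly fun p : List Bool × List Bool => codeNames p.1 := FPoly.codeNames.comp (by fun_prop)
    have hinit : FPoly fun p : List Bool × List Bool => (codeNames p.1).map fun _ => false :=
      FPoly.map (f := fun _ _ => false) hn (FPoly.const false)
    have hfold : FPoly fun p : List Bool × List Bool =>
        p.2.foldl (fun st _ => searchStep p.1 (codeNames p.1) st)
          (true, (codeNames p.1).map fun _ => false) := by
      refine FPoly.foldl (f := fun (p : List Bool × List Bool) st _ =>
        searchStep p.1 (codeNames p.1) st) (by fun_prop) (by fun_prop) ?_ ⟨fun _ => 6, .const 6, ?_⟩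
      · have hn' : FPoly fun p : (List Bool × List Bool) × (Bool × List Bool) × Bool =>
            codeNames p.1.1 := FPoly.codeNames.comp (by fun_prop)
        have ht := FPoly.isTrueCode (T := fun p : (List Bool × List Bool) × (Bool × List Bool) × Bool =>
          select (codeNames p.1.1) p.2.1.2) (s := fun p => p.1.1) (by fun_prop) (by fun_prop)
        unfold searchStep
        fun_prop
      · rintro p ⟨ok, c⟩ b -
        have := length_wordSucc_le c
        simp only [searchStep, size_prod, size_bool, size_word]
        omega
    unfold tautVerifier
    dsimp only
    fun_prop
  · rw [mem_TAUT_iff]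
    set names := codeNames s with hnames
    set r := names.length with hr
    have hrep : (names.map fun _ => false) = List.replicate r false := by simp [hr]
    have hver : ∀ y, tautVerifier s y = true ↔ (∀ i < y.length, isTrueCode (fun w =>
        (select names (wordSucc^[i] (List.replicate r false))).any fun u => decide (u = w)) s = true) ∧
        r < (wordSucc^[y.length] (List.replicate r false)).length := by
      intro y
      obtain ⟨h₁, h₂⟩ := foldl_searchStep s names y (List.replicate r false)
      simp only [tautVerifier, ← hnames, hrep, Bool.and_eq_true, h₂, h₁]
      simp [hr]
    have hrs : r ≤ s.length := by
      refine le_trans ?_ (length_encodeBlocks_codeNames s)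
      rw [length_encodeBlocks, ← hnames]
      calc r = (names.map fun _ => 1).sum := by simp [hr]
        _ ≤ _ := List.sum_le_sum fun w _ => by omega
    constructor
    · intro h
      refine ⟨List.replicate (2 ^ r) false, ?_, (hver _).2 ⟨fun i _ => h _, ?_⟩⟩
      · rw [List.length_replicate, one_mul]
        exact Nat.pow_le_pow_right (by norm_num) hrs
      · rw [List.length_replicate]
        have h₁ := wordVal_lt (wordSucc^[2 ^ r] (List.replicate r false))
        rw [wordVal_iterate, wordVal_replicate, zero_add] at h₁
        exact (Nat.pow_lt_pow_iff_right (by norm_num)).1 h₁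
    · rintro ⟨y, -, hy⟩ v
      obtain ⟨h₁, h₂⟩ := (hver y).1 hy
      have hlen : 2 ^ r ≤ y.length := by
        by_contra hlt
        rw [not_le] at hlt
        rw [iterate_wordSucc_replicate hlt, length_binaryWord] at h₂
        exact lt_irrefl _ h₂
      have hw := wordVal_lt (names.map v)
      rw [List.length_map] at hw
      have h₃ := h₁ (wordVal (names.map v)) (hw.trans_le hlen)
      have h₄ := binaryWord_wordVal (names.map v)
      rw [List.length_map] at h₄
      rw [iterate_wordSucc_replicate hw, h₄, select_map_eq_filter] at h₃
      rw [← h₃, isTrueCode_decodeBlocks v]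
      intro w hw
      simp [hnames, hw]

/-! ### Seeds of the generator as advice -/

theorem select_charWord {n : ℕ} (X : Fin n → Bool) (J : Finset (Fin n)) :
    select (List.ofFn X) (charWord J) = restrictWord X J := by
  have hsort : (List.finRange n).filter (fun i => decide (i ∈ J)) = J.sort (· ≤ ·) := by
    refine List.Perm.eq_of_pairwise' (r := (· ≤ ·)) ?_ (Finset.pairwise_sort J (· ≤ ·)) ?_
    · exact ((List.pairwise_lt_finRange n).imp le_of_lt).filter _
    · rw [List.perm_ext_iff_of_nodup ((List.nodup_finRange n).filter _) (Finset.sort_nodup J _)]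
      simp
  rw [charWord, restrictWord, ← hsort, List.ofFn_eq_map, List.ofFn_eq_map, select_map]

theorem length_select_le {α : Type} (l : List α) (c : List Bool) : (select l c).length ≤ l.length := by
  rw [select, List.length_map]
  refine (List.length_filter_le _ _).trans ?_
  simp

theorem tendsto_logOut {δ : ℝ} (hδ : 0 < δ) : Tendsto (logOut δ) atTop atTop :=
  tendsto_nat_floor_atTop.comp ((tendsto_rpow_atTop hδ).comp tendsto_natCast_atTop_atTop)

/-- For `k = ⌊n ^ δ⌋ ≥ 2` one has `n ^ δ < k + 1 ≤ k²`, so a seed is polynomially long in the input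
length `k`. -/
theorem le_logOut_pow {δ : ℝ} (hδ : 0 < δ) {n : ℕ} (hn : 2 ≤ logOut δ n) :
    n ≤ logOut δ n ^ ⌈2 / δ⌉₊ := by
  set k := logOut δ n with hk
  have hk2 : (2 : ℝ) ≤ k := by exact_mod_cast hn
  have h₁ : (n : ℝ) ^ δ ≤ (k : ℝ) ^ (2 : ℝ) := by
    have : (n : ℝ) ^ δ < k + 1 := Nat.lt_floor_add_one _
    rw [Real.rpow_two]
    nlinarith
  have h₂ : (n : ℝ) ≤ (k : ℝ) ^ (2 / δ) := by
    calc (n : ℝ) = ((n : ℝ) ^ δ) ^ (1 / δ) := by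
          rw [← Real.rpow_mul (Nat.cast_nonneg n), mul_one_div_cancel hδ.ne', Real.rpow_one]
      _ ≤ ((k : ℝ) ^ (2 : ℝ)) ^ (1 / δ) :=
          Real.rpow_le_rpow (by positivity) h₁ (by positivity)
      _ = (k : ℝ) ^ (2 / δ) := by
          rw [← Real.rpow_mul (by positivity)]; congr 1; ring
  have h₃ : (n : ℝ) ≤ (k : ℝ) ^ ⌈2 / δ⌉₊ := by
    rw [← Real.rpow_natCast]
    exact h₂.trans (Real.rpow_le_rpow_of_exponent_le (by linarith) (Nat.le_ceil _))
  exact_mod_cast h₃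

/-- Evaluation of an output bit of the generator by a nondeterministic machine: `F₀` and `F₁`
decide, for any advice word of length at most `|x| ^ c₀`, the value of `f` at the subword of the
advice that is selected by `g`. -/
theorem exists_advice_predicates {f : List Bool → Bool} (hf : IsNPcoNPUnique f)
    {g : List Bool × ℕ → List Bool}
    (hg : PolyTime (Computability.encodingProd wordEnc Computability.unaryEncodingNat) wordEnc g)
    (c₀ : ℕ) : ∃ (F : Bool → List Bool → List Bool → List Bool → Bool) (c : ℕ), 1 ≤ c ∧ c₀ ≤ c ∧
      (∀ a, PolyTimeRel3 (F a)) ∧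
      (∀ x z, ∃ b : Bool, ∀ a,
        (∃ y : List Bool, y.length ≤ x.length ^ c ∧ F a x y z = true) ↔ b = a) ∧
      ∀ x z a, x ≠ [] → z.length ≤ x.length ^ c₀ →
        ((∃ y : List Bool, y.length ≤ x.length ^ c ∧ F a x y z = true) ↔
          f (select z (g (x, z.length))) = a) := by
  obtain ⟨F, c', hF, hFf, -⟩ := hf
  obtain ⟨p, hp, hpl⟩ := FPoly.exists_pow (α := Bool) c'
  obtain ⟨p₀, hp₀, hpl₀⟩ := FPoly.exists_pow (α := Bool) c₀
  -- Advice longer than `|x| ^ c₀` is replaced by the empty word. Thus `f` is only evaluated at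
  -- polynomially long words and, being total, has exactly one certified value for every advice
  -- word.
  set cut : List Bool → List Bool → List Bool := fun x z =>
    bif decide (z.length ≤ (p₀ x).length) then z else [] with hcut
  set u : List Bool → List Bool → List Bool := fun x z =>
    select (cut x z) (g (x, (cut x z).length)) with hu
  -- On the empty input only the empty witness is short enough, which need not suffice for `f`; the
  -- answer is fixed to `true` there.
  set G : Bool → List Bool → List Bool → List Bool → Bool := fun a x y z =>
    bif x.isEmpty then a else decide (y.length ≤ (p (u x z)).length) && F a (u x z) y with hG
  have hcut_le : ∀ x z, (cut x z).length ≤ x.length ^ c₀ := by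
    intro x z
    simp only [hcut, hpl₀]
    by_cases h : z.length ≤ x.length ^ c₀ <;> simp [h]
  have hiff : ∀ x z a, x ≠ [] → ((∃ y : List Bool, y.length ≤ x.length ^ (c₀ * c' + c₀ + 1) ∧
      G a x y z = true) ↔ f (u x z) = a) := by
    intro x z a hx
    have hx' : x.isEmpty = false := by simpa using hx
    have hpos : 1 ≤ x.length := List.length_pos_iff.2 hx
    rw [hFf]
    refine exists_congr fun y => ?_
    simp only [hG, hx', cond_false, Bool.and_eq_true, decide_eq_true_eq, hpl]
    refine ⟨fun h => h.2, fun h => ⟨h.1.trans ?_, h⟩⟩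
    calc (u x z).length ^ c' ≤ (x.length ^ c₀) ^ c' :=
          Nat.pow_le_pow_left ((length_select_le _ _).trans (hcut_le x z)) _
      _ = x.length ^ (c₀ * c') := (pow_mul _ _ _).symm
      _ ≤ _ := Nat.pow_le_pow_right hpos (by omega)
  -- Witnesses of `f` at words of length at most `|x| ^ c₀` need the exponent `c₀ * c'`; the other
  -- summands make the exponent positive and at least `c₀`.
  refine ⟨G, c₀ * c' + c₀ + 1, by omega, by omega, fun a => FPoly.polyTimeRel3 ?_,
    fun x z => ?_, fun x z a hx hz => ?_⟩
  · have hcutp : FPoly fun q : List Bool × List Bool × List Bool => cut q.1 q.2.2 := by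
      have := hp₀.comp (FPoly.of_fst (α := List Bool) (β := List Bool × List Bool))
      simp only [hcut]
      fun_prop
    have hgp : FPoly fun q : List Bool × List Bool × List Bool => g (q.1, (cut q.1 q.2.2).length) :=
      (FPoly.of_unary hg).comp (g := fun q : List Bool × List Bool × List Bool =>
        (q.1, cut q.1 q.2.2)) (FPoly.pair (by fun_prop) hcutp)
    have hup : FPoly fun q : List Bool × List Bool × List Bool => u q.1 q.2.2 :=
      FPoly.select hcutp hgp
    have hFp : FPoly fun q : List Bool × List Bool × List Bool => F a (u q.1 q.2.2) q.2.1 :=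
      (FPoly.of_polyTimeRel2 (hF a)).comp (g := fun q : List Bool × List Bool × List Bool =>
        (u q.1 q.2.2, q.2.1)) (hup.pair (by fun_prop))
    have hpp := hp.comp hup
    exact FPoly.cond (by fun_prop) (FPoly.const a) ((FPoly.length_le (by fun_prop) hpp).and hFp)
  · by_cases hx : x = []
    · subst hx
      refine ⟨true, fun a => ?_⟩
      simp [hG]
    · exact ⟨f (u x z), fun a => hiff x z a hx⟩
  · rw [hiff x z a hx]
    have : cut x z = z := by simp [hcut, hpl₀, hz]
    simp only [hu, this]

/-- If infinitely many truth tables of `L` are outputs of the generator, then `L` is infinitely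
often in `(NP ∩ coNP)/poly`. -/
theorem infinitelyOftenIn_of_truthTable_eq_nwGen {f : List Bool → Bool} (hf : IsNPcoNPUnique f)
    {δ : ℝ} (hδ : 0 < δ) (A : DesignSequence δ) {L : Set (List Bool)}
    (hL : ∀ K, ∃ k, K ≤ k ∧ ∃ n, ∃ X : Fin n → Bool, truthTable L k = nwGen (A.J n) f X) :
    InfinitelyOftenIn L ClassNPcoNPPoly := by
  classical
  obtain ⟨g, hg, hgJ⟩ := A.feasible
  set c₀ := ⌈2 / δ⌉₊ with hc₀
  obtain ⟨F, c, hc, hcc, hF, hdec, hval⟩ := exists_advice_predicates hf hg c₀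
  set good : ℕ → Prop := fun k => 2 ≤ k ∧ ∃ n, ∃ X : Fin n → Bool,
    truthTable L k = nwGen (A.J n) f X with hgood
  have hlog : ∀ {k n : ℕ} {X : Fin n → Bool}, truthTable L k = nwGen (A.J n) f X →
      k = logOut δ n := by
    intro k n X h
    have := congrArg List.length h
    rw [length_truthTable, nwGen, List.length_ofFn, outLen] at this
    exact Nat.pow_right_injective le_rfl this
  -- The advice for a good length is a seed that produces the truth table; at other lengths the
  -- empty word is used.
  have hw : ∀ k, ∃ w : List Bool, w.length ≤ k ^ c ∧ (good k → ∃ n, ∃ X : Fin n → Bool,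
      w = List.ofFn X ∧ truthTable L k = nwGen (A.J n) f X) := by
    intro k
    by_cases hk : good k
    · obtain ⟨hk2, n, X, h⟩ := hk
      refine ⟨List.ofFn X, ?_, fun _ => ⟨n, X, rfl, h⟩⟩
      have hkn := hlog h
      rw [List.length_ofFn]
      calc n ≤ k ^ c₀ := by rw [hkn] at hk2 ⊢; exact le_logOut_pow hδ hk2
        _ ≤ k ^ c := Nat.pow_le_pow_right (by omega) hcc
    · exact ⟨[], Nat.zero_le _, fun h => absurd h hk⟩
  choose w hwlen hwgood using hw
  refine ⟨{x | ∃ y : List Bool, y.length ≤ x.length ^ c ∧ F true x y (w x.length) = true},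
    ⟨F false, F true, c, w, hc, hF _, hF _, fun x z _ => ?_, hwlen, fun x => Iff.rfl⟩, ?_⟩
  · obtain ⟨b, hb⟩ := hdec x z
    rw [hb, hb]
    cases b <;> simp [Xor]
  · refine Set.infinite_of_forall_exists_gt fun K => ?_
    obtain ⟨k, hk, hex⟩ := hL (K + 2)
    refine ⟨k, fun x hx => ?_, by omega⟩
    obtain ⟨n, X, hwX, htab⟩ := hwgood k ⟨by omega, hex⟩
    have hkn := hlog htab
    have hi : wordVal x < 2 ^ k := hx ▸ wordVal_lt x
    have hi' : wordVal x < outLen δ n := by rw [outLen, ← hkn]; exact hi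
    have hword : binaryWord k (wordVal x) = x := hx ▸ binaryWord_wordVal x
    have hzlen : (w x.length).length ≤ x.length ^ c₀ := by
      rw [hx, hwX, List.length_ofFn]
      have : 2 ≤ logOut δ n := by omega
      rw [hkn]
      exact le_logOut_pow hδ this
    have hne : x ≠ [] := by
      rintro rfl
      simp at hx
      omega
    show _ ↔ ∃ y : List Bool, y.length ≤ x.length ^ c ∧ F true x y (w x.length) = true
    rw [hval x _ true hne hzlen, hx, hwX, List.length_ofFn]
    have hgx : g (x, n) = charWord (A.J n ⟨wordVal x, hi'⟩) := by
      rw [← hgJ n ⟨wordVal x, hi'⟩]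
      dsimp only
      rw [← hkn, hword]
    rw [hgx, select_charWord]
    -- Entry number `wordVal x` of the table tells whether `x ∈ L`; as an output bit of the
    -- generator it is `f` at the seed restricted to the design set of that index.
    have hbit := congrArg (fun l : List Bool => l[wordVal x]?) htab
    simp only [truthTable, nwGen, List.getElem?_ofFn, hi, hi', dif_pos, Option.some.injEq,
      hword] at hbit
    rw [← hbit, decide_eq_true_iff]

theorem classNPcoNPPoly_subset_classNPPoly : ClassNPcoNPPoly ⊆ ClassNPPoly := by
  rintro L ⟨F₀, F₁, c, w, hc, -, hF₁, -, hw, hL⟩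
  exact ⟨F₁, c, w, hc, hF₁, hw, hL⟩

/-- This supplies the infinity condition of the conjecture: every exponent `logOut δ n ≥ K` with `n
≥ 1` contributes a table, and these exponents are unbounded. -/
theorem infinite_truthTable_outLen {δ : ℝ} (hδ : 0 < δ) (L : Set (List Bool)) (K : ℕ) :
    {z ∈ {z | ∃ k, K ≤ k ∧ z = truthTable L k} | ∃ n, 1 ≤ n ∧ z.length = outLen δ n}.Infinite := by
  intro hfin
  obtain ⟨B, hB⟩ := (hfin.image List.length).bddAbove
  obtain ⟨n, hn, hKB⟩ := ((eventually_ge_atTop 1).and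
    ((tendsto_logOut hδ).eventually (eventually_ge_atTop (max K B)))).exists
  have hmem := hB ⟨truthTable L (logOut δ n), ⟨⟨_, (le_max_left _ _).trans hKB, rfl⟩, n, hn,
    length_truthTable _ _⟩, rfl⟩
  rw [length_truthTable] at hmem
  have : logOut δ n < 2 ^ logOut δ n := Nat.lt_two_pow_self
  have := (le_max_right _ _).trans hKB
  omega

end FeasibleFunctions

theorem lemma2p3
    (A : (δ : Set.Ioc (0 : ℝ) (1 / 3)) → DesignSequence (δ : ℝ))
    (hConj : NWConjecture A)
    (hOWP : ∃ h : List Bool → List Bool, IsExpHardOneWayPermutation h) :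
    (∀ L : Set (List Bool), L ∈ ClassNE ∩ ClassCoNE → InfinitelyOftenIn L ClassNPcoNPPoly) ∧
      InfinitelyOftenIn TAUT ClassNPPoly := by
  obtain ⟨h, hh⟩ := hOWP
  have hf : IsNPcoNPUnique (hardCore h) := isNPcoNPUnique_hardCore hh.1 hh.2.1 hh.2.2.1
  -- `δ` depends on the hard-core bit alone and is chosen before any NP set, so it serves all
  -- languages and all lower bounds `K` below.
  obtain ⟨δ, hδ⟩ := hConj _ hf (hasExpNWHardness_hardCore hh)
  have main : ∀ L : Set (List Bool), L ∈ ClassNE ∩ ClassCoNE →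
      InfinitelyOftenIn L ClassNPcoNPPoly := by
    rintro L ⟨hL, hLc⟩
    refine infinitelyOftenIn_of_truthTable_eq_nwGen hf δ.2.1 (A δ) fun K => ?_
    -- The bound is shifted to `K + 1` because the NP set of tables requires a positive one.
    obtain ⟨_, ⟨n, -, X, rfl⟩, k, hk, hX⟩ := hδ _
      (setOf_truthTable_mem_NP hL hLc (Nat.le_add_left 1 K))
      (infinite_truthTable_outLen δ.2.1 L (K + 1))
    exact ⟨k, by omega, n, X, hX.symm⟩
  refine ⟨main, ?_⟩
  obtain ⟨L, hL, hinf⟩ := main TAUT ⟨TAUT_mem_NE, compl_TAUT_mem_NE⟩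
  exact ⟨L, classNPcoNPPoly_subset_classNPPoly hL, hinf⟩
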